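/- Let $L,E_0,\sigma_c,G_c>0$, $I=[-L,L]$, and let $g:I\to\mathbb R$ be bounded, $\|g\|_\infty=\sup_I|g|$. Consider meshes $\mathcal T_h$ of $I$ (finite partitions into intervals, called elements, not necessarily of equal length) whose largest element has length $h\to0$, and $\epsilon_h>0$ with $\epsilon_h\to0$ and $h=o(\epsilon_h)$. Let $\mathbb P^1_h$ be the continuous functions on $I$ that are affine on each element and $\mathbb P^0_h$ the functions that are constant on each element. With $a(d)=(1-d)^2$ and $\bar d_h$ the elementwise mean of $d_h$, set for $u_h,d_h\in\mathbb P^1_h$ and $0\le\eta_h\in\mathbb P^0_h$ $$F_h(u_h,\eta_h,d_h)=\int_I\tfrac12E_0|u_h'-\eta_h|^2\,dx+\int_I a(\bar d_h)\,\sigma_c\,\eta_h\,dx+\tfrac{G_c}{2}\int_I\Big(\tfrac1{\epsilon_h}d_h^2+\epsilon_h|d_h'|^2\Big)dx,$$ $$\mathcal F_h(u_h,d_h)=\min\{F_h(u_h,\eta_h,d_h):\eta_h\in\mathbb P^0_h,\ \eta_h\ge0\}.$$ Define $\widetilde{\mathcal F}_h:L^1(I)\times L^1(I)\to[0,+\infty]$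 by $\widetilde{\mathcal F}_h(u,d)=\mathcal F_h(u,d)$ if $u,d\in\mathbb P^1_h$, $\|u\|_\infty\le\|g\|_\infty$, $0\le d\le1$ on $I$, $u(\pm L)=g(\pm L)$ and $d(\pm L)=0$, and $\widetilde{\mathcal F}_h(u,d)=+\infty$ otherwise. For $u\in BV(I)$ let $u'$ be the density of the absolutely continuous part of the derivative $Du$ (a measure on $(-L,L)$), $D^cu$ its Cantor part, $J_u\subset(-L,L)$ the set of jump points, $[u](x)=u(x^+)-u(x^-)$ the jump at $x$, and $u(L^-)$, $u(-L^+)$ the one-sided limits at the end points. Let $$W(s)=\begin{cases}\tfrac12E_0s^2,& s\le\sigma_c/E_0,\\ \sigma_cs-\tfrac{\sigma_c^2}{2E_0},& s>\sigma_c/E_0,\end{cases}\qquad \phi(s)=\begin{cases}\dfrac{G_c\sigma_cs}{G_c+\sigma_cs},& s\ge0,\\ +\infty,& s<0,\end{cases}$$ $$\mathcal F(u)=\int_IW(u')\,dx+\sigma_c|D^cu|(I)+\sum_{x\in J_u}\phi([u](x))+\phi\big(g(L)-u(L^-)\big)+\phi\big(u(-L^+)-g(-L)\big).$$ Theorem.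 As $h\to0$, the functionals $\widetilde{\mathcal F}_h$ $\Gamma$-converge in $L^1(I)\times L^1(I)$ to the functional $\widetilde{\mathcal F}:L^1(I)\times L^1(I)\to[0,+\infty]$ given by $\widetilde{\mathcal F}(u,d)=\mathcal F(u)$ if $u\in BV(I)$, $\|u\|_\infty\le\|g\|_\infty$, $[u]>0$ on $J_u$, $D^cu\ge0$ and $d=0$ a.e. in $I$, and $\widetilde{\mathcal F}(u,d)=+\infty$ otherwise. That is, for every sequence of such meshes with $h\to0$: (i) if $(u_h,d_h)\to(u,d)$ in $L^1(I)\times L^1(I)$, then $\widetilde{\mathcal F}(u,d)\le\liminf_{h\to0}\widetilde{\mathcal F}_h(u_h,d_h)$; (ii) for every $(u,d)\in L^1(I)\times L^1(I)$ there are $(u_h,d_h)\to(u,d)$ in $L^1(I)\times L^1(I)$ with $\limsup_{h\to0}\widetilde{\mathcal F}_h(u_h,d_h)\le\widetilde{\mathcal F}(u,d)$. -/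

import Mathlib

open MeasureTheory Set Filter Topology
open scoped ENNReal

noncomputable section

namespace CohesiveGamma

/-! ### Gamma-convergence -/

/-- Sequential Gamma-convergence of `[0,∞]`-valued functionals: the liminf inequality along every
convergent sequence, and the existence of a recovery sequence at every point. -/
def GammaConverges {X : Type*} [TopologicalSpace X] (F : ℕ → X → ℝ≥0∞) (F₀ : X → ℝ≥0∞) : Prop :=
  (∀ (x : X) (y : ℕ → X), Tendsto y atTop (𝓝 x) →
      F₀ x ≤ liminf (fun n => F n (y n)) atTop) ∧
    ∀ x : X, ∃ y : ℕ → X, Tendsto y atTop (𝓝 x) ∧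
      limsup (fun n => F n (y n)) atTop ≤ F₀ x

/-! ### The interval and its meshes -/

/-- The space `L¹(I)` for `I = [-L, L]`, with its norm topology. -/
abbrev L1 (L : ℝ) : Type := Lp ℝ 1 (volume.restrict (Icc (-L) L))

/-- A mesh of `[-L, L]`: nodes `-L = x₀ < x₁ < ⋯ < x_N = L`. The elements are the intervals
`[x_i, x_{i+1}]`; they need not have equal length. -/
structure Mesh (L : ℝ) where
  N : ℕ
  node : Fin (N + 1) → ℝ
  strictMono : StrictMono node
  node_zero : node 0 = -L
  node_last : node (Fin.last N) = L

namespace Mesh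

variable {L : ℝ} (T : Mesh L)

/-- Left endpoint of the `i`-th element. -/
def left (i : Fin T.N) : ℝ := T.node i.castSucc

/-- Right endpoint of the `i`-th element. -/
def right (i : Fin T.N) : ℝ := T.node i.succ

/-- The mesh size: the largest length of an element. -/
def size : ℝ := ⨆ i : Fin T.N, (T.right i - T.left i)

/-- `v` is (on `[-L, L]`) a `P1` finite element function: affine on each closed element. Continuity
on `[-L, L]` follows, as neighbouring elements share a node. -/
def IsP1 (v : ℝ → ℝ) : Prop :=
  ∀ i : Fin T.N, ∃ p q : ℝ, ∀ x ∈ Icc (T.left i) (T.right i), v x = p * x + q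

/-- The mean value of `v` on the `i`-th element. -/
def mean (v : ℝ → ℝ) (i : Fin T.N) : ℝ := ⨍ x in Icc (T.left i) (T.right i), v x

end Mesh

/-! ### Constitutive functions -/

/-- The degradation function `a(d) = (1 - d)²`. -/
def degr (d : ℝ) : ℝ := (1 - d) ^ 2

/-- The reduced density `f(s,r) = min {½ E₀ (s - η)² + a(r) σ η : η ≥ 0}` in closed form. -/
def density (E₀ σ s r : ℝ) : ℝ :=
  if s ≤ degr r * σ / E₀ then E₀ / 2 * s ^ 2
  else degr r * σ * s - σ ^ 2 / (2 * E₀) * degr r ^ 2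

/-- The bulk energy density `W(s) = f(s,0)`. -/
def W (E₀ σ s : ℝ) : ℝ := density E₀ σ s 0

/-- The cohesive density: `φ(s) = G σ s / (G + σ s)` for `s ≥ 0` and `φ(s) = +∞` for `s < 0`. -/
def phi (σ G s : ℝ) : ℝ≥0∞ :=
  if 0 ≤ s then ENNReal.ofReal (G * σ * s / (G + σ * s)) else ⊤

/-! ### The discrete functionals -/

/-- The full discrete energy
`F_h(u,η,d) = ∫ ½E₀|u' - η|² + ∫ a(d̄) σ η + G/2 ∫ (d²/ε + ε|d'|²)`,
for `u`, `d` in `P1` and `η` in `P0`. A `P0` function is given by its values on the elements, and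
`d̄` is the elementwise mean of `d`. -/
def fullEnergy {L : ℝ} (E₀ σ G : ℝ) (T : Mesh L) (ε : ℝ) (u : ℝ → ℝ) (η : Fin T.N → ℝ)
    (d : ℝ → ℝ) : ℝ :=
  (∑ i : Fin T.N, ∫ x in (T.left i)..(T.right i), E₀ / 2 * (deriv u x - η i) ^ 2) +
    (∑ i : Fin T.N, ∫ _ in (T.left i)..(T.right i), degr (T.mean d i) * σ * η i) +
    G / 2 * ∫ x in (-L)..L, (1 / ε * d x ^ 2 + ε * deriv d x ^ 2)

/-- The reduced energy `𝓕_h(u,d) = min {F_h(u,η,d) : η ∈ P0, η ≥ 0}`. -/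
def reducedEnergy {L : ℝ} (E₀ σ G : ℝ) (T : Mesh L) (ε : ℝ) (u d : ℝ → ℝ) : ℝ≥0∞ :=
  ⨅ (η : Fin T.N → ℝ) (_ : ∀ i, 0 ≤ η i), ENNReal.ofReal (fullEnergy E₀ σ G T ε u η d)

/-- `‖g‖_∞ = sup_{[-L,L]} |g|`. -/
def supNorm (L : ℝ) (g : ℝ → ℝ) : ℝ := sSup ((fun x => |g x|) '' Icc (-L) L)

/-- The constraints on discrete pairs: `u, d ∈ P1`, `‖u‖_∞ ≤ ‖g‖_∞`, `0 ≤ d ≤ 1`, and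
`u = g`, `d = 0` at `±L`. -/
structure Admissible {L : ℝ} (g : ℝ → ℝ) (T : Mesh L) (u d : ℝ → ℝ) : Prop where
  u_P1 : T.IsP1 u
  d_P1 : T.IsP1 d
  u_bound : ∀ x ∈ Icc (-L) L, |u x| ≤ supNorm L g
  d_mem : ∀ x ∈ Icc (-L) L, d x ∈ Icc (0 : ℝ) 1
  u_left : u (-L) = g (-L)
  u_right : u L = g L
  d_left : d (-L) = 0
  d_right : d L = 0

/-- The extension of the reduced energy to `L¹(I) × L¹(I)`: its value is `𝓕_h(v,δ)` if the two
classes are represented by an admissible pair `(v,δ)` of `P1` functions (which is then unique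
on `[-L, L]`), and `+∞` (the infimum of the empty family) otherwise. -/
def discreteFunctional {L : ℝ} (E₀ σ G : ℝ) (g : ℝ → ℝ) (T : Mesh L) (ε : ℝ)
    (p : L1 L × L1 L) : ℝ≥0∞ :=
  ⨅ (v : ℝ → ℝ) (δ : ℝ → ℝ) (_ : Admissible g T v δ)
    (_ : (p.1 : ℝ → ℝ) =ᵐ[volume.restrict (Icc (-L) L)] v)
    (_ : (p.2 : ℝ → ℝ) =ᵐ[volume.restrict (Icc (-L) L)] δ),
    reducedEnergy E₀ σ G T ε v δ

/-! ### Functions of bounded variation on `(-L, L)`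

An element of `L¹(I)` lies in `BV(I)` iff it has a representative which is the restriction of a
function `w : ℝ → ℝ` of bounded variation. Its distributional derivative `Du` on `(-L, L)` is then
the Lebesgue-Stieltjes measure of `w`, and the one-sided limits of `u` at a point are
those of `w`. All the notions below only depend on the a.e. class of `w` on `(-L, L)`. -/

/-- The measure derivative `Du` on the open interval `(-L, L)`. -/
def measDeriv (L : ℝ) {w : ℝ → ℝ} (hw : BoundedVariationOn w univ) : SignedMeasure ℝ :=
  hw.vectorMeasure.restrict (Ioo (-L) L)

/-- The jump `w(x⁺) - w(x⁻)`. -/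
def jump (w : ℝ → ℝ) (x : ℝ) : ℝ := Function.rightLim w x - Function.leftLim w x

/-- The set `J_u` of the jump points in `(-L, L)`. -/
def jumpSet (L : ℝ) (w : ℝ → ℝ) : Set ℝ := {x ∈ Ioo (-L) L | jump w x ≠ 0}

/-- The approximate gradient `u'`: the density of the absolutely continuous part of `Du`. -/
def absGrad (L : ℝ) {w : ℝ → ℝ} (hw : BoundedVariationOn w univ) : ℝ → ℝ :=
  (measDeriv L hw).rnDeriv volume

/-- The Cantor part `D^c u`: the singular part of `Du` away from the jump set (a countable set). -/
def cantorPart (L : ℝ) {w : ℝ → ℝ} (hw : BoundedVariationOn w univ) : SignedMeasure ℝ :=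
  ((measDeriv L hw).singularPart volume).restrict (jumpSet L w)ᶜ

/-- The limit energy
`𝓕(u) = ∫ W(u') + σ |D^c u|(I) + ∑_{J_u} φ([u]) + φ(g(L) - u(L⁻)) + φ(u(-L⁺) - g(-L))`. -/
def limitEnergy (L E₀ σ G : ℝ) (g : ℝ → ℝ) {w : ℝ → ℝ} (hw : BoundedVariationOn w univ) : ℝ≥0∞ :=
  (∫⁻ x in Icc (-L) L, ENNReal.ofReal (W E₀ σ (absGrad L hw x))) +
    ENNReal.ofReal σ * (cantorPart L hw).totalVariation (Ioo (-L) L) +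
    (∑' x : jumpSet L w, phi σ G (jump w x)) +
    phi σ G (g L - Function.leftLim w L) +
    phi σ G (Function.rightLim w (-L) - g (-L))

/-- The limit functional on `L¹(I) × L¹(I)`: its value is `𝓕(u)` if `u ∈ BV(I)`,
`‖u‖_∞ ≤ ‖g‖_∞`, all the jumps of `u` in `(-L, L)` are positive, `D^c u ≥ 0` and `d = 0` a.e.;
otherwise it is `+∞` (the infimum of the empty family). The infimum only ranges over the choice of a
representative `w` of `u`, and does not depend on this choice. -/
def limitFunctional (L E₀ σ G : ℝ) (g : ℝ → ℝ) (p : L1 L × L1 L) : ℝ≥0∞ :=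
  ⨅ (w : ℝ → ℝ) (hw : BoundedVariationOn w univ)
    (_ : (p.1 : ℝ → ℝ) =ᵐ[volume.restrict (Icc (-L) L)] w)
    (_ : ∀ᵐ x ∂(volume.restrict (Icc (-L) L)), |(p.1 : ℝ → ℝ) x| ≤ supNorm L g)
    (_ : ∀ x ∈ jumpSet L w, 0 < jump w x)
    (_ : 0 ≤ cantorPart L hw)
    (_ : (p.2 : ℝ → ℝ) =ᵐ[volume.restrict (Icc (-L) L)] 0),
    limitEnergy L E₀ σ G g hw

end CohesiveGamma

end

/-!
A function `w` of finite limit energy, extended by `g(±L)` to the left and to the right of the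
interval, is the primitive of a density `f ∈ L²(-L, L)` plus a nonnegative measure `ν` on `[-L, L]`:
the elastic strain and the slip. The mismatches with the boundary data are the atoms of `ν` at `±L`.
As `W(s)` is the minimum of `E₀/2 (s - m)² + σ m` over `m ≥ 0`, the
limit energy of `w` is the minimum, over all such splittings (`IsSplitting`), of
`E₀/2 ∫ f² + ∫ G σ / (G + σ ν{x}) dν(x)`; the second term (`cohesiveEnergy`) equals `σ` times the
diffuse mass of `ν` plus the sum of `φ` over its atoms. The minimum is attained
(`limitEnergy_primitive_le`, `exists_splitting_of_limitEnergy`). The discrete energy has the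
same structure, with `f = u' - η` and `ν = η dx`.

*Liminf inequality* (`exists_splitting_of_energy_le`). For a sequence of bounded energy,
`u' - η` converges weakly in `L²`, hence the increasing primitives of `η` converge almost everywhere
and Helly's argument yields `ν`. The damage term `G/2 (d²/ε + ε d'²) ≥ G |d d'|` makes a transition
of `d` from `0` to its maximum `m` and back cost at least `G m²`, so on an interval with slip `s`
the energy is at least `(1 - m)² σ s + G m² ≥ G σ s / (G + σ s)`, up to small errors. Summing over
a partition whose nodes are not atoms and refining it gives `cohesiveEnergy`
(`sum_cohesive_le`, `cohesiveEnergy_le_of_partition`).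

*Recovery sequence* (`eventually_exists_recovery`). Let `w` be the primitive of an optimal
splitting. The stretched function `w (lam x)`, `lam > 1`, attains the boundary values continuously,
so that its nodal interpolant is admissible. The slip on an element is the density of `ν` on the
stretched element, and the damage is the interpolant of the maximum of finitely many
optimal profiles `β exp (-|x - y| / ε)` at the atoms, with `β = σ s / (G + σ s)` minimizing
`(1 - β)² σ s + G β²`. The assumption `h = o(ε)` makes the oscillation of the profiles on an element
negligible. Letting `h → 0`, then `lam → 1` and the set of atoms increase, one obtains the
limit energy, and a diagonal argument (`exists_recovery_of_approx`) concludes.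
-/

open MeasureTheory Set Filter Topology
open scoped ENNReal

noncomputable section

namespace CohesiveGamma

/-! ### Primitives of a density plus a measure -/

/-- The right-continuous function with value `c` at `-∞` and derivative `f dx + ν`. -/
def primitive (c : ℝ) (f : ℝ → ℝ) (ν : Measure ℝ) (x : ℝ) : ℝ :=
  c + (∫ t in Iic x, f t) + ν.real (Iic x)

theorem primitive_sub {c : ℝ} {f : ℝ → ℝ} (hf : Integrable f) (ν : Measure ℝ) [IsFiniteMeasure ν]
    {a b : ℝ} (hab : a ≤ b) :
    primitive c f ν b - primitive c f ν a = (∫ t in Ioc a b, f t) + ν.real (Ioc a b) := by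
  have h1 : (∫ t in Iic b, f t) = (∫ t in Iic a, f t) + ∫ t in Ioc a b, f t := by
    rw [← Iic_union_Ioc_eq_Iic hab, setIntegral_union _ measurableSet_Ioc hf.integrableOn
      hf.integrableOn]
    exact Set.disjoint_left.2 fun x hx hx' => not_lt.2 hx hx'.1
  have h2 : ν.real (Iic b) = ν.real (Iic a) + ν.real (Ioc a b) := by
    rw [← Iic_union_Ioc_eq_Iic hab, measureReal_union _ measurableSet_Ioc]
    exact Set.disjoint_left.2 fun x hx hx' => not_lt.2 hx hx'.1
  simp only [primitive, h1, h2]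
  ring

/-- The variation is dominated by that of the primitive of `|f| dx + ν`. -/
theorem boundedVariationOn_primitive (c : ℝ) {f : ℝ → ℝ} (hf : Integrable f) (ν : Measure ℝ)
    [IsFiniteMeasure ν] : BoundedVariationOn (primitive c f ν) univ := by
  have hmono : Monotone (primitive 0 (fun x => |f x|) ν) := by
    intro a b hab
    have := primitive_sub (c := 0) hf.abs ν hab
    have h1 : 0 ≤ ∫ t in Ioc a b, |f t| := integral_nonneg fun _ => abs_nonneg _
    have h2 : 0 ≤ ν.real (Ioc a b) := measureReal_nonneg
    linarith
  have hbd : ∀ x ∈ univ, |primitive 0 (fun x => |f x|) ν x| ≤ (∫ t, |f t|) + ν.real univ := by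
    intro x _
    have h1 : 0 ≤ ∫ t in Iic x, |f t| := integral_nonneg fun _ => abs_nonneg _
    have h2 : 0 ≤ ν.real (Iic x) := measureReal_nonneg
    have h3 : ν.real (Iic x) ≤ ν.real univ := measureReal_mono (subset_univ _)
    have h4 : ∫ t in Iic x, |f t| ≤ ∫ t, |f t| :=
      setIntegral_le_integral hf.abs (Eventually.of_forall fun _ => abs_nonneg _)
    rw [primitive, abs_of_nonneg (by positivity)]
    linarith
  have hbv := (hmono.monotoneOn univ).boundedVariationOn hbd
  refine ne_top_of_le_ne_top hbv ?_
  refine iSup_mono fun p => Finset.sum_le_sum fun i _ => ?_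
  have hle : p.2.1 i ≤ p.2.1 (i + 1) := p.2.2.1 i.le_succ
  rw [edist_dist, edist_dist, Real.dist_eq, Real.dist_eq, primitive_sub hf ν hle,
    primitive_sub hf.abs ν hle]
  refine ENNReal.ofReal_le_ofReal ?_
  have h2 : 0 ≤ ν.real (Ioc (p.2.1 i) (p.2.1 (i + 1))) := measureReal_nonneg
  have h1 : |∫ t in Ioc (p.2.1 i) (p.2.1 (i + 1)), f t| ≤
    ∫ t in Ioc (p.2.1 i) (p.2.1 (i + 1)), |f t| := abs_integral_le_integral_abs
  refine le_trans (abs_add_le _ _) ?_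
  rw [abs_of_nonneg h2]
  exact le_trans (add_le_add_left h1 _) (le_abs_self _)

/-- The signed measure `f dx + ν`. -/
def derivMeasure (f : ℝ → ℝ) (ν : Measure ℝ) [IsFiniteMeasure ν] : SignedMeasure ℝ :=
  volume.withDensityᵥ f + ν.toSignedMeasure

theorem derivMeasure_apply {f : ℝ → ℝ} (hf : Integrable f) (ν : Measure ℝ) [IsFiniteMeasure ν]
    {s : Set ℝ} (hs : MeasurableSet s) : derivMeasure f ν s = (∫ t in s, f t) + ν.real s := by
  simp [derivMeasure, withDensityᵥ_apply hf hs, hs]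

theorem rightLim_primitive (c : ℝ) {f : ℝ → ℝ} (hf : Integrable f) (ν : Measure ℝ)
    [IsFiniteMeasure ν] : Function.rightLim (primitive c f ν) = primitive c f ν := by
  ext a
  obtain ⟨u, u_anti, hu, u_lim⟩ := exists_seq_strictAnti_tendsto a
  have h1 : Tendsto (fun n => primitive c f ν (u n)) atTop
      (𝓝 (Function.rightLim (primitive c f ν) a)) :=
    ((boundedVariationOn_primitive c hf ν).tendsto_rightLim a).comp
      (tendsto_nhdsWithin_iff.2 ⟨u_lim, Eventually.of_forall hu⟩)
  have h2 : Tendsto (fun n => derivMeasure f ν (Ioc a (u n))) atTop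
      (𝓝 (derivMeasure f ν (⋂ n, Ioc a (u n)))) :=
    VectorMeasure.tendsto_vectorMeasure_iInter_atTop_nat
      (fun m n hmn => Ioc_subset_Ioc_right (u_anti.antitone hmn)) fun n => measurableSet_Ioc
  have h3 : (⋂ n, Ioc a (u n)) = ∅ := by
    refine eq_empty_of_forall_notMem fun x hx => ?_
    rw [mem_iInter] at hx
    have : x ≤ a := ge_of_tendsto' u_lim fun n => (hx n).2
    exact absurd (hx 0).1 (not_lt.2 this)
  rw [h3, VectorMeasure.empty] at h2
  have h4 : Tendsto (fun n => primitive c f ν (u n)) atTop (𝓝 (primitive c f ν a)) := by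
    have := h2.add_const (primitive c f ν a)
    rw [zero_add] at this
    refine this.congr fun n => ?_
    rw [derivMeasure_apply hf ν measurableSet_Ioc, ← primitive_sub hf ν (hu n).le]
    ring
  exact tendsto_nhds_unique h1 h4

/-- A signed measure on `ℝ` is determined by the masses of the half-open intervals. -/
theorem signedMeasure_ext_Ioc {S S' : SignedMeasure ℝ}
    (h : ∀ a b, a ≤ b → S (Ioc a b) = S' (Ioc a b)) : S = S' := by
  have huniv : S univ = S' univ := by
    have hU : (⋃ n : ℕ, Ioc (-(n : ℝ)) n) = univ := by
      refine eq_univ_of_forall fun x => mem_iUnion.2 ?_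
      obtain ⟨n, hn⟩ := exists_nat_gt |x|
      exact ⟨n, by have := (abs_lt.1 hn); exact ⟨this.1, this.2.le⟩⟩
    have key : ∀ R : SignedMeasure ℝ, Tendsto (fun n : ℕ => R (Ioc (-(n : ℝ)) n)) atTop
        (𝓝 (R univ)) := by
      intro R
      rw [← hU]
      refine VectorMeasure.tendsto_vectorMeasure_iUnion_atTop_nat ?_ fun n => measurableSet_Ioc
      intro m n hmn
      have : (m : ℝ) ≤ n := by exact_mod_cast hmn
      exact Ioc_subset_Ioc (by linarith) this
    refine tendsto_nhds_unique (key S) ((key S').congr fun n => (h _ _ ?_).symm)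
    have : (0 : ℝ) ≤ n := n.cast_nonneg
    linarith
  refine VectorMeasure.ext_of_generateFrom {s : Set ℝ | ∃ a b, a < b ∧ Ioc a b = s} ?_
    (BorelSpace.measurable_eq.trans (borel_eq_generateFrom_Ioc ℝ))
    (by simpa using isPiSystem_Ioc_mem (univ : Set ℝ) univ) huniv
  rintro _ ⟨a, b, hab, rfl⟩
  exact h a b hab.le

theorem vectorMeasure_primitive (c : ℝ) {f : ℝ → ℝ} (hf : Integrable f) (ν : Measure ℝ)
    [IsFiniteMeasure ν] (hw : BoundedVariationOn (primitive c f ν) univ) :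
    hw.vectorMeasure = derivMeasure f ν := by
  refine signedMeasure_ext_Ioc fun a b hab => ?_
  rw [hw.vectorMeasure_Ioc hab, rightLim_primitive c hf, primitive_sub hf ν hab,
    derivMeasure_apply hf ν measurableSet_Ioc]

theorem jump_primitive (c : ℝ) {f : ℝ → ℝ} (hf : Integrable f) (ν : Measure ℝ)
    [IsFiniteMeasure ν] (x : ℝ) : jump (primitive c f ν) x = ν.real {x} := by
  have hw := boundedVariationOn_primitive c hf ν
  rw [jump, ← hw.vectorMeasure_singleton, vectorMeasure_primitive c hf,
    derivMeasure_apply hf ν (measurableSet_singleton x)]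
  simp

/-! ### Signed measures with a nonnegative singular part -/

theorem totalVariation_toSignedMeasure (μ : Measure ℝ) [IsFiniteMeasure μ] :
    μ.toSignedMeasure.totalVariation = μ := by
  have : μ.toSignedMeasure.toJordanDecomposition =
      ⟨μ, 0, Measure.MutuallySingular.zero_right⟩ := by
    refine SignedMeasure.toJordanDecomposition_eq ?_
    simp [JordanDecomposition.toSignedMeasure]
  simp [SignedMeasure.totalVariation, this]

theorem toSignedMeasure_mutuallySingular {μ ρ : Measure ℝ} [IsFiniteMeasure μ] (h : μ ⟂ₘ ρ) :
    μ.toSignedMeasure ⟂ᵥ ρ.toENNRealVectorMeasure := by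
  obtain ⟨s, hs, h1, h2⟩ := h
  refine VectorMeasure.MutuallySingular.mk s hs (fun t ht hmt => ?_) fun t ht hmt => ?_
  · rw [Measure.toSignedMeasure_apply_measurable hmt, measureReal_def, measure_mono_null ht h1]
    rfl
  · rw [Measure.toENNRealVectorMeasure_apply_measurable hmt]
    exact measure_mono_null ht h2

/-- The Lebesgue decomposition of `f dx + ν` on a set `A`: the singular part is that of `ν`, the
density is the sum of `f` and the density of `ν`. -/
theorem singularPart_restrict_derivMeasure {f : ℝ → ℝ} (hf : Integrable f) (ν : Measure ℝ)
    [IsFiniteMeasure ν] {A : Set ℝ} (hA : MeasurableSet A) :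
    (SignedMeasure.singularPart ((derivMeasure f ν).restrict A) volume =
      ((ν.singularPart volume).restrict A).toSignedMeasure) ∧
    A.indicator (fun x => f x + (ν.rnDeriv volume x).toReal) =ᵐ[volume]
      SignedMeasure.rnDeriv ((derivMeasure f ν).restrict A) volume := by
  have hm : Integrable (fun x => (ν.rnDeriv volume x).toReal) := Measure.integrable_toReal_rnDeriv
  have hi : Integrable (A.indicator (fun x => f x + (ν.rnDeriv volume x).toReal)) :=
    (hf.add hm).indicator hA
  have hadd : (derivMeasure f ν).restrict A =
      ((ν.singularPart volume).restrict A).toSignedMeasure +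
        volume.withDensityᵥ (A.indicator (fun x => f x + (ν.rnDeriv volume x).toReal)) := by
    refine VectorMeasure.ext fun s hs => ?_
    rw [VectorMeasure.restrict_apply _ hA hs, derivMeasure_apply hf ν (hs.inter hA),
      _root_.add_apply, withDensityᵥ_apply hi hs, Measure.toSignedMeasure_apply_measurable hs,
      measureReal_restrict_apply hs, setIntegral_indicator hA, integral_add hf.integrableOn
      hm.integrableOn, Measure.setIntegral_toReal_rnDeriv_eq_withDensity]
    conv_lhs => rw [Measure.haveLebesgueDecomposition_add ν volume]
    rw [measureReal_add_apply]
    ring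
  have hms := toSignedMeasure_mutuallySingular
    ((Measure.mutuallySingular_singularPart ν volume).mono_ac
      (Measure.absolutelyContinuous_of_le (Measure.restrict_le_self (s := A)))
      Measure.AbsolutelyContinuous.rfl)
  exact ⟨(SignedMeasure.eq_singularPart _ _ hms hadd).symm,
    SignedMeasure.eq_rnDeriv _ _ hi hms hadd⟩

/-! ### The cohesive energy of a measure -/

/-- The cohesive energy of a measure: a diffuse part costs `σ` per unit mass, an atom of
mass `s` costs `φ(s)`. The density `φ(s)/s = G σ / (G + σ s)` is evaluated at the atoms of `ν`. -/
def cohesiveEnergy (σ G : ℝ) (ν : Measure ℝ) : ℝ≥0∞ :=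
  ∫⁻ x, ENNReal.ofReal (G * σ / (G + σ * ν.real {x})) ∂ν

theorem countable_setOf_singleton_ne_zero (ν : Measure ℝ) [IsFiniteMeasure ν] :
    {x | ν {x} ≠ 0}.Countable := by
  have := Measure.countable_meas_pos_of_disjoint_iUnion (μ := ν) (As := fun x : ℝ => {x})
    (fun x => measurableSet_singleton x) (fun x y hxy => by simpa using hxy)
  simpa [pos_iff_ne_zero] using this

/-- The diffuse part of `ν` pays `σ` per unit mass and each atom pays `φ` of its mass. -/
theorem cohesiveEnergy_eq {σ G : ℝ} (hσ : 0 < σ) (hG : 0 < G) (ν : Measure ℝ)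
    [IsFiniteMeasure ν] : cohesiveEnergy σ G ν =
      ENNReal.ofReal σ * ν {x | ν {x} = 0} + ∑' x, phi σ G (ν.real {x}) := by
  have hc := countable_setOf_singleton_ne_zero ν
  have hm : MeasurableSet {x | ν {x} = 0} := by
    have := hc.measurableSet.compl
    simpa [Set.compl_ofPred] using this
  rw [cohesiveEnergy, ← lintegral_add_compl _ hm]
  congr 1
  · rw [setLIntegral_congr_fun (g := fun _ => ENNReal.ofReal σ) hm]
    · simp
    · intro x hx
      have : ν.real {x} = 0 := by simp [measureReal_def, show ν {x} = 0 from hx]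
      simp only [this]
      congr 1
      field_simp
      ring
  · have hset : {x | ν {x} = 0}ᶜ = {x | ν {x} ≠ 0} := rfl
    rw [hset, lintegral_countable _ hc, ← tsum_subtype_eq_of_support_subset (s := {x | ν {x} ≠ 0})]
    · refine tsum_congr fun x => ?_
      have hx : ν {(x : ℝ)} = ENNReal.ofReal (ν.real {(x : ℝ)}) := by simp
      rw [phi, if_pos measureReal_nonneg]
      conv_lhs => rw [hx]
      rw [← ENNReal.ofReal_mul (by have := measureReal_nonneg (μ := ν) (s := {(x:ℝ)}); positivity)]
      congr 1
      ring
    · intro x hx h0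
      apply hx
      simp [phi, measureReal_def, show ν {x} = 0 from h0]

theorem W_apply (E₀ σ s : ℝ) : W E₀ σ s =
    if s ≤ σ / E₀ then E₀ / 2 * s ^ 2 else σ * s - σ ^ 2 / (2 * E₀) := by
  have h : degr 0 = 1 := by norm_num [degr]
  simp only [W, density, h, one_mul, one_pow, mul_one]

/-- The optimal split of a slope `s` into an elastic part, cut off at the critical slope `σ / E₀`,
and a slip. -/
theorem W_eq_min_add_max {E₀ σ : ℝ} (hE₀ : 0 < E₀) (s : ℝ) :
    W E₀ σ s = E₀ / 2 * (min s (σ / E₀)) ^ 2 + σ * max (s - σ / E₀) 0 := by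
  rw [W_apply]
  split_ifs with h
  · rw [min_eq_left h, max_eq_right (by linarith)]
    ring
  · push Not at h
    rw [min_eq_right h.le, max_eq_left (by linarith)]
    field_simp
    ring

/-- `W` is at most the energy of any split into an elastic part `a` and a slip `m ≥ 0`. -/
theorem W_add_le {E₀ σ : ℝ} (hE₀ : 0 < E₀) (a : ℝ) {m : ℝ} (hm : 0 ≤ m) :
    W E₀ σ (a + m) ≤ E₀ / 2 * a ^ 2 + σ * m := by
  rw [W_apply]
  split_ifs with h
  · have h' : E₀ * (a + m) ≤ σ := by
      rw [le_div_iff₀ hE₀] at h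
      linarith
    nlinarith [mul_le_mul_of_nonneg_right h' hm, mul_nonneg hE₀.le (mul_nonneg hm hm)]
  · have : E₀ / 2 * a ^ 2 + σ * m - (σ * (a + m) - σ ^ 2 / (2 * E₀))
        = E₀ / 2 * (a - σ / E₀) ^ 2 := by
      field_simp
      ring
    have h2 : 0 ≤ E₀ / 2 * (a - σ / E₀) ^ 2 := by positivity
    linarith

/-! ### The limit energy of a primitive -/

theorem jumpSet_primitive (L c : ℝ) {f : ℝ → ℝ} (hf : Integrable f) (ν : Measure ℝ)
    [IsFiniteMeasure ν] :
    jumpSet L (primitive c f ν) = Ioo (-L) L ∩ {x | ν {x} ≠ 0} := by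
  ext x
  simp [jumpSet, jump_primitive c hf ν, measureReal_def, ENNReal.toReal_eq_zero_iff]

theorem measurableSet_jumpSet_primitive (L c : ℝ) {f : ℝ → ℝ} (hf : Integrable f) (ν : Measure ℝ)
    [IsFiniteMeasure ν] : MeasurableSet (jumpSet L (primitive c f ν)) := by
  rw [jumpSet_primitive L c hf ν]
  exact measurableSet_Ioo.inter (countable_setOf_singleton_ne_zero ν).measurableSet

theorem cantorPart_primitive (L c : ℝ) {f : ℝ → ℝ} (hf : Integrable f) (ν : Measure ℝ)
    [IsFiniteMeasure ν] (hw : BoundedVariationOn (primitive c f ν) univ) :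
    cantorPart L hw = (((ν.singularPart volume).restrict (Ioo (-L) L)).restrict
      (jumpSet L (primitive c f ν))ᶜ).toSignedMeasure := by
  rw [cantorPart, measDeriv, vectorMeasure_primitive c hf,
    (singularPart_restrict_derivMeasure hf ν measurableSet_Ioo).1,
    Measure.toSignedMeasure_restrict_eq_restrict_toSignedMeasure]
  exact (measurableSet_jumpSet_primitive L c hf ν).compl

theorem absGrad_primitive (L c : ℝ) {f : ℝ → ℝ} (hf : Integrable f) (ν : Measure ℝ)
    [IsFiniteMeasure ν] (hw : BoundedVariationOn (primitive c f ν) univ) :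
    absGrad L hw =ᵐ[volume]
      (Ioo (-L) L).indicator (fun x => f x + (ν.rnDeriv volume x).toReal) := by
  rw [absGrad, measDeriv, vectorMeasure_primitive c hf]
  exact (singularPart_restrict_derivMeasure hf ν measurableSet_Ioo).2.symm

theorem leftLim_primitive (c : ℝ) {f : ℝ → ℝ} (hf : Integrable f) (ν : Measure ℝ)
    [IsFiniteMeasure ν] (x : ℝ) :
    Function.leftLim (primitive c f ν) x = primitive c f ν x - ν.real {x} := by
  have := jump_primitive c hf ν x
  rw [jump, rightLim_primitive c hf] at this
  linarith

theorem primitive_left_endpoint {L c : ℝ} {f : ℝ → ℝ} {ν : Measure ℝ}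
    (hf0 : ∀ x ∉ Icc (-L) L, f x = 0) (hν : ν (Icc (-L) L)ᶜ = 0) :
    primitive c f ν (-L) = c + ν.real {-L} := by
  have h1 : ∫ t in Iic (-L), f t = 0 := by
    rw [integral_Iic_eq_integral_Iio]
    exact setIntegral_eq_zero_of_forall_eq_zero fun x hx => hf0 x fun h => not_lt.2 h.1 hx
  have h2 : ν (Iic (-L)) = ν {-L} := by
    refine le_antisymm ?_ (measure_mono fun x hx => le_of_eq hx)
    refine (measure_mono (t := {-L} ∪ (Icc (-L) L)ᶜ) fun x hx => ?_).trans
      ((measure_union_le _ _).trans (by rw [hν, add_zero]))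
    rcases eq_or_lt_of_le (show x ≤ -L from hx) with h | h
    · exact Or.inl h
    · exact Or.inr fun h' => not_lt.2 h'.1 h
  rw [primitive, h1, measureReal_def, h2, measureReal_def, add_zero]

/-- A pair of a density `f ∈ L²(-L, L)` and a finite measure `ν` on `[-L, L]`, both extended by
zero, such that `f dx + ν` is the derivative on `ℝ` of a function which equals `a` to the left of
`-L` and `b` to the right of `L`. Atoms of `ν` at `±L` are the jumps at the boundary. -/
structure IsSplitting (L a b : ℝ) (f : ℝ → ℝ) (ν : Measure ℝ) : Prop where
  finite : IsFiniteMeasure ν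
  integrable : Integrable f
  integrable_sq : Integrable fun x => f x ^ 2
  eq_zero : ∀ x ∉ Icc (-L) L, f x = 0
  measure_compl : ν (Icc (-L) L)ᶜ = 0
  right : primitive a f ν L = b

/-- Any splitting of the derivative bounds the limit energy from above: the absolutely continuous
part of `ν` is absorbed in `W`, the rest of the diffuse part is the Cantor part, and the atoms are
the jumps. -/
theorem limitEnergy_primitive_le {L E₀ σ G : ℝ} (hL : 0 < L) (hE₀ : 0 < E₀) (hσ : 0 < σ)
    (hG : 0 < G) (g : ℝ → ℝ) {f : ℝ → ℝ} {ν : Measure ℝ}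
    (hs : IsSplitting L (g (-L)) (g L) f ν)
    (hw : BoundedVariationOn (primitive (g (-L)) f ν) univ) :
    limitEnergy L E₀ σ G g hw ≤
      ENNReal.ofReal (E₀ / 2 * ∫ x, f x ^ 2) + cohesiveEnergy σ G ν := by
  obtain ⟨hfin, hf, hf2, hf0, hν, hgL⟩ := hs
  have hbulk : ∫⁻ x in Icc (-L) L, ENNReal.ofReal (W E₀ σ (absGrad L hw x)) ≤
      ENNReal.ofReal (E₀ / 2 * ∫ x, f x ^ 2) +
        ENNReal.ofReal σ * (volume.withDensity (ν.rnDeriv volume)) (Ioo (-L) L) := by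
    rw [← integral_const_mul, ofReal_integral_eq_lintegral_ofReal (hf2.const_mul _)
      (Eventually.of_forall fun x => by positivity), withDensity_apply _ measurableSet_Ioo,
      ← lintegral_const_mul _ (Measure.measurable_rnDeriv _ _)]
    rw [← Measure.restrict_congr_set Ioo_ae_eq_Icc]
    refine le_trans ?_ (add_le_add_left (setLIntegral_le_lintegral (Ioo (-L) L) _) _)
    rw [← lintegral_add_right]
    · refine lintegral_mono_ae ?_
      filter_upwards [ae_restrict_of_ae (absGrad_primitive L (g (-L)) hf ν hw),
        ae_restrict_of_ae (Measure.rnDeriv_lt_top ν volume), ae_restrict_mem measurableSet_Ioo]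
        with x hx hlt hmem
      rw [hx, indicator_of_mem hmem]
      refine (ENNReal.ofReal_le_ofReal (W_add_le hE₀ (f x) ENNReal.toReal_nonneg)).trans ?_
      rw [ENNReal.ofReal_add (by positivity) (by positivity), ENNReal.ofReal_mul hσ.le,
        ENNReal.ofReal_toReal hlt.ne]
    · exact (Measure.measurable_rnDeriv _ _).const_mul _
  have hcantor : (cantorPart L hw).totalVariation (Ioo (-L) L) ≤
      (ν.singularPart volume) (Ioo (-L) L ∩ {x | ν {x} = 0}) := by
    rw [cantorPart_primitive L _ hf, totalVariation_toSignedMeasure,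
      Measure.restrict_apply measurableSet_Ioo, Measure.restrict_apply
      (measurableSet_Ioo.inter (measurableSet_jumpSet_primitive L _ hf ν).compl)]
    refine measure_mono fun x hx => ⟨hx.2, ?_⟩
    by_contra h
    apply hx.1.2
    rw [jumpSet_primitive L _ hf]
    exact ⟨hx.2, h⟩
  have hright : g L - Function.leftLim (primitive (g (-L)) f ν) L = ν.real {L} := by
    rw [leftLim_primitive _ hf, hgL]
    ring
  have hleft : Function.rightLim (primitive (g (-L)) f ν) (-L) - g (-L) = ν.real {-L} := by
    rw [rightLim_primitive _ hf, primitive_left_endpoint hf0 hν]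
    ring
  have hdiffuse : (volume.withDensity (ν.rnDeriv volume)) (Ioo (-L) L) +
      (ν.singularPart volume) (Ioo (-L) L ∩ {x | ν {x} = 0}) ≤ ν {x | ν {x} = 0} := by
    have hc := countable_setOf_singleton_ne_zero ν
    have h1 : (volume.withDensity (ν.rnDeriv volume)) (Ioo (-L) L) ≤
        (volume.withDensity (ν.rnDeriv volume)) {x | ν {x} = 0} := by
      refine measure_mono_ae ?_
      have : ∀ᵐ x ∂(volume.withDensity (ν.rnDeriv volume)), x ∉ {x | ν {x} ≠ 0} :=
        (withDensity_absolutelyContinuous _ _).ae_le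
          (measure_eq_zero_iff_ae_notMem.1 (hc.measure_zero volume))
      filter_upwards [this] with x hx _
      exact not_not.1 hx
    generalize {x | ν {x} = 0} = Z at h1 ⊢
    conv_rhs => rw [Measure.haveLebesgueDecomposition_add ν volume, Measure.add_apply]
    rw [add_comm]
    exact add_le_add (measure_mono inter_subset_right) h1
  have hatoms : (∑' x : jumpSet L (primitive (g (-L)) f ν),
        phi σ G (jump (primitive (g (-L)) f ν) x)) + phi σ G (ν.real {L}) +
        phi σ G (ν.real {-L}) ≤ ∑' x, phi σ G (ν.real {x}) := by
    simp_rw [jump_primitive _ hf ν]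
    rw [tsum_subtype (jumpSet L (primitive (g (-L)) f ν)) fun x => phi σ G (ν.real {x}),
      ← tsum_ite_eq L fun x => phi σ G (ν.real {x}),
      ← tsum_ite_eq (-L) fun x => phi σ G (ν.real {x}), ← ENNReal.tsum_add, ← ENNReal.tsum_add]
    refine ENNReal.tsum_le_tsum fun x => ?_
    by_cases hx : x ∈ jumpSet L (primitive (g (-L)) f ν)
    · have h1 : x ≠ L := hx.1.2.ne
      have h2 : x ≠ -L := hx.1.1.ne'
      simp [hx, h1, h2]
    · rw [indicator_of_notMem hx]
      by_cases h1 : x = L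
      · have : x ≠ -L := by rw [h1]; linarith
        simp [h1, show L ≠ -L by linarith]
      · by_cases h2 : x = -L <;> simp [h1, h2, show -L ≠ L by linarith]
  rw [limitEnergy, hright, hleft, cohesiveEnergy_eq hσ hG]
  calc _ ≤ (ENNReal.ofReal (E₀ / 2 * ∫ x, f x ^ 2) +
        ENNReal.ofReal σ * (volume.withDensity (ν.rnDeriv volume)) (Ioo (-L) L)) +
        ENNReal.ofReal σ * (ν.singularPart volume) (Ioo (-L) L ∩ {x | ν {x} = 0}) +
        (∑' x : jumpSet L (primitive (g (-L)) f ν),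
        phi σ G (jump (primitive (g (-L)) f ν) x)) + phi σ G (ν.real {L}) +
        phi σ G (ν.real {-L}) := by gcongr
    _ = ENNReal.ofReal (E₀ / 2 * ∫ x, f x ^ 2) + (ENNReal.ofReal σ *
        ((volume.withDensity (ν.rnDeriv volume)) (Ioo (-L) L) +
          (ν.singularPart volume) (Ioo (-L) L ∩ {x | ν {x} = 0})) +
        ((∑' x : jumpSet L (primitive (g (-L)) f ν),
        phi σ G (jump (primitive (g (-L)) f ν) x)) + phi σ G (ν.real {L}) +
        phi σ G (ν.real {-L}))) := by rw [mul_add]; ring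
    _ ≤ _ := by gcongr

/-! ### Decomposing a function of bounded variation -/

theorem countable_not_continuousAt {w : ℝ → ℝ} (hw : BoundedVariationOn w univ) :
    {x | ¬ ContinuousAt w x}.Countable := by
  obtain ⟨p, q, hp, hq, rfl⟩ :=
    hw.locallyBoundedVariationOn.exists_monotoneOn_sub_monotoneOn
  rw [monotoneOn_univ] at hp hq
  refine (hp.countable_not_continuousAt.union hq.countable_not_continuousAt).mono fun x hx => ?_
  by_contra h
  simp only [mem_union, mem_ofPred_eq, not_or, not_not] at h
  exact hx (h.1.sub h.2)

theorem rightLim_ae_eq {w : ℝ → ℝ} (hw : BoundedVariationOn w univ) :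
    Function.rightLim w =ᵐ[volume] w := by
  have := measure_eq_zero_iff_ae_notMem.1 ((countable_not_continuousAt hw).measure_zero volume)
  filter_upwards [this] with x hx
  have hc : ContinuousAt w x := not_not.1 hx
  exact hc.continuousWithinAt.rightLim_eq

theorem countable_jumpSet (L : ℝ) {w : ℝ → ℝ} (hw : BoundedVariationOn w univ) :
    (jumpSet L w).Countable := by
  refine (countable_not_continuousAt hw).mono fun x hx => ?_
  by_contra hc
  have hc : ContinuousAt w x := not_not.1 hc
  apply hx.2
  rw [jump, hc.continuousWithinAt.rightLim_eq, hc.continuousWithinAt.leftLim_eq, sub_self]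

theorem measDeriv_eq (L : ℝ) {w : ℝ → ℝ} (hw : BoundedVariationOn w univ) :
    (measDeriv L hw).singularPart volume + volume.withDensityᵥ (absGrad L hw) =
      measDeriv L hw :=
  SignedMeasure.singularPart_add_withDensity_rnDeriv_eq _ _

theorem singularPart_measDeriv_singleton (L : ℝ) {w : ℝ → ℝ} (hw : BoundedVariationOn w univ)
    {x : ℝ} (hx : x ∈ Ioo (-L) L) :
    (measDeriv L hw).singularPart volume {x} = jump w x := by
  have h1 : measDeriv L hw {x} = jump w x := by
    rw [measDeriv, VectorMeasure.restrict_eq_self _ measurableSet_Ioo (measurableSet_singleton x)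
      (singleton_subset_iff.2 hx), hw.vectorMeasure_singleton, jump]
  rw [← h1]
  conv_rhs => rw [← measDeriv_eq L hw]
  rw [_root_.add_apply, absGrad, withDensityᵥ_apply (SignedMeasure.integrable_rnDeriv _ _)
    (measurableSet_singleton x)]
  simp

/-- The singular part of `Du` is nonnegative: on the countable jump set it is the sum of the jumps,
elsewhere it is the Cantor part. -/
theorem singularPart_measDeriv_nonneg (L : ℝ) {w : ℝ → ℝ} (hw : BoundedVariationOn w univ)
    (hjump : ∀ x ∈ jumpSet L w, 0 < jump w x) (hcantor : 0 ≤ cantorPart L hw) :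
    0 ≤ (measDeriv L hw).singularPart volume := by
  have hJ := countable_jumpSet L hw
  refine VectorMeasure.le_iff.2 fun B hB => ?_
  set S := (measDeriv L hw).singularPart volume
  change 0 ≤ S B
  rw [← Set.inter_union_sdiff B (jumpSet L w), VectorMeasure.of_union
    (disjoint_sdiff_inter.symm) (hB.inter hJ.measurableSet)
    (MeasurableSet.diff hB hJ.measurableSet)]
  have h1 : 0 ≤ S (B \ jumpSet L w) := by
    have := hcantor B hB
    rwa [cantorPart, VectorMeasure.restrict_apply _ hJ.measurableSet.compl hB, ← sdiff_eq] at this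
  have h2 : 0 ≤ S (B ∩ jumpSet L w) := by
    rw [← biUnion_of_singleton (B ∩ jumpSet L w),
      VectorMeasure.of_biUnion (hJ.mono inter_subset_right)]
    · refine tsum_nonneg fun x => ?_
      rw [singularPart_measDeriv_singleton L hw x.2.2.1]
      exact (hjump x x.2.2).le
    · intro x _ y _ hxy
      simpa using hxy
    · exact fun x _ => measurableSet_singleton x
  exact add_nonneg h2 h1

/-- A property which holds almost everywhere holds at points arbitrarily close on the right. -/
theorem frequently_nhdsGT_of_ae {a b x : ℝ} {P : ℝ → Prop}
    (h : ∀ᵐ y ∂(volume.restrict (Icc a b)), P y) (hx : x ∈ Ico a b) : ∃ᶠ y in 𝓝[>] x, P y := by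
  intro hne
  obtain ⟨u, hu, hsub⟩ := (mem_nhdsGT_iff_exists_Ioo_subset' hx.2).1
    (inter_mem hne (Ioo_mem_nhdsGT hx.2))
  have h0 : volume (Ioo x u) = 0 := by
    refine measure_mono_null (fun y hy => ?_)
      ((ae_restrict_iff' measurableSet_Icc).1 h : volume _ = 0)
    intro hP
    have := hsub hy
    exact this.1 (hP ⟨hx.1.trans hy.1.le, this.2.2.le⟩)
  rw [Real.volume_Ioo, ENNReal.ofReal_eq_zero] at h0
  linarith [show x < u from hu]

namespace IsSplitting

variable {L a b : ℝ} {f : ℝ → ℝ} {ν : Measure ℝ}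

theorem primitive_of_lt (hs : IsSplitting L a b f ν) {x : ℝ} (hx : x < -L) :
    primitive a f ν x = a := by
  have h1 : ∫ t in Iic x, f t = 0 := setIntegral_eq_zero_of_forall_eq_zero fun y hy =>
    hs.eq_zero y fun h => not_lt.2 (h.1.trans hy) hx
  have h2 : ν (Iic x) = 0 := measure_mono_null
    (show Iic x ⊆ (Icc (-L) L)ᶜ from fun y hy h => not_lt.2 (h.1.trans hy) hx) hs.measure_compl
  rw [primitive, h1, measureReal_def, h2]
  simp

theorem primitive_of_ge (hs : IsSplitting L a b f ν) {x : ℝ} (hx : L ≤ x) :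
    primitive a f ν x = b := by
  have hfin := hs.finite
  have h := primitive_sub (c := a) hs.integrable ν hx
  have h1 : ∫ t in Ioc L x, f t = 0 := setIntegral_eq_zero_of_forall_eq_zero fun y hy =>
    hs.eq_zero y fun h => not_lt.2 h.2 hy.1
  have h2 : ν (Ioc L x) = 0 := measure_mono_null
    (show Ioc L x ⊆ (Icc (-L) L)ᶜ from fun y hy h => not_lt.2 h.2 hy.1) hs.measure_compl
  rw [h1, measureReal_def, h2, hs.right] at h
  simpa [sub_eq_zero] using h

theorem abs_primitive_le {M : ℝ} (hs : IsSplitting L a b f ν) (ha : |a| ≤ M) (hb : |b| ≤ M)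
    (h : ∀ᵐ x ∂(volume.restrict (Icc (-L) L)), |primitive a f ν x| ≤ M) (x : ℝ) :
    |primitive a f ν x| ≤ M := by
  have hfin := hs.finite
  rcases lt_or_ge x (-L) with h1 | h1
  · rwa [hs.primitive_of_lt h1]
  rcases le_or_gt L x with h2 | h2
  · rwa [hs.primitive_of_ge h2]
  have ht := (boundedVariationOn_primitive a hs.integrable ν).tendsto_rightLim x
  rw [rightLim_primitive a hs.integrable ν] at ht
  exact le_of_tendsto_of_frequently ht.abs (frequently_nhdsGT_of_ae h ⟨h1, h2⟩)

end IsSplitting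

/-- The optimal splitting. The measure `ν` consists of the singular part of `Du`, the part of the
gradient above the critical slope, and the boundary mismatches as atoms at `±L`. -/
theorem exists_splitting_of_limitEnergy {L E₀ σ G : ℝ} (hL : 0 < L) (hE₀ : 0 < E₀)
    (hσ : 0 < σ) (hG : 0 < G) (g : ℝ → ℝ) {w : ℝ → ℝ} (hw : BoundedVariationOn w univ)
    (hjump : ∀ x ∈ jumpSet L w, 0 < jump w x) (hcantor : 0 ≤ cantorPart L hw)
    (hfin : limitEnergy L E₀ σ G g hw ≠ ∞) :
    ∃ (f : ℝ → ℝ) (ν : Measure ℝ), IsSplitting L (g (-L)) (g L) f ν ∧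
      primitive (g (-L)) f ν =ᵐ[volume.restrict (Icc (-L) L)] w ∧
      ENNReal.ofReal (E₀ / 2 * ∫ x, f x ^ 2) + cohesiveEnergy σ G ν ≤
        limitEnergy L E₀ σ G g hw := by
  set jl := Function.rightLim w (-L) - g (-L) with hjl
  set jr := g L - Function.leftLim w L with hjr
  have hphi : ∀ s, phi σ G s ≠ ∞ → 0 ≤ s := by
    intro s h
    by_contra h0
    exact h (by rw [phi, if_neg h0])
  have hjl0 : 0 ≤ jl := hphi _ (ne_top_of_le_ne_top hfin le_add_self)
  have hjr0 : 0 ≤ jr := hphi _ (ne_top_of_le_ne_top hfin (le_add_self.trans le_self_add))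
  have hbulk : ∫⁻ x in Icc (-L) L, ENNReal.ofReal (W E₀ σ (absGrad L hw x)) ≠ ∞ := by
    refine ne_top_of_le_ne_top hfin ?_
    rw [limitEnergy, add_assoc, add_assoc, add_assoc]
    exact le_self_add
  set S := (measDeriv L hw).singularPart volume with hS
  have hSpos := singularPart_measDeriv_nonneg L hw hjump hcantor
  set τ := S.toMeasureOfZeroLE univ MeasurableSet.univ
    ((VectorMeasure.le_restrict_univ_iff_le _ _).2 hSpos) with hτ
  have hτr : ∀ B, MeasurableSet B → τ.real B = S B := fun B hB => by
    rw [hτ, SignedMeasure.toMeasureOfZeroLE_real_apply _ _ _ hB, univ_inter]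
  have hJ := countable_jumpSet L hw
  have hag : Integrable (absGrad L hw) := SignedMeasure.integrable_rnDeriv _ _
  have hagm : Measurable (absGrad L hw) := SignedMeasure.measurable_rnDeriv _ _
  -- the elastic part of the gradient is cut off at the critical slope `σ / E₀`
  set f : ℝ → ℝ := (Ioo (-L) L).indicator fun x => min (absGrad L hw x) (σ / E₀) with hf
  set m : ℝ → ℝ := (Ioo (-L) L).indicator fun x => max (absGrad L hw x - σ / E₀) 0 with hm
  have hfm : Measurable f := (hagm.min measurable_const).indicator measurableSet_Ioo
  have hmm : Measurable m :=
    ((hagm.sub measurable_const).max measurable_const).indicator measurableSet_Ioo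
  have hσE : 0 < σ / E₀ := by positivity
  have hfi : Integrable f := by
    refine hag.mono hfm.aestronglyMeasurable (Eventually.of_forall fun x => ?_)
    rw [hf]
    by_cases hx : x ∈ Ioo (-L) L
    · simp only [indicator_of_mem hx, Real.norm_eq_abs]
      rcases le_total (absGrad L hw x) (σ / E₀) with h | h
      · rw [min_eq_left h]
      · rw [min_eq_right h, abs_of_pos hσE]
        exact h.trans (le_abs_self _)
    · simp [indicator_of_notMem hx]
  have hm0 : ∀ x, 0 ≤ m x := fun x => indicator_nonneg (fun x _ => le_max_right _ _) x
  have hmi : Integrable m := by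
    refine hag.mono hmm.aestronglyMeasurable (Eventually.of_forall fun x => ?_)
    rw [hm]
    by_cases hx : x ∈ Ioo (-L) L
    · simp only [indicator_of_mem hx, Real.norm_eq_abs]
      rw [abs_of_nonneg (le_max_right _ _)]
      exact max_le (by linarith [le_abs_self (absGrad L hw x)]) (abs_nonneg _)
    · simp [indicator_of_notMem hx]
  have hfadd : ∀ x ∈ Ioo (-L) L, f x + m x = absGrad L hw x := by
    intro x hx
    simp only [hf, hm, indicator_of_mem hx]
    rcases le_total (absGrad L hw x) (σ / E₀) with h | h
    · rw [min_eq_left h, max_eq_right (by linarith), add_zero]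
    · rw [min_eq_right h, max_eq_left (by linarith)]
      ring
  have hWeq : ∀ x ∈ Ioo (-L) L, ENNReal.ofReal (W E₀ σ (absGrad L hw x)) =
      ENNReal.ofReal (E₀ / 2 * f x ^ 2) + ENNReal.ofReal σ * ENNReal.ofReal (m x) := by
    intro x hx
    rw [W_eq_min_add_max hE₀, ENNReal.ofReal_add (by positivity) (by positivity),
      ENNReal.ofReal_mul hσ.le]
    simp only [hf, hm, indicator_of_mem hx]
  have hlin : ∫⁻ x in Icc (-L) L, ENNReal.ofReal (W E₀ σ (absGrad L hw x)) =
      (∫⁻ x, ENNReal.ofReal (E₀ / 2 * f x ^ 2)) +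
        ENNReal.ofReal σ * ∫⁻ x, ENNReal.ofReal (m x) := by
    rw [← Measure.restrict_congr_set Ioo_ae_eq_Icc, setLIntegral_congr_fun measurableSet_Ioo hWeq,
      lintegral_add_left (by fun_prop), lintegral_const_mul _ (by fun_prop)]
    congr 1
    · refine setLIntegral_eq_of_support_subset ?_
      intro x hx
      by_contra h
      exact hx (by simp [hf, indicator_of_notMem h])
    · congr 1
      refine setLIntegral_eq_of_support_subset ?_
      intro x hx
      by_contra h
      exact hx (by simp [hm, indicator_of_notMem h])
  have hf2 : Integrable fun x => f x ^ 2 := by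
    have h1 : Integrable fun x => E₀ / 2 * f x ^ 2 := by
      refine ⟨by fun_prop, ?_⟩
      rw [hasFiniteIntegral_iff_ofReal (Eventually.of_forall fun x => by positivity)]
      refine lt_of_le_of_lt ?_ (lt_top_iff_ne_top.2 hbulk)
      rw [hlin]
      exact le_self_add
    have h2 := h1.const_mul (E₀ / 2)⁻¹
    refine h2.congr (Eventually.of_forall fun x => ?_)
    simp only
    field_simp
  have hmfin : IsFiniteMeasure (volume.withDensity fun x => ENNReal.ofReal (m x)) :=
    isFiniteMeasure_withDensity_ofReal hmi.2
  set ν : Measure ℝ := τ.restrict (Ioo (-L) L) + volume.withDensity (fun x => ENNReal.ofReal (m x))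
    + ENNReal.ofReal jr • Measure.dirac L + ENNReal.ofReal jl • Measure.dirac (-L) with hν
  have hdr : IsFiniteMeasure (ENNReal.ofReal jr • Measure.dirac L : Measure ℝ) :=
    Measure.smul_finite _ ENNReal.ofReal_ne_top
  have hdl : IsFiniteMeasure (ENNReal.ofReal jl • Measure.dirac (-L) : Measure ℝ) :=
    Measure.smul_finite _ ENNReal.ofReal_ne_top
  have hνfin : IsFiniteMeasure ν := by rw [hν]; infer_instance
  have hνB : ∀ B, MeasurableSet B → ν B = τ (B ∩ Ioo (-L) L) +
      (∫⁻ x in B, ENNReal.ofReal (m x)) + ENNReal.ofReal jr * B.indicator 1 L +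
      ENNReal.ofReal jl * B.indicator 1 (-L) := by
    intro B hB
    simp [hν, hB, Measure.restrict_apply, withDensity_apply]
  have hνin : ∀ B, MeasurableSet B → B ⊆ Ioo (-L) L →
      (∫ t in B, f t) + ν.real B = hw.vectorMeasure B := by
    intro B hB hBI
    have hr : L ∉ B := fun h => lt_irrefl _ (hBI h).2
    have hl : -L ∉ B := fun h => lt_irrefl _ (hBI h).1
    have h1 : ν.real B = S B + ∫ t in B, m t := by
      rw [measureReal_def, hνB B hB, inter_eq_left.2 hBI]
      simp only [hr, hl, not_false_eq_true, indicator_of_notMem, mul_zero, add_zero]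
      rw [ENNReal.toReal_add (measure_ne_top _ _) , ← hτr B hB, measureReal_def,
        integral_eq_lintegral_of_nonneg_ae (Eventually.of_forall hm0) hmm.aestronglyMeasurable]
      have := measure_ne_top (volume.withDensity fun x => ENNReal.ofReal (m x)) B
      rwa [withDensity_apply _ hB] at this
    have h2 : measDeriv L hw B = hw.vectorMeasure B := by
      rw [measDeriv, VectorMeasure.restrict_eq_self _ measurableSet_Ioo hB hBI]
    rw [h1, ← h2, ← measDeriv_eq L hw, _root_.add_apply, withDensityᵥ_apply hag hB,
      setIntegral_congr_fun hB fun x hx => (hfadd x (hBI hx)).symm,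
      integral_add hfi.integrableOn hmi.integrableOn]
    ring
  have hνr : ν {L} = ENNReal.ofReal jr := by
    have : -L ≠ L := by linarith
    rw [hνB _ (measurableSet_singleton L)]
    simp [this]
  have hνl : ν {-L} = ENNReal.ofReal jl := by
    have : L ≠ -L := by linarith
    rw [hνB _ (measurableSet_singleton _)]
    simp [this]
  have hνc : ν (Icc (-L) L)ᶜ = 0 := by
    have h1 : (Icc (-L) L)ᶜ ∩ Ioo (-L) L = ∅ := by
      ext x
      simp only [mem_inter_iff, mem_compl_iff, mem_Icc, mem_Ioo, mem_empty_iff_false, iff_false]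
      intro h
      exact h.1 ⟨h.2.1.le, h.2.2.le⟩
    have h2 : ∫⁻ x in (Icc (-L) L)ᶜ, ENNReal.ofReal (m x) = 0 := by
      rw [setLIntegral_congr_fun (g := fun _ => 0) measurableSet_Icc.compl, lintegral_zero]
      intro x hx
      have : x ∉ Ioo (-L) L := fun h => hx ⟨h.1.le, h.2.le⟩
      simp [hm, indicator_of_notMem this]
    rw [hνB _ measurableSet_Icc.compl, h1, h2]
    have h3 : -L ≤ L := by linarith
    simp [h3]
  have hf0 : ∀ x ∉ Icc (-L) L, f x = 0 := fun x hx =>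
    indicator_of_notMem (fun h => hx ⟨h.1.le, h.2.le⟩) _
  have hpl : primitive (g (-L)) f ν (-L) = Function.rightLim w (-L) := by
    rw [primitive_left_endpoint hf0 hνc, measureReal_def, hνl, ENNReal.toReal_ofReal hjl0, hjl]
    ring
  have hpx : ∀ x ∈ Ioo (-L) L, primitive (g (-L)) f ν x = Function.rightLim w x := by
    intro x hx
    have h1 := primitive_sub (c := g (-L)) hfi ν hx.1.le
    rw [hνin _ measurableSet_Ioc (Ioc_subset_Ioo_right hx.2), hpl,
      hw.vectorMeasure_Ioc hx.1.le] at h1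
    linarith
  have hpr : primitive (g (-L)) f ν L = g L := by
    have hLL : -L < L := by linarith
    have h1 := primitive_sub (c := g (-L)) hfi ν hLL.le
    have h2 : ν.real (Ioc (-L) L) = ν.real (Ioo (-L) L) + ν.real {L} := by
      rw [← Ioo_union_right hLL, measureReal_union (by simp) (measurableSet_singleton L)]
    rw [h2, integral_Ioc_eq_integral_Ioo, ← add_assoc, hνin _ measurableSet_Ioo subset_rfl, hpl,
      hw.vectorMeasure_Ioo hLL, measureReal_def, hνr, ENNReal.toReal_ofReal hjr0, hjr] at h1
    linarith
  refine ⟨f, ν, ⟨hνfin, hfi, hf2, hf0, hνc, hpr⟩, ?_, ?_⟩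
  · rw [← Measure.restrict_congr_set Ioo_ae_eq_Icc]
    filter_upwards [ae_restrict_of_ae (rightLim_ae_eq hw), ae_restrict_mem measurableSet_Ioo]
      with x hx hmem
    rw [hpx x hmem, hx]
  have hνx : ∀ x ∈ Ioo (-L) L, ν.real {x} = jump w x := by
    intro x hx
    have := hνin {x} (measurableSet_singleton x) (singleton_subset_iff.2 hx)
    rw [hw.vectorMeasure_singleton] at this
    simpa [jump] using this
  have hatoms : ∑' x, phi σ G (ν.real {x}) ≤
      (∑' x : jumpSet L w, phi σ G (jump w x)) + phi σ G jr + phi σ G jl := by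
    rw [tsum_subtype (jumpSet L w) fun x => phi σ G (jump w x),
      ← tsum_ite_eq L fun _ => phi σ G jr,
      ← tsum_ite_eq (-L) fun _ => phi σ G jl, ← ENNReal.tsum_add, ← ENNReal.tsum_add]
    refine ENNReal.tsum_le_tsum fun x => ?_
    by_cases hx : x ∈ Ioo (-L) L
    · by_cases hxJ : x ∈ jumpSet L w
      · rw [hνx x hx, indicator_of_mem hxJ]
        exact le_self_add.trans le_self_add
      · have : jump w x = 0 := by
          by_contra h
          exact hxJ ⟨hx, h⟩
        rw [hνx x hx, this]
        simp [phi]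
    · by_cases hxr : x = L
      · rw [if_pos hxr, hxr, measureReal_def, hνr, ENNReal.toReal_ofReal hjr0]
        exact le_add_self.trans le_self_add
      by_cases hxl : x = -L
      · rw [if_pos hxl, hxl, measureReal_def, hνl, ENNReal.toReal_ofReal hjl0]
        exact le_add_self
      · have : ν {x} = 0 := by
          refine measure_mono_null (singleton_subset_iff.2 ?_) hνc
          intro h
          exact hx ⟨lt_of_le_of_ne h.1 (Ne.symm hxl), lt_of_le_of_ne h.2 hxr⟩
        simp [measureReal_def, this, phi]
  have hdiffuse : ν {x | ν {x} = 0} ≤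
      (∫⁻ x, ENNReal.ofReal (m x)) + (cantorPart L hw).totalVariation (Ioo (-L) L) := by
    have hc := countable_setOf_singleton_ne_zero ν
    have hmZ : MeasurableSet {x | ν {x} = 0} := by
      have := hc.measurableSet.compl
      simpa [Set.compl_ofPred] using this
    have hcp : cantorPart L hw = (τ.restrict (jumpSet L w)ᶜ).toSignedMeasure := by
      rw [cantorPart, ← Measure.toSignedMeasure_restrict_eq_restrict_toSignedMeasure _ _
        hJ.measurableSet.compl, SignedMeasure.toMeasureOfZeroLE_toSignedMeasure]
    rw [hcp, totalVariation_toSignedMeasure, Measure.restrict_apply measurableSet_Ioo, hνB _ hmZ]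
    have h1 : ENNReal.ofReal jr * {x | ν {x} = 0}.indicator 1 L = 0 := by
      by_cases h : ν {L} = 0
      · rw [← hνr, h, zero_mul]
      · rw [indicator_of_notMem (s := {x | ν {x} = 0}) h, mul_zero]
    have h2 : ENNReal.ofReal jl * {x | ν {x} = 0}.indicator 1 (-L) = 0 := by
      by_cases h : ν {-L} = 0
      · rw [← hνl, h, zero_mul]
      · rw [indicator_of_notMem (s := {x | ν {x} = 0}) h, mul_zero]
    rw [h1, h2, add_zero, add_zero, add_comm]
    refine add_le_add (setLIntegral_le_lintegral _ _) (measure_mono fun x hx => ⟨hx.2, fun h => ?_⟩)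
    apply h.2
    rw [← hνx x hx.2, measureReal_def, show ν {x} = 0 from hx.1, ENNReal.toReal_zero]
  rw [cohesiveEnergy_eq hσ hG, limitEnergy, hlin, ← integral_const_mul,
    ofReal_integral_eq_lintegral_ofReal (hf2.const_mul _)
      (Eventually.of_forall fun x => by positivity)]
  calc _ ≤ (∫⁻ x, ENNReal.ofReal (E₀ / 2 * f x ^ 2)) + (ENNReal.ofReal σ *
        ((∫⁻ x, ENNReal.ofReal (m x)) + (cantorPart L hw).totalVariation (Ioo (-L) L)) +
        ((∑' x : jumpSet L w, phi σ G (jump w x)) + phi σ G jr + phi σ G jl)) := by gcongr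
    _ = _ := by rw [mul_add]; ring

/-! ### Meshes, step functions and piecewise affine functions -/

namespace Mesh

variable {L : ℝ} (T : Mesh L)

theorem left_lt_right (i : Fin T.N) : T.left i < T.right i :=
  T.strictMono Fin.castSucc_lt_succ

theorem neg_le_left (i : Fin T.N) : -L ≤ T.left i := by
  rw [← T.node_zero]
  exact T.strictMono.monotone (Fin.zero_le _)

theorem right_le (i : Fin T.N) : T.right i ≤ L := by
  exact (T.strictMono.monotone (Fin.le_last _)).trans_eq T.node_last

theorem length_le_size (i : Fin T.N) : T.right i - T.left i ≤ T.size :=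
  le_ciSup (f := fun i => T.right i - T.left i) (Finite.bddAbove_range _) i

theorem right_le_left {i j : Fin T.N} (h : i < j) : T.right i ≤ T.left j :=
  T.strictMono.monotone (Fin.succ_le_castSucc_iff.2 h)

theorem pairwise_disjoint :
    Pairwise fun i j : Fin T.N =>
      Disjoint (Ioc (T.left i) (T.right i)) (Ioc (T.left j) (T.right j)) := by
  intro i j hij
  rw [Set.disjoint_left]
  intro x hi hj
  rcases lt_or_gt_of_ne hij with h | h
  · linarith [T.right_le_left h, hi.2, hj.1]
  · linarith [T.right_le_left h, hj.2, hi.1]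

theorem exists_mem_Ioc {x : ℝ} (hx : x ∈ Ioc (-L) L) :
    ∃ i, x ∈ Ioc (T.left i) (T.right i) := by
  have hne : (Finset.univ.filter fun k => x ≤ T.node k).Nonempty :=
    ⟨Fin.last _, by simpa [T.node_last] using hx.2⟩
  set k := Finset.min' _ hne with hk
  have hkm : x ≤ T.node k := by simpa using Finset.min'_mem _ hne
  have hk0 : k ≠ 0 := by
    intro h
    rw [h, T.node_zero] at hkm
    exact absurd hx.1 (not_lt.2 hkm)
  obtain ⟨i, hi⟩ := Fin.exists_succ_eq.2 hk0
  refine ⟨i, ?_, by rwa [right, hi]⟩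
  by_contra hlt
  have : k ≤ i.castSucc := Finset.min'_le _ _ (by simpa [left] using hlt)
  rw [← hi] at this
  exact absurd Fin.castSucc_lt_succ (not_lt.2 this)

/-- The function with the value `c i` on the `i`-th element, and `0` outside `(-L, L]`. -/
def stepFun (c : Fin T.N → ℝ) (x : ℝ) : ℝ :=
  ∑ i, (Ioc (T.left i) (T.right i)).indicator (fun _ => c i) x

variable {T}

theorem stepFun_of_mem (c : Fin T.N → ℝ) {i : Fin T.N} {x : ℝ}
    (hx : x ∈ Ioc (T.left i) (T.right i)) : T.stepFun c x = c i := by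
  rw [stepFun, Finset.sum_eq_single i, indicator_of_mem hx]
  · intro j _ hji
    exact indicator_of_notMem (fun hj => Set.disjoint_left.1 (T.pairwise_disjoint hji) hj hx) _
  · simp

theorem stepFun_of_notMem (c : Fin T.N → ℝ) {x : ℝ} (hx : x ∉ Ioc (-L) L) :
    T.stepFun c x = 0 :=
  Finset.sum_eq_zero fun i _ => indicator_of_notMem
    (fun h => hx (Ioc_subset_Ioc (T.neg_le_left i) (T.right_le i) h)) _

theorem comp_stepFun (c : Fin T.N → ℝ) {φ : ℝ → ℝ} (hφ : φ 0 = 0) (x : ℝ) :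
    φ (T.stepFun c x) = T.stepFun (fun i => φ (c i)) x := by
  by_cases hx : x ∈ Ioc (-L) L
  · obtain ⟨i, hi⟩ := T.exists_mem_Ioc hx
    rw [stepFun_of_mem _ hi, stepFun_of_mem _ hi]
  · rw [stepFun_of_notMem _ hx, stepFun_of_notMem _ hx, hφ]

theorem stepFun_add (c c' : Fin T.N → ℝ) (x : ℝ) :
    T.stepFun (fun i => c i + c' i) x = T.stepFun c x + T.stepFun c' x := by
  rw [stepFun, stepFun, stepFun, ← Finset.sum_add_distrib]
  exact Finset.sum_congr rfl fun i _ => by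
    simp only [indicator]
    split_ifs <;> simp

theorem stepFun_nonneg {c : Fin T.N → ℝ} (hc : ∀ i, 0 ≤ c i) (x : ℝ) : 0 ≤ T.stepFun c x :=
  Finset.sum_nonneg fun i _ => indicator_nonneg (fun _ _ => hc i) _

theorem measurable_stepFun (c : Fin T.N → ℝ) : Measurable (T.stepFun c) :=
  Finset.measurable_fun_sum _ fun _ _ => measurable_const.indicator measurableSet_Ioc

theorem integrable_stepFun (c : Fin T.N → ℝ) : Integrable (T.stepFun c) :=
  integrable_finsetSum _ fun i _ => (integrable_indicator_iff measurableSet_Ioc).2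
    (integrableOn_const measure_Ioc_lt_top.ne)

theorem integral_stepFun (c : Fin T.N → ℝ) :
    ∫ x, T.stepFun c x = ∑ i, (T.right i - T.left i) * c i := by
  simp only [stepFun]
  rw [integral_finsetSum]
  · refine Finset.sum_congr rfl fun i _ => ?_
    rw [integral_indicator measurableSet_Ioc, setIntegral_const]
    simp [measureReal_def, (T.left_lt_right i).le]
  · exact fun i _ => (integrable_indicator_iff measurableSet_Ioc).2
      (integrableOn_const measure_Ioc_lt_top.ne)

/-- The slope of a `P1` function on an element. -/
def slope (T : Mesh L) (v : ℝ → ℝ) (i : Fin T.N) : ℝ :=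
  (v (T.right i) - v (T.left i)) / (T.right i - T.left i)

namespace IsP1

variable {v : ℝ → ℝ}

theorem eq_on (hv : T.IsP1 v) (i : Fin T.N) {x : ℝ} (hx : x ∈ Icc (T.left i) (T.right i)) :
    v x = v (T.left i) + T.slope v i * (x - T.left i) := by
  obtain ⟨p, q, h⟩ := hv i
  have hlt := T.left_lt_right i
  have h0 : T.right i - T.left i ≠ 0 := by linarith
  rw [slope, h x hx, h _ (left_mem_Icc.2 hlt.le), h _ (right_mem_Icc.2 hlt.le)]
  field_simp
  ring

theorem hasDerivAt (hv : T.IsP1 v) (i : Fin T.N) {x : ℝ} (hx : x ∈ Ioo (T.left i) (T.right i)) :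
    HasDerivAt v (T.slope v i) x := by
  have h1 : HasDerivAt (fun y => v (T.left i) + T.slope v i * (y - T.left i)) (T.slope v i) x := by
    simpa using (((hasDerivAt_id x).sub_const (T.left i)).const_mul (T.slope v i)).const_add
      (v (T.left i))
  refine h1.congr_of_eventuallyEq ?_
  filter_upwards [Icc_mem_nhds hx.1 hx.2] with y hy using hv.eq_on i hy

theorem continuousOn (hL : 0 < L) (hv : T.IsP1 v) : ContinuousOn v (Icc (-L) L) := by
  have h : ContinuousOn v (⋃ i, Icc (T.left i) (T.right i)) := by
    refine (locallyFinite_of_finite _).continuousOn_iUnion (fun i => isClosed_Icc) fun i => ?_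
    have : ContinuousOn (fun y => v (T.left i) + T.slope v i * (y - T.left i))
      (Icc (T.left i) (T.right i)) := by fun_prop
    exact this.congr fun x hx => hv.eq_on i hx
  refine h.mono fun x hx => ?_
  rcases eq_or_lt_of_le hx.1 with h1 | h1
  · obtain ⟨i, hi⟩ := T.exists_mem_Ioc (right_mem_Ioc.2 (by linarith : -L < L))
    have hN : 0 < T.N := i.pos
    refine mem_iUnion.2 ⟨⟨0, hN⟩, ?_⟩
    have : T.left ⟨0, hN⟩ = -L := by rw [← T.node_zero]; rfl
    rw [← h1, ← this]
    exact left_mem_Icc.2 (T.left_lt_right _).le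
  · obtain ⟨i, hi⟩ := T.exists_mem_Ioc ⟨h1, hx.2⟩
    exact mem_iUnion.2 ⟨i, Ioc_subset_Icc_self hi⟩

theorem hasDerivAt_stepFun (hv : T.IsP1 v) {x : ℝ} (hx : x ∈ Ioc (-L) L)
    (hn : x ∉ range T.node) : HasDerivAt v (T.stepFun (T.slope v) x) x := by
  obtain ⟨i, hi⟩ := T.exists_mem_Ioc hx
  rw [stepFun_of_mem _ hi]
  refine hv.hasDerivAt i ⟨hi.1, lt_of_le_of_ne hi.2 ?_⟩
  rintro rfl
  exact hn ⟨_, rfl⟩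

theorem integral_slope (hL : 0 < L) (hv : T.IsP1 v) {x : ℝ} (hx : x ∈ Icc (-L) L) :
    ∫ t in Iic x, T.stepFun (T.slope v) t = v x - v (-L) := by
  have h1 : ∫ t in Iic (-L), T.stepFun (T.slope v) t = 0 :=
    setIntegral_eq_zero_of_forall_eq_zero fun y hy =>
      stepFun_of_notMem _ fun h => not_lt.2 hy h.1
  rw [← Iic_union_Ioc_eq_Iic hx.1, setIntegral_union _ measurableSet_Ioc
    (integrable_stepFun _).integrableOn (integrable_stepFun _).integrableOn, h1, zero_add,
    ← intervalIntegral.integral_of_le hx.1]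
  · refine MeasureTheory.integral_eq_of_hasDerivAt_off_countable_of_le _ _ hx.1
      (finite_range T.node).countable ((hv.continuousOn hL).mono (Icc_subset_Icc_right hx.2))
      (fun y hy => ?_) (integrable_stepFun _).intervalIntegrable
    exact hv.hasDerivAt_stepFun ⟨hy.1.1, hy.1.2.le.trans hx.2⟩ hy.2
  · exact Set.disjoint_left.2 fun y hy hy' => not_lt.2 hy hy'.1

theorem mean_mem (hL : 0 < L) (hv : T.IsP1 v) (i : Fin T.N) {a b : ℝ}
    (h : ∀ x ∈ Icc (T.left i) (T.right i), v x ∈ Icc a b) : T.mean v i ∈ Icc a b := by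
  have hlt := T.left_lt_right i
  refine (convex_Icc a b).set_average_mem isClosed_Icc (by simp [hlt]) (by simp) ?_ ?_
  · exact (ae_restrict_mem measurableSet_Icc).mono h
  · exact ((hv.continuousOn hL).mono (Icc_subset_Icc (T.neg_le_left i)
      (T.right_le i))).integrableOn_Icc

end IsP1

theorem integral_element (i : Fin T.N) {F : ℝ → ℝ} {c : ℝ}
    (h : ∀ x ∈ Ioo (T.left i) (T.right i), F x = c) :
    ∫ x in (T.left i)..(T.right i), F x = (T.right i - T.left i) * c := by
  have hlt := (T.left_lt_right i).le
  rw [intervalIntegral.integral_of_le hlt, integral_Ioc_eq_integral_Ioo,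
    setIntegral_congr_fun measurableSet_Ioo h, setIntegral_const]
  simp [measureReal_def, hlt]

end Mesh

open Mesh

/-- The discrete energy in terms of step functions on the whole line. -/
theorem fullEnergy_eq {L : ℝ} (hL : 0 < L) (E₀ σ G : ℝ) {T : Mesh L} (ε : ℝ) {u d : ℝ → ℝ}
    (hu : T.IsP1 u) (hd : T.IsP1 d) (η : Fin T.N → ℝ) :
    fullEnergy E₀ σ G T ε u η d =
      E₀ / 2 * (∫ x, T.stepFun (fun i => T.slope u i - η i) x ^ 2) +
      (∫ x, T.stepFun (fun i => degr (T.mean d i) * σ * η i) x) +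
      G / 2 * ∫ x in Ioc (-L) L, (1 / ε * d x ^ 2 + ε * T.stepFun (T.slope d) x ^ 2) := by
  rw [fullEnergy]
  congr 1
  · congr 1
    · simp only [comp_stepFun (φ := fun x => x ^ 2) _ (by simp), integral_stepFun]
      rw [Finset.mul_sum]
      refine Finset.sum_congr rfl fun i _ => ?_
      rw [integral_element i (c := E₀ / 2 * (T.slope u i - η i) ^ 2)]
      · ring
      · intro x hx
        rw [(hu.hasDerivAt i hx).deriv]
    · rw [integral_stepFun]
      exact Finset.sum_congr rfl fun i _ => integral_element i fun _ _ => rfl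
  · congr 1
    rw [intervalIntegral.integral_of_le (by linarith)]
    refine setIntegral_congr_ae measurableSet_Ioc ?_
    have := measure_eq_zero_iff_ae_notMem.1 ((finite_range T.node).measure_zero volume)
    filter_upwards [this] with x hx hmem
    rw [(hd.hasDerivAt_stepFun hmem hx).deriv]

/-! ### The local lower bound -/

/-- The Modica-Mortola inequality `2 |d D| ≤ d² / ε + ε D²`, integrated from the end points of an
interval to the maximum point of `d`. -/
theorem exists_bound_le_integral {d D : ℝ → ℝ} (hd : Continuous d) {C : Set ℝ} (hC : C.Countable)
    (hD : ∀ x ∉ C, HasDerivAt d (D x) x) (hDi : Integrable D) (hD2 : Integrable fun x => D x ^ 2)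
    (hd01 : ∀ x, d x ∈ Icc (0 : ℝ) 1) {ε : ℝ} (hε : 0 < ε) {s t : ℝ} (hst : s ≤ t) :
    ∃ m ∈ Icc (0 : ℝ) 1, (∀ x ∈ Icc s t, d x ≤ m) ∧
      2 * m ^ 2 - d s ^ 2 - d t ^ 2 ≤ ∫ x in Ioc s t, (1 / ε * d x ^ 2 + ε * D x ^ 2) := by
  obtain ⟨z, hz, hmax⟩ := isCompact_Icc.exists_isMaxOn (nonempty_Icc.2 hst) hd.continuousOn
  refine ⟨d z, hd01 z, fun x hx => hmax hx, ?_⟩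
  have hii : ∀ a b, IntervalIntegrable (fun x => 1 / ε * d x ^ 2 + ε * D x ^ 2) volume a b :=
    fun a b => ((hd.pow 2).const_mul _).intervalIntegrable a b |>.add
      (hD2.const_mul ε).intervalIntegrable
  have hdD : ∀ a b, IntervalIntegrable (fun x => 2 * d x * D x) volume a b := fun a b =>
    (hDi.intervalIntegrable).continuousOn_mul (by fun_prop)
  have hftc : ∀ a b, ∫ x in a..b, 2 * d x * D x = d b ^ 2 - d a ^ 2 := by
    intro a b
    refine MeasureTheory.integral_eq_of_hasDerivAt_off_countable (fun x => d x ^ 2) _ hC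
      (by fun_prop) (fun x hx => ?_) (hdD a b)
    simpa using (hD x hx.2).fun_pow 2
  have hpt : ∀ x, |2 * d x * D x| ≤ 1 / ε * d x ^ 2 + ε * D x ^ 2 := by
    intro x
    have h1 : 1 / ε * d x ^ 2 + ε * D x ^ 2 - 2 * d x * D x = (d x - ε * D x) ^ 2 / ε := by
      field_simp
      ring
    have h2 : 1 / ε * d x ^ 2 + ε * D x ^ 2 + 2 * d x * D x = (d x + ε * D x) ^ 2 / ε := by
      field_simp
      ring
    have h3 : 0 ≤ (d x - ε * D x) ^ 2 / ε := by positivity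
    have h4 : 0 ≤ (d x + ε * D x) ^ 2 / ε := by positivity
    exact abs_le.2 ⟨by linarith, by linarith⟩
  have h1 := intervalIntegral.integral_mono_on hz.1 (hdD s z) (hii s z)
    fun x _ => (le_abs_self _).trans (hpt x)
  have h2 := intervalIntegral.integral_mono_on hz.2 (hdD z t).neg (hii z t)
    fun x _ => (neg_le_abs _).trans (hpt x)
  rw [hftc] at h1
  simp only [Pi.neg_apply] at h2
  rw [intervalIntegral.integral_neg, hftc] at h2
  rw [← intervalIntegral.integral_of_le hst,
    ← intervalIntegral.integral_add_adjacent_intervals (hii s z) (hii z t)]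
  linarith

/-- The real-valued cohesive law `φ(s) = G σ s / (G + σ s)` for `s ≥ 0`, as the optimal balance
between the degraded cohesive energy and the cost of a damage peak of height `m`. -/
theorem cohesive_le {σ G : ℝ} (hσ : 0 < σ) (hG : 0 < G) {s : ℝ} (hs : 0 ≤ s) (m : ℝ) :
    G * σ * s / (G + σ * s) ≤ (1 - m) ^ 2 * σ * s + G * m ^ 2 := by
  have h : 0 < G + σ * s := by positivity
  rw [div_le_iff₀ h]
  nlinarith [sq_nonneg (σ * s - m * (G + σ * s)), mul_nonneg hσ.le hs]

/-- Lower bound of the cohesive and phase-field energies by the cohesive law, for the masses of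
`η` on finitely many disjoint intervals whose end points carry little damage. -/
theorem sum_cohesive_le {L : ℝ} (hL : 0 < L) {σ G : ℝ} (hσ : 0 < σ) (hG : 0 < G) {T : Mesh L}
    {ε : ℝ} (hε : 0 < ε) {d : ℝ → ℝ} (hd : T.IsP1 d) (hd01 : ∀ x ∈ Icc (-L) L, d x ∈ Icc (0 : ℝ) 1)
    (hdl : d (-L) = 0) (hdr : d L = 0) {η : Fin T.N → ℝ} (hη : ∀ i, 0 ≤ η i)
    {N : ℕ} {t : ℕ → ℝ} (ht : ∀ j < N, t j + 2 * T.size ≤ t (j + 1)) (hsize : 0 ≤ T.size) :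
    ∑ j ∈ Finset.range N,
      (G * σ * (∫ x in Ioc (t j + T.size) (t (j + 1) - T.size), T.stepFun η x) /
        (G + σ * ∫ x in Ioc (t j + T.size) (t (j + 1) - T.size), T.stepFun η x) -
        G / 2 * ((Icc (-L) L).indicator d (t j) ^ 2 + (Icc (-L) L).indicator d (t (j + 1)) ^ 2)) ≤
      (∫ x, T.stepFun (fun i => degr (T.mean d i) * σ * η i) x) +
      G / 2 * ∫ x in Ioc (-L) L, (1 / ε * d x ^ 2 + ε * T.stepFun (T.slope d) x ^ 2) := by
  have hLL : -L ≤ L := by linarith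
  set d' := (Icc (-L) L).indicator d with hd'
  set D := T.stepFun (T.slope d) with hDdef
  have hd'in : ∀ x ∈ Icc (-L) L, d' x = d x := fun x hx => indicator_of_mem hx d
  have hcont : Continuous d' := by
    refine continuous_indicator ?_ (by rw [isClosed_Icc.closure_eq]; exact hd.continuousOn hL)
    intro a ha
    rw [frontier_Icc hLL] at ha
    rcases ha with rfl | rfl
    · exact hdl
    · exact hdr
  have h01 : ∀ x, d' x ∈ Icc (0 : ℝ) 1 := by
    intro x
    by_cases hx : x ∈ Icc (-L) L
    · rw [hd'in x hx]
      exact hd01 x hx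
    · rw [hd', indicator_of_notMem hx]
      simp
  have hder : ∀ x ∉ insert (-L) (range T.node), HasDerivAt d' (D x) x := by
    intro x hx
    rw [mem_insert_iff, not_or] at hx
    have hxL : x ≠ L := fun h => hx.2 ⟨Fin.last _, by rw [T.node_last, h]⟩
    by_cases hmem : x ∈ Icc (-L) L
    · have h1 : x ∈ Ioo (-L) L :=
        ⟨lt_of_le_of_ne hmem.1 (Ne.symm hx.1), lt_of_le_of_ne hmem.2 hxL⟩
      refine (hd.hasDerivAt_stepFun ⟨h1.1, h1.2.le⟩ hx.2).congr_of_eventuallyEq ?_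
      filter_upwards [Icc_mem_nhds h1.1 h1.2] with y hy using hd'in y hy
    · have h0 : D x = 0 := stepFun_of_notMem _ fun h => hmem (Ioc_subset_Icc_self h)
      rw [h0]
      refine (hasDerivAt_const x (0 : ℝ)).congr_of_eventuallyEq ?_
      filter_upwards [isClosed_Icc.isOpen_compl.mem_nhds hmem] with y hy
        using indicator_of_notMem hy d
  have hDi : Integrable D := integrable_stepFun _
  have hD2 : Integrable fun x => D x ^ 2 := by
    simp only [hDdef, comp_stepFun (φ := fun x => x ^ 2) _ (by simp)]
    exact integrable_stepFun _
  set A := T.stepFun (fun i => degr (T.mean d i) * σ * η i) with hA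
  have hAi : Integrable A := integrable_stepFun _
  have hA0 : ∀ x, 0 ≤ A x := stepFun_nonneg fun i => by
    have : 0 ≤ degr (T.mean d i) := sq_nonneg _
    have := hη i
    positivity
  set Q : ℝ → ℝ := fun x => 1 / ε * d' x ^ 2 + ε * D x ^ 2 with hQ
  have hQ0 : ∀ x, 0 ≤ Q x := fun x => by positivity
  have hd'2 : Integrable fun x => d' x ^ 2 := by
    have : Continuous fun x => d' x ^ 2 := by fun_prop
    refine this.integrable_of_hasCompactSupport ?_
    refine HasCompactSupport.intro isCompact_Icc (K := Icc (-L) L) fun x hx => ?_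
    simp [hd', indicator_of_notMem hx]
  have hQi : Integrable Q := (hd'2.const_mul _).add (hD2.const_mul _)
  have hQeq : ∫ x in Ioc (-L) L, (1 / ε * d x ^ 2 + ε * D x ^ 2) = ∫ x, Q x := by
    have h1 : ∫ x, Q x = ∫ x in Icc (-L) L, Q x := by
      refine (setIntegral_eq_integral_of_forall_compl_eq_zero fun x hx => ?_).symm
      have h0 : D x = 0 := stepFun_of_notMem _ fun h => hx (Ioc_subset_Icc_self h)
      simp [hQ, hd', indicator_of_notMem hx, h0]
    rw [h1, integral_Icc_eq_integral_Ioc]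
    exact setIntegral_congr_fun measurableSet_Ioc fun x hx => by
      simp only [hQ, hd'in x (Ioc_subset_Icc_self hx)]
  rw [hQeq, ← integral_const_mul, ← integral_add hAi (hQi.const_mul _)]
  have hΨi : Integrable fun x => A x + G / 2 * Q x := hAi.add (hQi.const_mul _)
  have hΨ0 : ∀ x, 0 ≤ A x + G / 2 * Q x := fun x => by
    have := hA0 x
    have := hQ0 x
    positivity
  have hstep : ∀ j < N, t j ≤ t (j + 1) := fun j hj => by linarith [ht j hj]
  have hmono : ∀ n ≤ N, t 0 ≤ t n := by
    intro n
    induction n with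
    | zero => intro _; rfl
    | succ n ih => intro hn; exact (ih (by omega)).trans (hstep n (by omega))
  have hsum : ∑ j ∈ Finset.range N, ∫ x in (t j)..(t (j + 1)), (A x + G / 2 * Q x) ≤
      ∫ x, (A x + G / 2 * Q x) := by
    rw [intervalIntegral.sum_integral_adjacent_intervals fun j _ => hΨi.intervalIntegrable,
      intervalIntegral.integral_of_le (hmono N le_rfl)]
    exact setIntegral_le_integral hΨi (Eventually.of_forall hΨ0)
  refine le_trans (Finset.sum_le_sum fun j hj => ?_) hsum
  have hj' := Finset.mem_range.1 hj
  obtain ⟨m, hm, hmle, hmQ⟩ := exists_bound_le_integral hcont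
    ((finite_range T.node).countable.insert (-L)) hder hDi hD2 h01 hε (hstep j hj')
  set s := ∫ x in Ioc (t j + T.size) (t (j + 1) - T.size), T.stepFun η x with hs
  have hs0 : 0 ≤ s := integral_nonneg fun x => stepFun_nonneg hη x
  have hAs : (1 - m) ^ 2 * σ * s ≤ ∫ x in Ioc (t j) (t (j + 1)), A x := by
    have hsub : Ioc (t j + T.size) (t (j + 1) - T.size) ⊆ Ioc (t j) (t (j + 1)) :=
      Ioc_subset_Ioc (by linarith) (by linarith)
    refine le_trans ?_ (setIntegral_mono_set hAi.integrableOn (Eventually.of_forall hA0)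
      hsub.eventuallyLE)
    rw [hs, ← integral_const_mul]
    refine setIntegral_mono_on ((integrable_stepFun η).integrableOn.const_mul _) hAi.integrableOn
      measurableSet_Ioc fun x hx => ?_
    by_cases hxI : x ∈ Ioc (-L) L
    · obtain ⟨i, hi⟩ := T.exists_mem_Ioc hxI
      have hlen := T.length_le_size i
      have hmean : T.mean d i ∈ Icc 0 m := by
        refine IsP1.mean_mem hL hd i fun y hy => ?_
        have hyI : y ∈ Icc (-L) L := ⟨(T.neg_le_left i).trans hy.1, hy.2.trans (T.right_le i)⟩
        refine ⟨(hd01 y hyI).1, ?_⟩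
        rw [← hd'in y hyI]
        exact hmle y ⟨by linarith [hx.1, hi.2, hy.1], by linarith [hx.2, hi.1, hy.2]⟩
      rw [hA, stepFun_of_mem _ hi, stepFun_of_mem _ hi]
      have h1 : (1 - m) ^ 2 ≤ degr (T.mean d i) :=
        pow_le_pow_left₀ (by linarith [hm.2]) (by linarith [hmean.2]) 2
      have h2 : 0 ≤ σ * η i := mul_nonneg hσ.le (hη i)
      nlinarith
    · rw [hA, stepFun_of_notMem _ hxI, stepFun_of_notMem _ hxI, mul_zero]
  rw [intervalIntegral.integral_of_le (hstep j hj'), integral_add hAi.integrableOn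
    (hQi.const_mul _).integrableOn, integral_const_mul]
  have := cohesive_le hσ hG hs0 m
  nlinarith

/-! ### Compactness -/

/-- Weak sequential compactness of bounded sequences in a separable Hilbert space. -/
theorem exists_subseq_tendsto_inner {H : Type*} [NormedAddCommGroup H] [InnerProductSpace ℝ H]
    [CompleteSpace H] [TopologicalSpace.SeparableSpace H] {x : ℕ → H} {R : ℝ}
    (hx : ∀ n, ‖x n‖ ≤ R) :
    ∃ (y : H) (φ : ℕ → ℕ), StrictMono φ ∧
      ∀ z, Tendsto (fun n => inner ℝ (x (φ n)) z) atTop (𝓝 (inner ℝ y z)) := by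
  have hmem : ∀ n, StrongDual.toWeakDual (InnerProductSpace.toDual ℝ H (x n)) ∈
      WeakDual.toStrongDual ⁻¹' Metric.closedBall (0 : StrongDual ℝ H) R := by
    intro n
    simpa using hx n
  obtain ⟨ℓ, -, φ, hφ, hlim⟩ := WeakDual.isSeqCompact_closedBall ℝ H 0 R hmem
  refine ⟨(InnerProductSpace.toDual ℝ H).symm (WeakDual.toStrongDual ℓ), φ, hφ, fun z => ?_⟩
  rw [InnerProductSpace.toDual_symm_apply]
  have := ((WeakDual.eval_continuous z).tendsto ℓ).comp hlim
  exact this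

/-- Weak compactness in `L²`: the primitives converge pointwise, and the weak lower
semicontinuity of the norm is recorded through the minorants `ℓ n = 2 ⟨F n, f⟩ - ‖f‖²`, whose limit
is `‖f‖²`. -/
theorem exists_weak_limit {L R : ℝ} {F : ℕ → ℝ → ℝ} (hF : ∀ n, MemLp (F n) 2 volume)
    (hF0 : ∀ n, ∀ x ∉ Icc (-L) L, F n x = 0) (hR : ∀ n, ∫ x, F n x ^ 2 ≤ R) :
    ∃ (f : ℝ → ℝ) (φ : ℕ → ℕ), StrictMono φ ∧ Integrable f ∧ (Integrable fun x => f x ^ 2) ∧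
      (∀ x ∉ Icc (-L) L, f x = 0) ∧
      (∀ x, Tendsto (fun n => ∫ t in Iic x, F (φ n) t) atTop (𝓝 (∫ t in Iic x, f t))) ∧
      ∃ ℓ : ℕ → ℝ, (∀ n, ℓ n ≤ ∫ x, F (φ n) x ^ 2) ∧ Tendsto ℓ atTop (𝓝 (∫ x, f x ^ 2)) := by
  set μ := (volume : Measure ℝ).restrict (Icc (-L) L) with hμ
  have : Fact ((2 : ℝ≥0∞) ≠ ∞) := ⟨by simp⟩
  have hFμ : ∀ n, MemLp (F n) 2 μ := fun n => (hF n).restrict _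
  have hnorm : ∀ h : Lp ℝ 2 μ, ‖h‖ ^ 2 = ∫ x in Icc (-L) L, h x ^ 2 := by
    intro h
    rw [← real_inner_self_eq_norm_sq, L2.inner_def]
    refine integral_congr_ae (Eventually.of_forall fun x => ?_)
    simp [sq]
  have hFnorm : ∀ n, ‖(hFμ n).toLp‖ ^ 2 = ∫ x, F n x ^ 2 := by
    intro n
    rw [hnorm, ← setIntegral_eq_integral_of_forall_compl_eq_zero (f := fun x => F n x ^ 2)
      (s := Icc (-L) L) (fun x hx => by simp [hF0 n x hx])]
    refine integral_congr_ae ?_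
    filter_upwards [(hFμ n).coeFn_toLp] with x hx
    rw [hx]
  obtain ⟨y, φ, hφ, hlim⟩ := exists_subseq_tendsto_inner (x := fun n => (hFμ n).toLp)
    (R := Real.sqrt R) fun n => Real.le_sqrt_of_sq_le (by rw [hFnorm]; exact hR n)
  set f := (Icc (-L) L).indicator (y : ℝ → ℝ) with hf
  have hyi : IntegrableOn y (Icc (-L) L) := (Lp.memLp y).integrable (by norm_num)
  have hy2 : IntegrableOn (fun x => y x ^ 2) (Icc (-L) L) := (Lp.memLp y).integrable_sq
  have hf2 : (fun x => f x ^ 2) = (Icc (-L) L).indicator fun x => y x ^ 2 := by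
    ext x
    by_cases hx : x ∈ Icc (-L) L <;> simp [hf, hx]
  refine ⟨f, φ, hφ, hyi.integrable_indicator measurableSet_Icc, ?_,
    fun x hx => indicator_of_notMem hx _, fun x => ?_,
    fun n => 2 * inner ℝ (hFμ (φ n)).toLp y - ‖y‖ ^ 2, fun n => ?_, ?_⟩
  · rw [hf2]
    exact hy2.integrable_indicator measurableSet_Icc
  · have hset : ∀ k : ℝ → ℝ, ∫ t in Iic x, k t ∂μ = ∫ t in Iic x, (Icc (-L) L).indicator k t := by
      intro k
      rw [hμ, Measure.restrict_restrict measurableSet_Iic, setIntegral_indicator measurableSet_Icc]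
    have h1 := hlim (indicatorConstLp 2 (μ := μ) (s := Iic x) measurableSet_Iic
      (measure_ne_top _ _) 1)
    simp_rw [fun z : Lp ℝ 2 μ => real_inner_comm (indicatorConstLp 2 (μ := μ) (s := Iic x)
      measurableSet_Iic (measure_ne_top _ _) 1) z, L2.inner_indicatorConstLp_one] at h1
    rw [hset] at h1
    refine h1.congr fun n => ?_
    have h3 : (Icc (-L) L).indicator (F (φ n)) = F (φ n) :=
      indicator_eq_self.2 fun t ht => not_not.1 fun h => ht (hF0 _ t h)
    have h4 := hset (F (φ n))
    rw [h3] at h4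
    rw [← h4]
    exact integral_congr_ae (ae_restrict_of_ae (hFμ (φ n)).coeFn_toLp)
  · rw [← hFnorm]
    have := norm_sub_sq_real (hFμ (φ n)).toLp y
    have h0 : 0 ≤ ‖(hFμ (φ n)).toLp - y‖ ^ 2 := by positivity
    linarith
  · have h1 := ((hlim y).const_mul 2).sub_const (‖y‖ ^ 2)
    rw [real_inner_self_eq_norm_sq] at h1
    have h2 : ∫ x, f x ^ 2 = ‖y‖ ^ 2 := by
      rw [hnorm, hf2, integral_indicator measurableSet_Icc]
    rw [h2]
    convert h1 using 2
    ring

/-- A Helly type theorem: monotone functions which converge almost everywhere and are constant to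
the left of `-L` and to the right of `L` converge to the distribution function of a measure. -/
theorem exists_measure_of_monotone_tendsto {L : ℝ} {F : ℕ → ℝ → ℝ}
    (hF : ∀ n, Monotone (F n)) (hleft : ∀ n, ∀ x ≤ -L, F n x = 0)
    (hright : ∀ n, ∀ x, L ≤ x → F n x = F n L)
    (hlim : ∀ᵐ x, ∃ l, Tendsto (fun n => F n x) atTop (𝓝 l)) :
    ∃ ν : Measure ℝ, IsFiniteMeasure ν ∧ ν (Icc (-L) L)ᶜ = 0 ∧
      ∀ x, ν {x} = 0 → ∀ s : ℕ → ℝ, Tendsto s atTop (𝓝 x) →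
        Tendsto (fun n => F n (s n)) atTop (𝓝 (ν.real (Iic x))) := by
  set D := {x | ∃ l, Tendsto (fun n => F n x) atTop (𝓝 l)} with hD
  have hdense : Dense D := Measure.dense_of_ae hlim
  choose! ℓ hℓ using fun x (hx : x ∈ D) => hx
  have hmonoD : MonotoneOn ℓ D := fun x hx y hy hxy =>
    le_of_tendsto_of_tendsto' (hℓ x hx) (hℓ y hy) fun n => hF n hxy
  have hnn : ∀ n x, 0 ≤ F n x := by
    intro n x
    rw [← hleft n (min x (-L)) (min_le_right _ _)]
    exact hF n (min_le_left _ _)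
  have hle : ∀ n x, F n x ≤ F n L := by
    intro n x
    rw [← hright n (max x L) (le_max_right _ _)]
    exact hF n (le_max_left _ _)
  obtain ⟨b, hb, hbL, -⟩ : ∃ b ∈ D, L < b ∧ b < L + 1 := by
    obtain ⟨b, hb, hb'⟩ := hdense.exists_between (show L < L + 1 by linarith)
    exact ⟨b, hb, hb'.1, hb'.2⟩
  have hbd : ∀ x ∈ D, ℓ x ≤ ℓ b := fun x hx => le_of_tendsto_of_tendsto' (hℓ x hx) (hℓ b hb)
    fun n => (hle n x).trans_eq (hright n b hbL.le).symm
  have hbd0 : ∀ x ∈ D, 0 ≤ ℓ x := fun x hx => ge_of_tendsto' (hℓ x hx) fun n => hnn n x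
  obtain ⟨M, hM, hMD⟩ := hmonoD.exists_monotone_extension
    ⟨0, by rintro _ ⟨x, hx, rfl⟩; exact hbd0 x hx⟩ ⟨ℓ b, by rintro _ ⟨x, hx, rfl⟩; exact hbd x hx⟩
  have hMl : ∀ x, x < -L → M x = 0 := by
    have hD0 : ∀ x ≤ -L, x ∈ D → M x = 0 := by
      intro x hx hxD
      rw [← hMD hxD]
      refine tendsto_nhds_unique (hℓ x hxD) ?_
      simp [hleft _ x hx]
    intro x hx
    obtain ⟨y, hy, hy'⟩ := hdense.exists_between (show x - 1 < x by linarith)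
    obtain ⟨z, hz, hz'⟩ := hdense.exists_between hx
    refine le_antisymm ?_ ?_
    · rw [← hD0 z hz'.2.le hz]
      exact hM hz'.1.le
    · rw [← hD0 y (by linarith [hy'.2]) hy]
      exact hM hy'.2.le
  have hMr : ∀ x, L < x → M x = ℓ b := by
    have hDb : ∀ x, L ≤ x → x ∈ D → M x = ℓ b := by
      intro x hx hxD
      rw [← hMD hxD]
      refine tendsto_nhds_unique (hℓ x hxD) ((hℓ b hb).congr fun n => ?_)
      rw [hright n x hx, hright n b hbL.le]
    intro x hx
    obtain ⟨y, hy, hy'⟩ := hdense.exists_between (show x < x + 1 by linarith)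
    obtain ⟨z, hz, hz'⟩ := hdense.exists_between hx
    refine le_antisymm ?_ ?_
    · rw [← hDb y (by linarith [hy'.1]) hy]
      exact hM hy'.1.le
    · rw [← hDb z hz'.1.le hz]
      exact hM hz'.2.le
  set R := hM.stieltjesFunction with hR
  have hRl : ∀ x, x < -L → R x = 0 := by
    intro x hx
    rw [hR, hM.stieltjesFunction_eq]
    refine rightLim_eq_of_tendsto ?_
    refine tendsto_const_nhds.congr' ?_
    filter_upwards [Ioo_mem_nhdsGT hx] with y hy
    exact (hMl y hy.2).symm
  have hRr : ∀ x, L ≤ x → R x = ℓ b := by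
    intro x hx
    rw [hR, hM.stieltjesFunction_eq]
    refine rightLim_eq_of_tendsto ?_
    refine tendsto_const_nhds.congr' ?_
    filter_upwards [self_mem_nhdsWithin] with y hy
    exact (hMr y (lt_of_le_of_lt hx hy)).symm
  have hbot : Tendsto R atBot (𝓝 0) := tendsto_const_nhds.congr' (by
    filter_upwards [Iio_mem_atBot (-L)] with x hx using (hRl x hx).symm)
  have htop : Tendsto R atTop (𝓝 (ℓ b)) := tendsto_const_nhds.congr' (by
    filter_upwards [Ici_mem_atTop L] with x hx using (hRr x hx).symm)
  have hfin : IsFiniteMeasure R.measure := R.isFiniteMeasure hbot htop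
  have hIic : ∀ x, R.measure (Iic x) = ENNReal.ofReal (R x) := fun x => by
    rw [R.measure_Iic hbot, sub_zero]
  have hR0 : ∀ x, 0 ≤ R x := fun x => R.mono.le_of_tendsto hbot x
  refine ⟨R.measure, hfin, ?_, fun x hx s hs => ?_⟩
  · have h1 : R.measure (Ioi L) = 0 := by
      rw [R.measure_Ioi htop, hRr L le_rfl]
      simp
    have h2 : R.measure (Iio (-L)) = 0 := by
      rw [R.measure_Iio hbot]
      have : Function.leftLim R (-L) = 0 := by
        refine leftLim_eq_of_tendsto ?_
        refine tendsto_const_nhds.congr' ?_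
        filter_upwards [self_mem_nhdsWithin] with y hy using (hRl y hy).symm
      simp [this]
    refine measure_mono_null (t := Iio (-L) ∪ Ioi L) (fun x hx => ?_) (measure_union_null h2 h1)
    by_contra h
    rw [mem_union, not_or, mem_Iio, mem_Ioi, not_lt, not_lt] at h
    exact hx h
  · rw [measureReal_def, hIic, ENNReal.toReal_ofReal (hR0 x)]
    rw [R.measure_singleton, ENNReal.ofReal_eq_zero, sub_nonpos] at hx
    have hRx : R x = Function.rightLim M x := hM.stieltjesFunction_eq x
    have hcont : ContinuousAt M x := by
      rw [hM.continuousAt_iff_leftLim_eq_rightLim]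
      refine le_antisymm (hM.leftLim_le_rightLim le_rfl) ?_
      rw [← hRx]
      refine hx.trans ?_
      refine le_of_tendsto (R.mono.tendsto_leftLim x) ?_
      filter_upwards [self_mem_nhdsWithin] with y hy
      rw [hR, hM.stieltjesFunction_eq]
      exact hM.rightLim_le_leftLim hy
    rw [hRx, hcont.continuousWithinAt.rightLim_eq]
    refine tendsto_order.2 ⟨fun a ha => ?_, fun a ha => ?_⟩
    · obtain ⟨l, hl, hsub⟩ := exists_Ioc_subset_of_mem_nhds (hcont.eventually_const_lt ha)
        (exists_lt x)
      obtain ⟨y, hy, hy'⟩ := hdense.exists_between hl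
      have h1 : a < ℓ y := by
        rw [hMD hy]
        exact hsub ⟨hy'.1, hy'.2.le⟩
      filter_upwards [(hℓ y hy).eventually_const_lt h1, hs.eventually_const_lt hy'.2] with n h2 h3
      exact h2.trans_le (hF n h3.le)
    · obtain ⟨l, hl, hsub⟩ := exists_Ico_subset_of_mem_nhds (hcont.eventually_lt_const ha)
        (exists_gt x)
      obtain ⟨y, hy, hy'⟩ := hdense.exists_between hl
      have h1 : ℓ y < a := by
        rw [hMD hy]
        exact hsub ⟨hy'.1.le, hy'.2⟩
      filter_upwards [(hℓ y hy).eventually_lt_const h1, hs.eventually_lt_const hy'.1] with n h2 h3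
      exact (hF n h3.le).trans_lt h2

/-! ### The liminf inequality -/

theorem Mesh.size_pos {L : ℝ} (hL : 0 < L) (T : Mesh L) : 0 < T.size := by
  obtain ⟨i, -⟩ := T.exists_mem_Ioc (right_mem_Ioc.2 (by linarith : -L < L))
  linarith [T.length_le_size i, T.left_lt_right i]

/-- A fine partition with nodes in a dense set. -/
theorem exists_partition {D : Set ℝ} (hD : Dense D) {L r : ℝ} (hr : 0 < r) :
    ∃ (t : ℕ → ℝ) (N : ℕ), (∀ j, t j ∈ D) ∧ (∀ j, t j < t (j + 1)) ∧ (∀ j, t (j + 1) - t j < r) ∧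
      t 0 < -L ∧ L < t N := by
  set ρ := r / 2 with hρ
  have hρ0 : 0 < ρ := by positivity
  have h : ∀ j : ℕ, ∃ x ∈ D, x ∈ Ioo (-L - ρ + j * ρ) (-L - ρ + (j + 1) * ρ) := fun j =>
    hD.exists_between (by nlinarith)
  choose t htD ht using h
  obtain ⟨N, hN⟩ := exists_nat_gt ((2 * L + ρ) / ρ)
  rw [div_lt_iff₀ hρ0] at hN
  refine ⟨t, N, htD, fun j => ?_, fun j => ?_, ?_, ?_⟩
  · have h1 := (ht j).2
    have h2 := (ht (j + 1)).1
    push_cast at h2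
    linarith
  · have h1 := (ht j).1
    have h2 := (ht (j + 1)).2
    push_cast at h2
    nlinarith
  · have h1 := (ht 0).2
    push_cast at h1
    linarith
  · have h1 := (ht N).1
    linarith

/-- Passage from the cohesive law on the cells of fine partitions to the cohesive energy. -/
theorem cohesiveEnergy_le_of_partition {L σ G c : ℝ} (hσ : 0 < σ) (hG : 0 < G)
    {ν : Measure ℝ} [IsFiniteMeasure ν] (hν : ν (Icc (-L) L)ᶜ = 0) {D : Set ℝ} (hD : Dense D)
    (h : ∀ (t : ℕ → ℝ) (N : ℕ), (∀ j, t j ∈ D) → (∀ j, t j < t (j + 1)) →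
      ∑ j ∈ Finset.range N, G * σ * ν.real (Ioc (t j) (t (j + 1))) /
        (G + σ * ν.real (Ioc (t j) (t (j + 1)))) ≤ c) :
    cohesiveEnergy σ G ν ≤ ENNReal.ofReal c := by
  -- comparison on the cells of a partition of width less than `r`
  have key : ∀ r : ℝ, 0 < r →
      ∫⁻ x, ENNReal.ofReal (G * σ / (G + σ * ν.real (Ioc (x - r) (x + r)))) ∂ν ≤
        ENNReal.ofReal c := by
    intro r hr
    obtain ⟨t, N, htD, hlt, hwidth, h0, hN⟩ := exists_partition hD (L := L) hr
    have hmono : Monotone t := monotone_nat_of_le_succ fun j => (hlt j).le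
    refine le_trans ?_ (ENNReal.ofReal_le_ofReal (h t N htD hlt))
    have hcover : ∀ᵐ x ∂ν, x ∈ ⋃ j ∈ Finset.range N, Ioc (t j) (t (j + 1)) := by
      have h1 : ∀ᵐ x ∂ν, x ∈ Icc (-L) L := hν
      filter_upwards [h1] with x hx
      have hex : ∃ j, x ≤ t j := ⟨N, hx.2.trans hN.le⟩
      classical
      set j := Nat.find hex with hj
      have hjx : x ≤ t j := Nat.find_spec hex
      have hj0 : j ≠ 0 := by
        intro hj0
        rw [hj0] at hjx
        linarith [hx.1]
      have hjN : j ≤ N := Nat.find_min' hex (hx.2.trans hN.le)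
      obtain ⟨k, hk⟩ := Nat.exists_eq_succ_of_ne_zero hj0
      have hkx : t k < x := not_le.1 (Nat.find_min hex (by omega))
      refine mem_iUnion₂.2 ⟨k, Finset.mem_range.2 (by omega), hkx, ?_⟩
      rwa [hk] at hjx
    have hnull : ν (⋃ j ∈ Finset.range N, Ioc (t j) (t (j + 1)))ᶜ = 0 := hcover
    rw [← lintegral_add_compl _ (Finset.measurableSet_biUnion _ fun j _ => measurableSet_Ioc :
      MeasurableSet (⋃ j ∈ Finset.range N, Ioc (t j) (t (j + 1)))),
      setLIntegral_measure_zero _ _ hnull, add_zero,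
      lintegral_biUnion_finset _ (fun j _ => measurableSet_Ioc)]
    · rw [ENNReal.ofReal_sum_of_nonneg]
      · refine Finset.sum_le_sum fun j _ => ?_
        calc _ ≤ ∫⁻ x in Ioc (t j) (t (j + 1)),
              ENNReal.ofReal (G * σ / (G + σ * ν.real (Ioc (t j) (t (j + 1))))) ∂ν := by
              refine setLIntegral_mono' measurableSet_Ioc fun x hx => ?_
              refine ENNReal.ofReal_le_ofReal ?_
              have hle : ν.real (Ioc (t j) (t (j + 1))) ≤ ν.real (Ioc (x - r) (x + r)) := by
                refine measureReal_mono (Ioc_subset_Ioc ?_ ?_)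
                · linarith [hx.2, hwidth j]
                · linarith [hx.1, hwidth j]
              have h0 : 0 ≤ ν.real (Ioc (t j) (t (j + 1))) := measureReal_nonneg
              gcongr
          _ = _ := by
              have h0 : 0 ≤ ν.real (Ioc (t j) (t (j + 1))) := measureReal_nonneg
              rw [setLIntegral_const, ← ofReal_measureReal, ← ENNReal.ofReal_mul (by positivity)]
              congr 1
              ring
      · intro j _
        have h0 : 0 ≤ ν.real (Ioc (t j) (t (j + 1))) := measureReal_nonneg
        positivity
    · intro i _ j _ hij
      exact (hmono.pairwise_disjoint_on_Ioc_succ hij)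
  have hmeas : ∀ r : ℝ, 0 < r → Measurable fun x =>
      ENNReal.ofReal (G * σ / (G + σ * ν.real (Ioc (x - r) (x + r)))) := by
    intro r hr
    have h1 : Measurable fun x => ν (Ioc (x - r) (x + r)) := by
      have hm : Measurable fun y => ν (Iic y) :=
        (show Monotone fun y => ν (Iic y) from fun a b hab => measure_mono
          (Iic_subset_Iic.2 hab)).measurable
      have : (fun x => ν (Ioc (x - r) (x + r))) = fun x => ν (Iic (x + r)) - ν (Iic (x - r)) := by
        ext x
        have h0 : Ioc (x - r) (x + r) = Iic (x + r) \ Iic (x - r) := by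
          ext y
          simp [and_comm]
        rw [h0, measure_sdiff (Iic_subset_Iic.2 (by linarith))
          measurableSet_Iic.nullMeasurableSet (measure_ne_top _ _)]
      rw [this]
      exact (hm.comp (measurable_id.add_const r)).sub (hm.comp (measurable_id.sub_const r))
    have h2 : Measurable fun x => ν.real (Ioc (x - r) (x + r)) := h1.ennreal_toReal
    fun_prop
  set r : ℕ → ℝ := fun n => 1 / ((n : ℝ) + 1) with hr
  have hr0 : ∀ n, 0 < r n := fun n => by positivity
  have hrlim : Tendsto r atTop (𝓝 0) := tendsto_one_div_add_atTop_nhds_zero_nat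
  have hranti : Antitone r := fun m n hmn => by
    have : (m : ℝ) ≤ n := by exact_mod_cast hmn
    simp only [hr]
    gcongr
  have hptw : ∀ x, Tendsto (fun n => ENNReal.ofReal (G * σ / (G + σ *
      ν.real (Ioc (x - r n) (x + r n))))) atTop
        (𝓝 (ENNReal.ofReal (G * σ / (G + σ * ν.real {x})))) := by
    intro x
    have h1 : Tendsto (fun n => ν (Ioc (x - r n) (x + r n))) atTop (𝓝 (ν {x})) := by
      have h2 : ⋂ n, Ioc (x - r n) (x + r n) = {x} := by
        ext y
        simp only [mem_iInter, mem_Ioc, mem_singleton_iff]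
        constructor
        · intro hy
          refine le_antisymm ?_ ?_
          · have := hrlim.const_add x
            rw [add_zero] at this
            exact ge_of_tendsto' this fun n => (hy n).2
          · have := hrlim.const_sub x
            rw [sub_zero] at this
            exact le_of_tendsto' this fun n => (hy n).1.le
        · rintro rfl n
          have := hr0 n
          exact ⟨by linarith, by linarith⟩
      rw [← h2]
      refine tendsto_measure_iInter_atTop (fun n => measurableSet_Ioc.nullMeasurableSet) ?_
        ⟨0, measure_ne_top _ _⟩
      intro m n hmn
      have := hranti hmn
      exact Ioc_subset_Ioc (by linarith) (by linarith)
    have h3 : Tendsto (fun n => ν.real (Ioc (x - r n) (x + r n))) atTop (𝓝 (ν.real {x})) :=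
      (ENNReal.tendsto_toReal (measure_ne_top _ _)).comp h1
    refine ENNReal.tendsto_ofReal (Tendsto.div tendsto_const_nhds
      ((h3.const_mul σ).const_add G) ?_)
    have : 0 ≤ ν.real {x} := measureReal_nonneg
    positivity
  calc cohesiveEnergy σ G ν = ∫⁻ x, liminf (fun n => ENNReal.ofReal (G * σ / (G + σ *
        ν.real (Ioc (x - r n) (x + r n))))) atTop ∂ν := by
        rw [cohesiveEnergy]
        exact lintegral_congr fun x => (hptw x).liminf_eq.symm
    _ ≤ liminf (fun n => ∫⁻ x, ENNReal.ofReal (G * σ / (G + σ *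
        ν.real (Ioc (x - r n) (x + r n)))) ∂ν) atTop := lintegral_liminf_le fun n => hmeas _ (hr0 n)
    _ ≤ ENNReal.ofReal c := by
        refine liminf_le_of_le (by isBoundedDefault) fun b hb => ?_
        obtain ⟨n, hn⟩ := hb.exists
        exact hn.trans (key _ (hr0 n))

/-- Compactness and lower bound: a sequence of discrete pairs with energies bounded by `c` has, at
an almost everywhere limit `u`, a splitting of energy at most `c`. -/
theorem exists_splitting_of_energy_le {L E₀ σ G c : ℝ} (hL : 0 < L) (hE₀ : 0 < E₀) (hσ : 0 < σ)
    (hG : 0 < G) {g u : ℝ → ℝ} {T : ℕ → Mesh L} {ε : ℕ → ℝ} (hε : ∀ n, 0 < ε n)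
    (hT : Tendsto (fun n => (T n).size) atTop (𝓝 0)) {v d : ℕ → ℝ → ℝ}
    {η : ∀ n, Fin (T n).N → ℝ} (hadm : ∀ n, Admissible g (T n) (v n) (d n))
    (hη : ∀ n i, 0 ≤ η n i) (hc : ∀ n, fullEnergy E₀ σ G (T n) (ε n) (v n) (η n) (d n) ≤ c)
    (hu : ∀ᵐ x ∂(volume.restrict (Icc (-L) L)), Tendsto (fun n => v n x) atTop (𝓝 (u x)))
    (hd : ∀ᵐ x ∂(volume.restrict (Icc (-L) L)), Tendsto (fun n => d n x) atTop (𝓝 0)) :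
    ∃ (f : ℝ → ℝ) (ν : Measure ℝ), IsSplitting L (g (-L)) (g L) f ν ∧
      primitive (g (-L)) f ν =ᵐ[volume.restrict (Icc (-L) L)] u ∧
      ENNReal.ofReal (E₀ / 2 * ∫ x, f x ^ 2) + cohesiveEnergy σ G ν ≤ ENNReal.ofReal c := by
  have hLL : -L ≤ L := by linarith
  set F : ℕ → ℝ → ℝ := fun n => (T n).stepFun fun i => (T n).slope (v n) i - η n i with hF
  set B : ℕ → ℝ := fun n =>
    (∫ x, (T n).stepFun (fun i => degr ((T n).mean (d n) i) * σ * η n i) x) +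
      G / 2 * ∫ x in Ioc (-L) L,
        (1 / ε n * d n x ^ 2 + ε n * (T n).stepFun ((T n).slope (d n)) x ^ 2) with hB
  have hFB : ∀ n, E₀ / 2 * (∫ x, F n x ^ 2) + B n ≤ c := by
    intro n
    have := hc n
    rw [fullEnergy_eq hL E₀ σ G (ε n) (hadm n).u_P1 (hadm n).d_P1] at this
    simp only [hB, hF]
    linarith
  have hB0 : ∀ n, 0 ≤ B n := by
    intro n
    refine add_nonneg (integral_nonneg fun x => stepFun_nonneg (fun i => ?_) x)
      (mul_nonneg (by positivity) (integral_nonneg fun x => ?_))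
    · exact mul_nonneg (mul_nonneg (sq_nonneg _) hσ.le) (hη n i)
    · have := hε n
      positivity
  have hF2 : ∀ n, ∫ x, F n x ^ 2 ≤ c / (E₀ / 2) := by
    intro n
    rw [le_div_iff₀ (by positivity)]
    linarith [hFB n, hB0 n]
  have hFLp : ∀ n, MemLp (F n) 2 volume := by
    intro n
    refine (memLp_two_iff_integrable_sq (measurable_stepFun _).aestronglyMeasurable).2 ?_
    simp only [comp_stepFun (φ := fun x => x ^ 2) _ (by simp)]
    exact integrable_stepFun _
  obtain ⟨f, φ, hφ, hfi, hf2, hf0, hFlim, ℓ, hℓ, hℓlim⟩ := exists_weak_limit hFLp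
    (fun n x hx => stepFun_of_notMem _ fun h => hx (Ioc_subset_Icc_self h)) hF2
  -- the primitives of the slips are increasing, and converge wherever `v` does
  set M : ℕ → ℝ → ℝ := fun n x => ∫ t in Iic x, (T (φ n)).stepFun (η (φ n)) t with hM
  have hMsub : ∀ n, ∀ a b, a ≤ b →
      M n b - M n a = ∫ t in Ioc a b, (T (φ n)).stepFun (η (φ n)) t := by
    intro n a b hab
    simp only [hM]
    rw [← Iic_union_Ioc_eq_Iic hab, setIntegral_union _ measurableSet_Ioc
      (integrable_stepFun _).integrableOn (integrable_stepFun _).integrableOn, add_sub_cancel_left]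
    exact Set.disjoint_left.2 fun y hy hy' => not_lt.2 hy hy'.1
  have hMmono : ∀ n, Monotone (M n) := by
    intro n a b hab
    have h1 : 0 ≤ ∫ t in Ioc a b, (T (φ n)).stepFun (η (φ n)) t :=
      integral_nonneg fun x => stepFun_nonneg (hη _) x
    linarith [hMsub n a b hab]
  have hMl : ∀ n, ∀ x ≤ -L, M n x = 0 := fun n x hx =>
    setIntegral_eq_zero_of_forall_eq_zero fun y hy =>
      stepFun_of_notMem _ fun h => not_lt.2 (le_trans hy hx) h.1
  have hMr : ∀ n, ∀ x, L ≤ x → M n x = M n L := by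
    intro n x hx
    have h1 : ∫ t in Ioc L x, (T (φ n)).stepFun (η (φ n)) t = 0 :=
      setIntegral_eq_zero_of_forall_eq_zero fun y hy =>
        stepFun_of_notMem _ fun h => not_lt.2 h.2 hy.1
    linarith [hMsub n L x hx]
  have hMv : ∀ n, ∀ x ∈ Icc (-L) L, M n x = v (φ n) x - g (-L) - ∫ t in Iic x, F (φ n) t := by
    intro n x hx
    have h1 := (hadm (φ n)).u_P1.integral_slope hL hx
    rw [(hadm (φ n)).u_left] at h1
    rw [← h1, eq_sub_iff_add_eq, ← integral_add (integrable_stepFun _).integrableOn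
      (integrable_stepFun _).integrableOn]
    refine integral_congr_ae (Eventually.of_forall fun t => ?_)
    simp only [← stepFun_add, add_sub_cancel]
  have hMlim : ∀ x ∈ Icc (-L) L, Tendsto (fun n => v n x) atTop (𝓝 (u x)) →
      Tendsto (fun n => M n x) atTop (𝓝 (u x - g (-L) - ∫ t in Iic x, f t)) := by
    intro x hx hux
    refine Tendsto.congr (fun n => (hMv n x hx).symm) ?_
    exact ((hux.comp hφ.tendsto_atTop).sub_const _).sub (hFlim x)
  have hMlimL : Tendsto (fun n => M n L) atTop (𝓝 (g L - g (-L) - ∫ t in Iic L, f t)) := by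
    refine Tendsto.congr (fun n => (hMv n L ⟨hLL, le_rfl⟩).symm) ?_
    simp only [(hadm _).u_right]
    exact tendsto_const_nhds.sub (hFlim L)
  rw [ae_restrict_iff' measurableSet_Icc] at hu hd
  obtain ⟨ν, hfin, hνc, hν⟩ := exists_measure_of_monotone_tendsto hMmono hMl hMr (by
    filter_upwards [hu] with x hx
    rcases lt_or_ge x (-L) with h1 | h1
    · exact ⟨0, by simp [hMl _ x h1.le]⟩
    rcases lt_or_ge L x with h2 | h2
    · exact ⟨_, by simpa only [hMr _ x h2.le] using hMlimL⟩
    · exact ⟨_, hMlim x ⟨h1, h2⟩ (hx ⟨h1, h2⟩)⟩)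
  have hatom : ∀ᵐ x, ν {x} = 0 := by
    have := measure_eq_zero_iff_ae_notMem.1
      ((countable_setOf_singleton_ne_zero ν).measure_zero volume)
    filter_upwards [this] with x hx using not_not.1 hx
  have hright : primitive (g (-L)) f ν L = g L := by
    have h1 : ν {L + 1} = 0 := measure_mono_null (singleton_subset_iff.2 fun h => by
      linarith [h.2]) hνc
    have h2 := hν (L + 1) h1 (fun _ => L + 1) tendsto_const_nhds
    simp only [hMr _ (L + 1) (by linarith)] at h2
    have h3 := tendsto_nhds_unique hMlimL h2
    have h4 : ν (Iic (L + 1)) = ν (Iic L) := by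
      refine le_antisymm ?_ (measure_mono (Iic_subset_Iic.2 (by linarith)))
      refine (measure_mono (t := Iic L ∪ (Icc (-L) L)ᶜ) fun x _ => ?_).trans
        ((measure_union_le _ _).trans (by rw [hνc, add_zero]))
      rcases le_or_gt x L with h | h
      · exact Or.inl h
      · exact Or.inr fun h' => not_lt.2 h'.2 h
    rw [measureReal_def, h4, ← measureReal_def] at h3
    rw [primitive]
    linarith
  refine ⟨f, ν, ⟨hfin, hfi, hf2, hf0, hνc, hright⟩, ?_, ?_⟩
  · rw [EventuallyEq, ae_restrict_iff' measurableSet_Icc]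
    filter_upwards [hu, hatom] with x hx hx0 hmem
    have := tendsto_nhds_unique (hMlim x hmem (hx hmem)) (hν x hx0 (fun _ => x) tendsto_const_nhds)
    rw [primitive, ← this]
    ring
  -- the nodes of the partitions are points of vanishing damage which are not atoms
  set D : Set ℝ := {x | ν {x} = 0 ∧
    Tendsto (fun n => (Icc (-L) L).indicator (d (φ n)) x) atTop (𝓝 0)} with hD
  have hDdense : Dense D := by
    refine Measure.dense_of_ae (μ := volume) ?_
    filter_upwards [hatom, hd] with x hx0 hx
    refine ⟨hx0, ?_⟩
    by_cases hmem : x ∈ Icc (-L) L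
    · simp only [indicator_of_mem hmem]
      exact (hx hmem).comp hφ.tendsto_atTop
    · simp [indicator_of_notMem hmem]
  have hTφ : Tendsto (fun n => (T (φ n)).size) atTop (𝓝 0) := hT.comp hφ.tendsto_atTop
  have key : ∀ (t : ℕ → ℝ) (N : ℕ), (∀ j, t j ∈ D) → (∀ j, t j < t (j + 1)) →
      ∑ j ∈ Finset.range N, G * σ * ν.real (Ioc (t j) (t (j + 1))) /
        (G + σ * ν.real (Ioc (t j) (t (j + 1)))) ≤ c - E₀ / 2 * ∫ x, f x ^ 2 := by
    intro t N htD htlt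
    -- the cells are shrunk by the mesh size, so that they only meet elements inside the cell
    set S : ℕ → ℕ → ℝ := fun n j => ∫ x in Ioc (t j + (T (φ n)).size) (t (j + 1) - (T (φ n)).size),
      (T (φ n)).stepFun (η (φ n)) x with hS
    have hSlim : ∀ j, Tendsto (fun n => S n j) atTop (𝓝 (ν.real (Ioc (t j) (t (j + 1))))) := by
      intro j
      have h1 : ν.real (Ioc (t j) (t (j + 1))) = ν.real (Iic (t (j + 1))) - ν.real (Iic (t j)) := by
        rw [← Iic_union_Ioc_eq_Iic (htlt j).le, measureReal_union _ measurableSet_Ioc,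
          add_sub_cancel_left]
        exact Set.disjoint_left.2 fun y hy hy' => not_lt.2 hy hy'.1
      rw [h1]
      have h2 := hν _ (htD (j + 1)).1 (fun n => t (j + 1) - (T (φ n)).size)
        (by simpa using hTφ.const_sub (t (j + 1)))
      have h3 := hν _ (htD j).1 (fun n => t j + (T (φ n)).size)
        (by simpa using hTφ.const_add (t j))
      refine (h2.sub h3).congr' ?_
      have hpos : 0 < (t (j + 1) - t j) / 2 := by linarith [htlt j]
      filter_upwards [hTφ.eventually_lt_const hpos] with n hn
      exact hMsub n _ _ (by linarith)
    have hsum : ∀ᶠ n in atTop, ∑ j ∈ Finset.range N,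
        (G * σ * S n j / (G + σ * S n j) - G / 2 * ((Icc (-L) L).indicator (d (φ n)) (t j) ^ 2 +
          (Icc (-L) L).indicator (d (φ n)) (t (j + 1)) ^ 2)) ≤ c - E₀ / 2 * ℓ n := by
      have hev : ∀ᶠ n in atTop, ∀ j ∈ Finset.range N, t j + 2 * (T (φ n)).size ≤ t (j + 1) := by
        rw [Finset.eventually_all]
        intro j _
        have hpos : 0 < (t (j + 1) - t j) / 2 := by linarith [htlt j]
        filter_upwards [hTφ.eventually_lt_const hpos] with n hn
        linarith
      filter_upwards [hev] with n hn
      have ha := hadm (φ n)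
      have h1 := sum_cohesive_le hL hσ hG (hε (φ n)) ha.d_P1 ha.d_mem ha.d_left ha.d_right
        (hη (φ n)) (N := N) (t := t) (fun j hj => hn j (Finset.mem_range.2 hj))
        (Mesh.size_pos hL _).le
      have h2 := hFB (φ n)
      have h3 := mul_le_mul_of_nonneg_left (hℓ n) (by positivity : 0 ≤ E₀ / 2)
      refine h1.trans ?_
      simp only [hB] at h2
      linarith
    refine le_of_tendsto_of_tendsto ?_ ((hℓlim.const_mul (E₀ / 2)).const_sub c) hsum
    refine tendsto_finsetSum _ fun j _ => ?_
    have h0 : 0 ≤ ν.real (Ioc (t j) (t (j + 1))) := measureReal_nonneg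
    have h1 : Tendsto (fun n => G * σ * S n j / (G + σ * S n j)) atTop
        (𝓝 (G * σ * ν.real (Ioc (t j) (t (j + 1))) / (G + σ * ν.real (Ioc (t j) (t (j + 1)))))) :=
      ((hSlim j).const_mul _).div (((hSlim j).const_mul σ).const_add G) (by positivity)
    have h2 := (((htD j).2.pow 2).add ((htD (j + 1)).2.pow 2)).const_mul (G / 2)
    simpa using h1.sub h2
  have hnn : 0 ≤ E₀ / 2 * ∫ x, f x ^ 2 :=
    mul_nonneg (by positivity) (integral_nonneg fun x => sq_nonneg _)
  have hc0 : 0 ≤ c - E₀ / 2 * ∫ x, f x ^ 2 := by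
    obtain ⟨t, N, htD, htlt, -⟩ := exists_partition hDdense (L := L) one_pos
    simpa using key t 0 htD htlt
  calc _ ≤ ENNReal.ofReal (E₀ / 2 * ∫ x, f x ^ 2) +
        ENNReal.ofReal (c - E₀ / 2 * ∫ x, f x ^ 2) := by
        gcongr
        exact cohesiveEnergy_le_of_partition hσ hG hνc hDdense key
    _ = ENNReal.ofReal c := by
        rw [← ENNReal.ofReal_add hnn hc0]
        congr 1
        ring

theorem Mesh.IsP1.integral_sq_le {L : ℝ} (hL : 0 < L) {T : Mesh L} {d : ℝ → ℝ} (hd : T.IsP1 d)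
    {ε : ℝ} (hε : 0 < ε) :
    ∫ x in Ioc (-L) L, d x ^ 2 ≤
      ε * ∫ x in Ioc (-L) L, (1 / ε * d x ^ 2 + ε * T.stepFun (T.slope d) x ^ 2) := by
  have h1 : IntegrableOn (fun x => d x ^ 2) (Ioc (-L) L) :=
    (((hd.continuousOn hL).pow 2).integrableOn_Icc).mono_set Ioc_subset_Icc_self
  have h2 : Integrable (fun x => T.stepFun (T.slope d) x ^ 2) := by
    simp only [comp_stepFun (φ := fun x => x ^ 2) _ (by simp)]
    exact integrable_stepFun _
  rw [← integral_const_mul]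
  refine integral_mono h1
    (((h1.const_mul (1 / ε)).add (h2.integrableOn.const_mul ε)).const_mul ε) fun x => ?_
  have h3 : ε * (1 / ε * d x ^ 2 + ε * T.stepFun (T.slope d) x ^ 2) =
      d x ^ 2 + (ε * T.stepFun (T.slope d) x) ^ 2 := by
    field_simp
  simp only [h3]
  nlinarith [sq_nonneg (ε * T.stepFun (T.slope d) x)]

/-- Bounded energy forces the damage to be of order `√ε` in `L²`. -/
theorem integral_sq_le_of_fullEnergy_le {L E₀ σ G c : ℝ} (hL : 0 < L) (hE₀ : 0 < E₀) (hσ : 0 < σ)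
    (hG : 0 < G) {T : Mesh L} {ε : ℝ} (hε : 0 < ε) {v d : ℝ → ℝ} {η : Fin T.N → ℝ}
    (hv : T.IsP1 v) (hd : T.IsP1 d) (hη : ∀ i, 0 ≤ η i) (hc : fullEnergy E₀ σ G T ε v η d ≤ c) :
    ∫ x in Ioc (-L) L, d x ^ 2 ≤ 2 * c / G * ε := by
  rw [fullEnergy_eq hL E₀ σ G ε hv hd] at hc
  have h1 : 0 ≤ E₀ / 2 * ∫ x, T.stepFun (fun i => T.slope v i - η i) x ^ 2 :=
    mul_nonneg (by positivity) (integral_nonneg fun x => sq_nonneg _)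
  have h2 : 0 ≤ ∫ x, T.stepFun (fun i => degr (T.mean d i) * σ * η i) x :=
    integral_nonneg fun x => stepFun_nonneg
      (fun i => mul_nonneg (mul_nonneg (sq_nonneg _) hσ.le) (hη i)) x
  refine (hd.integral_sq_le hL hε).trans ?_
  rw [mul_comm]
  refine mul_le_mul_of_nonneg_right ?_ hε.le
  rw [le_div_iff₀ hG]
  linarith

/-- A splitting of `w` bounds the limit functional at the class of `w`. -/
theorem limitFunctional_le_of_splitting {L E₀ σ G : ℝ} (hL : 0 < L) (hE₀ : 0 < E₀) (hσ : 0 < σ)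
    (hG : 0 < G) {g f : ℝ → ℝ} {ν : Measure ℝ} (hs : IsSplitting L (g (-L)) (g L) f ν)
    {p : L1 L × L1 L}
    (h1 : (p.1 : ℝ → ℝ) =ᵐ[volume.restrict (Icc (-L) L)] primitive (g (-L)) f ν)
    (hb : ∀ᵐ x ∂(volume.restrict (Icc (-L) L)), |(p.1 : ℝ → ℝ) x| ≤ supNorm L g)
    (h2 : (p.2 : ℝ → ℝ) =ᵐ[volume.restrict (Icc (-L) L)] 0) :
    limitFunctional L E₀ σ G g p ≤
      ENNReal.ofReal (E₀ / 2 * ∫ x, f x ^ 2) + cohesiveEnergy σ G ν := by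
  have := hs.finite
  have hw := boundedVariationOn_primitive (g (-L)) hs.integrable ν
  refine le_trans ?_ (limitEnergy_primitive_le hL hE₀ hσ hG g hs hw)
  rw [limitFunctional]
  refine iInf_le_of_le _ (iInf_le_of_le hw (iInf_le_of_le h1 (iInf_le_of_le hb
    (iInf_le_of_le (fun x hx => ?_) (iInf_le_of_le ?_ (iInf_le_of_le h2 le_rfl))))))
  · rw [jump_primitive _ hs.integrable]
    refine lt_of_le_of_ne measureReal_nonneg fun h => hx.2 ?_
    rw [jump_primitive _ hs.integrable, ← h]
  · rw [cantorPart_primitive L _ hs.integrable]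
    exact Measure.zero_le_toSignedMeasure _

/-- The liminf inequality. A bound on a subsequence of the energies yields a splitting of the limit,
which is then a competitor in the definition of the limit functional. -/
theorem limitFunctional_le_liminf {L E₀ σ G : ℝ} (hL : 0 < L) (hE₀ : 0 < E₀) (hσ : 0 < σ)
    (hG : 0 < G) {g : ℝ → ℝ} {T : ℕ → Mesh L} {ε : ℕ → ℝ} (hε_pos : ∀ n, 0 < ε n)
    (hT : Tendsto (fun n => (T n).size) atTop (𝓝 0)) (hε : Tendsto ε atTop (𝓝 0))
    {p : L1 L × L1 L} {y : ℕ → L1 L × L1 L} (hy : Tendsto y atTop (𝓝 p)) :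
    limitFunctional L E₀ σ G g p ≤
      liminf (fun n => discreteFunctional E₀ σ G g (T n) (ε n) (y n)) atTop := by
  refine le_of_forall_gt_imp_ge_of_dense fun c hc => ?_
  rcases eq_or_ne c ⊤ with rfl | hctop
  · exact le_top
  obtain ⟨ψ, hψ, hlt⟩ := extraction_of_frequently_atTop
    (frequently_lt_of_liminf_lt (by isBoundedDefault) hc)
  simp only [discreteFunctional, reducedEnergy, iInf_lt_iff] at hlt
  choose v d hadm hv hd η hη hlt using hlt
  have hle : ∀ n, fullEnergy E₀ σ G (T (ψ n)) (ε (ψ n)) (v n) (η n) (d n) ≤ c.toReal :=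
    fun n => (ENNReal.ofReal_le_iff_le_toReal hctop).1 (hlt n).le
  -- almost everywhere convergence along a further subsequence
  have hy1 : Tendsto (fun n => (y (ψ n)).1) atTop (𝓝 p.1) :=
    (continuous_fst.tendsto p).comp (hy.comp hψ.tendsto_atTop)
  have hy2 : Tendsto (fun n => (y (ψ n)).2) atTop (𝓝 p.2) :=
    (continuous_snd.tendsto p).comp (hy.comp hψ.tendsto_atTop)
  obtain ⟨χ, hχ, hχlim⟩ := (tendstoInMeasure_of_tendsto_Lp hy1).exists_seq_tendsto_ae
  obtain ⟨χ', hχ', hχlim'⟩ := (tendstoInMeasure_of_tendsto_Lp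
    (hy2.comp hχ.tendsto_atTop)).exists_seq_tendsto_ae
  set θ : ℕ → ℕ := fun n => χ (χ' n) with hθ
  have hθt : Tendsto θ atTop atTop := hχ.tendsto_atTop.comp hχ'.tendsto_atTop
  have hvlim : ∀ᵐ x ∂(volume.restrict (Icc (-L) L)),
      Tendsto (fun n => v (θ n) x) atTop (𝓝 ((p.1 : ℝ → ℝ) x)) := by
    filter_upwards [hχlim, ae_all_iff.2 hv] with x hx hvx
    simp only [← hvx]
    exact hx.comp hχ'.tendsto_atTop
  have hdlim : ∀ᵐ x ∂(volume.restrict (Icc (-L) L)),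
      Tendsto (fun n => d (θ n) x) atTop (𝓝 ((p.2 : ℝ → ℝ) x)) := by
    filter_upwards [hχlim', ae_all_iff.2 hd] with x hx hdx
    simp only [← hdx]
    exact hx
  have hψθ : Tendsto (fun n => ψ (θ n)) atTop atTop := hψ.tendsto_atTop.comp hθt
  have hp2 : (p.2 : ℝ → ℝ) =ᵐ[volume.restrict (Icc (-L) L)] 0 := by
    have hm : ∀ n, AEMeasurable (fun x => ENNReal.ofReal (d (θ n) x ^ 2))
        (volume.restrict (Icc (-L) L)) := fun n =>
      ((((hadm (θ n)).d_P1.continuousOn hL).aemeasurable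
          measurableSet_Icc).pow_const 2).ennreal_ofReal
    have hint : ∀ n, ∫⁻ x in Icc (-L) L, ENNReal.ofReal (d (θ n) x ^ 2) ≤
        ENNReal.ofReal (2 * c.toReal / G * ε (ψ (θ n))) := by
      intro n
      have h1 := integral_sq_le_of_fullEnergy_le hL hE₀ hσ hG (hε_pos _) (hadm (θ n)).u_P1
        (hadm (θ n)).d_P1 (hη (θ n)) (hle (θ n))
      rw [← integral_Icc_eq_integral_Ioc] at h1
      have h2 : IntegrableOn (fun x => d (θ n) x ^ 2) (Icc (-L) L) :=
        (((hadm (θ n)).d_P1.continuousOn hL).pow 2).integrableOn_Icc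
      rw [← ofReal_integral_eq_lintegral_ofReal h2 (Eventually.of_forall fun x => sq_nonneg _)]
      exact ENNReal.ofReal_le_ofReal h1
    have hzero : Tendsto (fun n => ENNReal.ofReal (2 * c.toReal / G * ε (ψ (θ n)))) atTop
        (𝓝 0) := by
      simpa using ENNReal.tendsto_ofReal ((hε.comp hψθ).const_mul (2 * c.toReal / G))
    have h0 : ∫⁻ x in Icc (-L) L, ENNReal.ofReal ((p.2 : ℝ → ℝ) x ^ 2) = 0 := by
      refine le_antisymm ?_ zero_le
      calc ∫⁻ x in Icc (-L) L, ENNReal.ofReal ((p.2 : ℝ → ℝ) x ^ 2)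
          = ∫⁻ x in Icc (-L) L, liminf (fun n => ENNReal.ofReal (d (θ n) x ^ 2)) atTop := by
            refine lintegral_congr_ae ?_
            filter_upwards [hdlim] with x hx
            exact (ENNReal.tendsto_ofReal (hx.pow 2)).liminf_eq.symm
        _ ≤ liminf (fun n => ∫⁻ x in Icc (-L) L, ENNReal.ofReal (d (θ n) x ^ 2)) atTop :=
            lintegral_liminf_le' hm
        _ ≤ liminf (fun n => ENNReal.ofReal (2 * c.toReal / G * ε (ψ (θ n)))) atTop :=
            liminf_le_liminf (Eventually.of_forall hint)
        _ = 0 := hzero.liminf_eq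
    rw [lintegral_eq_zero_iff'
      ((Lp.aestronglyMeasurable _).aemeasurable.pow_const 2).ennreal_ofReal] at h0
    filter_upwards [h0] with x hx
    have hx' : (p.2 : ℝ → ℝ) x ^ 2 ≤ 0 := ENNReal.ofReal_eq_zero.1 hx
    exact pow_eq_zero_iff two_ne_zero |>.1 (le_antisymm hx' (sq_nonneg _))
  obtain ⟨f, ν, hs, hprim, hen⟩ := exists_splitting_of_energy_le hL hE₀ hσ hG
    (fun n => hε_pos (ψ (θ n))) (hT.comp hψθ) (fun n => hadm (θ n)) (fun n => hη (θ n))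
    (fun n => hle (θ n)) hvlim (by
      filter_upwards [hdlim, hp2] with x hx hx0
      simpa [hx0] using hx)
  rw [ENNReal.ofReal_toReal hctop] at hen
  refine (limitFunctional_le_of_splitting hL hE₀ hσ hG hs hprim.symm ?_ hp2).trans hen
  filter_upwards [hvlim, ae_restrict_mem measurableSet_Icc] with x hx hmem
  exact le_of_tendsto hx.abs (Eventually.of_forall fun n => (hadm (θ n)).u_bound x hmem)

/-! ### Nodal interpolation -/

namespace Mesh

variable {L : ℝ} (T : Mesh L)

/-- The piecewise affine function with the values of `q` at the nodes (extended by `q` itself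
outside `(-L, L]`). -/
def interp (q : ℝ → ℝ) (x : ℝ) : ℝ :=
  open Classical in
  if x ∈ Ioc (-L) L then
    T.stepFun (fun i => q (T.left i) - T.slope q i * T.left i) x + T.stepFun (T.slope q) x * x
  else q x

variable {T}

theorem interp_of_mem_Ioc (q : ℝ → ℝ) {i : Fin T.N} {x : ℝ}
    (hx : x ∈ Ioc (T.left i) (T.right i)) :
    T.interp q x = q (T.left i) + T.slope q i * (x - T.left i) := by
  rw [interp, if_pos (Ioc_subset_Ioc (T.neg_le_left i) (T.right_le i) hx), stepFun_of_mem _ hx,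
    stepFun_of_mem _ hx]
  ring

theorem slope_mul (q : ℝ → ℝ) (i : Fin T.N) :
    T.slope q i * (T.right i - T.left i) = q (T.right i) - q (T.left i) := by
  have := T.left_lt_right i
  rw [slope, div_mul_cancel₀]
  linarith

theorem interp_node (q : ℝ → ℝ) (k : Fin (T.N + 1)) : T.interp q (T.node k) = q (T.node k) := by
  induction k using Fin.cases with
  | zero => rw [interp, if_neg (by simp [T.node_zero])]
  | succ i =>
    change T.interp q (T.right i) = q (T.right i)
    rw [interp_of_mem_Ioc q (right_mem_Ioc.2 (T.left_lt_right i)), slope_mul]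
    ring

theorem interp_eq (q : ℝ → ℝ) {i : Fin T.N} {x : ℝ} (hx : x ∈ Icc (T.left i) (T.right i)) :
    T.interp q x = q (T.left i) + T.slope q i * (x - T.left i) := by
  rcases eq_or_lt_of_le hx.1 with h | h
  · have : T.interp q (T.left i) = q (T.left i) := interp_node q i.castSucc
    rw [← h, this]
    ring
  · exact interp_of_mem_Ioc q ⟨h, hx.2⟩

theorem isP1_interp (q : ℝ → ℝ) : T.IsP1 (T.interp q) := fun i =>
  ⟨T.slope q i, q (T.left i) - T.slope q i * T.left i, fun x hx => by rw [interp_eq q hx]; ring⟩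

theorem interp_neg (q : ℝ → ℝ) : T.interp q (-L) = q (-L) := by
  rw [← T.node_zero, interp_node]

theorem interp_self (q : ℝ → ℝ) : T.interp q L = q L := by
  have := interp_node (T := T) q (Fin.last _)
  rwa [T.node_last] at this

theorem slope_interp (q : ℝ → ℝ) (i : Fin T.N) : T.slope (T.interp q) i = T.slope q i := by
  have h1 : T.interp q (T.left i) = q (T.left i) := interp_node q i.castSucc
  have h2 : T.interp q (T.right i) = q (T.right i) := interp_node q i.succ
  rw [slope, slope, h1, h2]

theorem interp_mem (q : ℝ → ℝ) {i : Fin T.N} {x a b : ℝ} (hx : x ∈ Icc (T.left i) (T.right i))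
    (hl : q (T.left i) ∈ Icc a b) (hr : q (T.right i) ∈ Icc a b) : T.interp q x ∈ Icc a b := by
  have hlt := T.left_lt_right i
  have h0 : 0 < T.right i - T.left i := by linarith
  have h1 : T.interp q x = ((T.right i - x) / (T.right i - T.left i)) • q (T.left i) +
      ((x - T.left i) / (T.right i - T.left i)) • q (T.right i) := by
    rw [interp_eq q hx, slope, smul_eq_mul, smul_eq_mul]
    field_simp
    ring
  rw [h1]
  refine convex_Icc a b hl hr (div_nonneg ?_ h0.le) (div_nonneg ?_ h0.le) ?_
  · linarith [hx.2]
  · linarith [hx.1]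
  · field_simp
    ring

theorem exists_mem_Icc (hL : 0 < L) {x : ℝ} (hx : x ∈ Icc (-L) L) :
    ∃ i, x ∈ Icc (T.left i) (T.right i) := by
  rcases eq_or_lt_of_le hx.1 with h | h
  · obtain ⟨j, -⟩ := T.exists_mem_Ioc (right_mem_Ioc.2 (by linarith : -L < L))
    have h0 : T.left ⟨0, j.pos⟩ = -L := by rw [← T.node_zero]; rfl
    exact ⟨⟨0, j.pos⟩, by rw [← h, ← h0]; exact left_mem_Icc.2 (T.left_lt_right _).le⟩
  · obtain ⟨i, hi⟩ := T.exists_mem_Ioc ⟨h, hx.2⟩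
    exact ⟨i, Ioc_subset_Icc_self hi⟩

theorem interp_mem_of_forall (hL : 0 < L) (q : ℝ → ℝ) {a b : ℝ} (h : ∀ x, q x ∈ Icc a b)
    {x : ℝ} (hx : x ∈ Icc (-L) L) : T.interp q x ∈ Icc a b := by
  obtain ⟨i, hi⟩ := T.exists_mem_Icc hL hx
  exact interp_mem q hi (h _) (h _)

end Mesh

theorem sq_integral_Ioc_le {a b : ℝ} (hab : a ≤ b) {f : ℝ → ℝ} (hf : IntegrableOn f (Ioc a b))
    (hf2 : IntegrableOn (fun x => f x ^ 2) (Ioc a b)) :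
    (∫ x in Ioc a b, f x) ^ 2 ≤ (b - a) * ∫ x in Ioc a b, f x ^ 2 := by
  rcases eq_or_lt_of_le hab with rfl | hlt
  · simp
  set t : ℝ := (∫ x in Ioc a b, f x) / (b - a) with ht
  have h0 : 0 < b - a := by linarith
  have h1 : ∫ x in Ioc a b, (f x - t) ^ 2 =
      (∫ x in Ioc a b, f x ^ 2) - 2 * t * (∫ x in Ioc a b, f x) + (b - a) * t ^ 2 := by
    have : ∀ x, (f x - t) ^ 2 = f x ^ 2 - 2 * t * f x + t ^ 2 := fun x => by ring
    simp only [this]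
    have hi1 : Integrable (fun x => f x ^ 2 - 2 * t * f x) (volume.restrict (Ioc a b)) :=
      hf2.sub (hf.const_mul _)
    rw [integral_add hi1 (integrable_const _), integral_sub hf2 (hf.const_mul _),
      integral_const_mul, setIntegral_const]
    simp [measureReal_def, hab]
  have h2 : 0 ≤ ∫ x in Ioc a b, (f x - t) ^ 2 := integral_nonneg fun x => sq_nonneg _
  have h3 : (b - a) * t = ∫ x in Ioc a b, f x := by
    rw [ht]
    field_simp
  rw [h1] at h2
  have h4 := mul_nonneg h0.le h2
  nlinarith [h4]

/-- Stretching by a factor `lam > 1` moves the mass of `ν` at the end points into the interior. The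
slip on an element is the mean density of `ν` on the stretched element. -/
def slip {L : ℝ} (T : Mesh L) (lam : ℝ) (ν : Measure ℝ) (i : Fin T.N) : ℝ :=
  ν.real (Ioc (lam * T.left i) (lam * T.right i)) / (T.right i - T.left i)

theorem slip_nonneg {L : ℝ} (T : Mesh L) (lam : ℝ) (ν : Measure ℝ) (i : Fin T.N) :
    0 ≤ slip T lam ν i :=
  div_nonneg measureReal_nonneg (by linarith [T.left_lt_right i])

/-- The elastic energy of the interpolant of a stretched primitive, by the Cauchy-Schwarz
inequality on each element. -/
theorem integral_elastic_le {L lam c : ℝ} (hlam : 0 < lam) (T : Mesh L) {f : ℝ → ℝ}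
    (hf : Integrable f) (hf2 : Integrable fun x => f x ^ 2) (ν : Measure ℝ) [IsFiniteMeasure ν] :
    ∫ x, T.stepFun (fun i =>
        T.slope (fun x => primitive c f ν (lam * x)) i - slip T lam ν i) x ^ 2 ≤
      lam * ∫ x, f x ^ 2 := by
  simp only [comp_stepFun (φ := fun x => x ^ 2) _ (by simp), integral_stepFun]
  set J : Fin T.N → Set ℝ := fun i => Ioc (lam * T.left i) (lam * T.right i) with hJ
  have hle : ∀ i, lam * T.left i ≤ lam * T.right i := fun i =>
    mul_le_mul_of_nonneg_left (T.left_lt_right i).le hlam.le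
  calc _ ≤ ∑ i, lam * ∫ x in J i, f x ^ 2 := by
        refine Finset.sum_le_sum fun i _ => ?_
        have hlt := T.left_lt_right i
        have h0 : 0 < T.right i - T.left i := by linarith
        have h1 : T.slope (fun x => primitive c f ν (lam * x)) i - slip T lam ν i =
            (∫ x in J i, f x) / (T.right i - T.left i) := by
          rw [Mesh.slope, slip, ← sub_div, primitive_sub hf ν (hle i)]
          ring
        have h2 := sq_integral_Ioc_le (hle i) hf.integrableOn hf2.integrableOn
        rw [h1, div_pow, ← mul_div_assoc, div_le_iff₀ (by positivity)]
        calc _ ≤ (T.right i - T.left i) *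
              ((lam * T.right i - lam * T.left i) * ∫ x in J i, f x ^ 2) :=
              mul_le_mul_of_nonneg_left h2 h0.le
          _ = _ := by ring
    _ = lam * ∫ x in ⋃ i, J i, f x ^ 2 := by
        rw [← Finset.mul_sum, integral_iUnion_fintype (fun i => measurableSet_Ioc) ?_
          fun i => hf2.integrableOn]
        intro i j hij
        refine Set.disjoint_left.2 fun x hi hj => ?_
        refine Set.disjoint_left.1 (T.pairwise_disjoint hij) (?_ : x / lam ∈ _) ?_
        · exact ⟨by rw [lt_div_iff₀' hlam]; exact hi.1, by rw [div_le_iff₀' hlam]; exact hi.2⟩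
        · exact ⟨by rw [lt_div_iff₀' hlam]; exact hj.1, by rw [div_le_iff₀' hlam]; exact hj.2⟩
    _ ≤ lam * ∫ x, f x ^ 2 := by
        refine mul_le_mul_of_nonneg_left ?_ hlam.le
        exact setIntegral_le_integral hf2 (Eventually.of_forall fun x => sq_nonneg _)

/-- The cohesive energy of the slips, when the degradation is at most `a x` on the element whose
stretched copy contains `x`, for the points `x` of the finite set `F`. -/
theorem integral_slip_le {L lam σ : ℝ} (hlam : 0 < lam) (hσ : 0 ≤ σ) (T : Mesh L) (ν : Measure ℝ)
    [IsFiniteMeasure ν] {k : Fin T.N → ℝ} (hk : ∀ i, k i ≤ 1)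
    (F : Finset ℝ) {a : ℝ → ℝ} (ha0 : ∀ x ∈ F, 0 ≤ a x)
    (ha : ∀ x ∈ F, ∀ i, x ∈ Ioc (lam * T.left i) (lam * T.right i) → k i ≤ a x) :
    ∫ x, T.stepFun (fun i => k i * σ * slip T lam ν i) x ≤
      σ * (ν.real (F : Set ℝ)ᶜ + ∑ x ∈ F, a x * ν.real {x}) := by
  have hdiv : ∀ x i, x / lam ∈ Ioc (T.left i) (T.right i) ↔
      x ∈ Ioc (lam * T.left i) (lam * T.right i) := fun x i => by
    rw [mem_Ioc, mem_Ioc, lt_div_iff₀' hlam, div_le_iff₀' hlam]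
  have hstep : ∀ x, T.stepFun k (x / lam) =
      ∑ i, (Ioc (lam * T.left i) (lam * T.right i)).indicator (fun _ => k i) x := fun x => by
    simp only [stepFun, indicator, hdiv]
  have hind : ∀ i ∈ Finset.univ, Integrable (fun x =>
      (Ioc (lam * T.left i) (lam * T.right i)).indicator (fun _ => k i) x) ν := fun i _ =>
    (integrable_const (k i)).indicator measurableSet_Ioc
  have hint : Integrable (fun x => T.stepFun k (x / lam)) ν := by
    simp only [hstep]
    exact integrable_finsetSum _ hind
  have heq : ∫ x, T.stepFun (fun i => k i * σ * slip T lam ν i) x =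
      σ * ∫ x, T.stepFun k (x / lam) ∂ν := by
    simp only [hstep]
    rw [integral_stepFun, integral_finsetSum _ hind, Finset.mul_sum]
    refine Finset.sum_congr rfl fun i _ => ?_
    have h0 : T.right i - T.left i ≠ 0 := by linarith [T.left_lt_right i]
    rw [integral_indicator measurableSet_Ioc, setIntegral_const, smul_eq_mul, slip]
    field_simp
  rw [heq]
  refine mul_le_mul_of_nonneg_left ?_ hσ
  have hm : MeasurableSet (F : Set ℝ) := F.measurableSet
  rw [← integral_add_compl hm hint, add_comm]
  refine add_le_add ?_ ?_
  · have h1 : ∀ x, T.stepFun k (x / lam) ≤ 1 := fun x => by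
      by_cases hx : x / lam ∈ Ioc (-L) L
      · obtain ⟨i, hi⟩ := T.exists_mem_Ioc hx
        rw [stepFun_of_mem _ hi]
        exact hk i
      · rw [stepFun_of_notMem _ hx]
        exact zero_le_one
    calc _ ≤ ∫ x in (F : Set ℝ)ᶜ, (1 : ℝ) ∂ν :=
          integral_mono hint.integrableOn (integrable_const _) h1
      _ = _ := by simp
  · rw [setIntegral_finset _ hint.integrableOn]
    refine Finset.sum_le_sum fun x hx => ?_
    rw [smul_eq_mul, mul_comm]
    refine mul_le_mul_of_nonneg_right ?_ measureReal_nonneg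
    by_cases hxL : x / lam ∈ Ioc (-L) L
    · obtain ⟨i, hi⟩ := T.exists_mem_Ioc hxL
      rw [stepFun_of_mem _ hi]
      exact ha x hx i ((hdiv x i).1 hi)
    · rw [stepFun_of_notMem _ hxL]
      exact ha0 x hx

/-! ### Optimal damage profiles -/

theorem abs_exp_sub_exp_le {a b K : ℝ} (ha : Real.exp a ≤ K) (hb : Real.exp b ≤ K) :
    |Real.exp a - Real.exp b| ≤ |a - b| * K := by
  wlog hab : a ≤ b generalizing a b
  · rw [abs_sub_comm, abs_sub_comm a]
    exact this hb ha (le_of_not_ge hab)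
  rw [abs_of_nonpos (by simpa using hab), abs_of_nonpos (by simpa using hab)]
  have h1 : Real.exp a = Real.exp b * Real.exp (a - b) := by
    rw [← Real.exp_add]
    ring_nf
  have h2 := Real.add_one_le_exp (a - b)
  have h3 := mul_le_mul_of_nonneg_left h2 (Real.exp_pos b).le
  have h4 := mul_le_mul_of_nonneg_left hb (by linarith : 0 ≤ b - a)
  nlinarith

theorem integrable_exp_neg_abs {ε : ℝ} (hε : 0 < ε) (y : ℝ) :
    Integrable fun x : ℝ => Real.exp (-2 * |x - y| / ε) := by
  have h0 : Integrable fun x : ℝ => Real.exp (-2 * |x| / ε) := by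
    have h1 : IntegrableOn (fun x : ℝ => Real.exp (-2 * |x| / ε)) (Ioi 0) := by
      refine (integrableOn_exp_mul_Ioi (a := -2 / ε) (div_neg_of_neg_of_pos (by norm_num) hε)
        0).congr_fun (fun x hx => ?_) measurableSet_Ioi
      simp only [abs_of_pos (mem_Ioi.1 hx)]
      ring_nf
    rw [← integrableOn_univ, ← Iic_union_Ioi (a := (0 : ℝ))]
    refine IntegrableOn.union ?_ h1
    have h2 := (integrableOn_Ici_iff_integrableOn_Ioi (f := fun x : ℝ => Real.exp (-2 * |x| / ε))
      (μ := volume) (b := 0)).2 h1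
    have h3 := h2.comp_neg
    simpa using h3
  exact h0.comp_sub_right y

theorem integral_exp_neg_abs {ε : ℝ} (hε : 0 < ε) (y : ℝ) :
    ∫ x : ℝ, Real.exp (-2 * |x - y| / ε) = ε := by
  rw [integral_sub_right_eq_self (fun x : ℝ => Real.exp (-2 * |x| / ε)),
    integral_comp_abs (f := fun x : ℝ => Real.exp (-2 * x / ε))]
  have : ∀ x : ℝ, Real.exp (-2 * x / ε) = Real.exp (-2 / ε * x) := fun x => by ring_nf
  simp only [this]
  rw [integral_exp_mul_Ioi (div_neg_of_neg_of_pos (by norm_num) hε)]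
  field_simp
  simp

/-- The optimal profile `exp (-|x - y| / ε)`, shifted so that it vanishes at distance `r`. -/
def bump (ε r y x : ℝ) : ℝ := max (Real.exp (-|x - y| / ε) - Real.exp (-r / ε)) 0

theorem bump_nonneg (ε r y x : ℝ) : 0 ≤ bump ε r y x := le_max_right _ _

theorem bump_le_exp (ε r y x : ℝ) : bump ε r y x ≤ Real.exp (-|x - y| / ε) :=
  max_le (by linarith [Real.exp_pos (-r / ε)]) (Real.exp_pos _).le

theorem bump_le_one {ε : ℝ} (hε : 0 < ε) (r y x : ℝ) : bump ε r y x ≤ 1 :=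
  (bump_le_exp ε r y x).trans (Real.exp_le_one_iff.2
    (div_nonpos_of_nonpos_of_nonneg (by simp) hε.le))

theorem bump_eq_zero {ε r y x : ℝ} (hε : 0 < ε) (h : r ≤ |x - y|) : bump ε r y x = 0 := by
  refine max_eq_right (sub_nonpos.2 (Real.exp_le_exp.2 ?_))
  gcongr

theorem abs_bump_sub_le {ε r y x x' K : ℝ} (hε : 0 < ε) (hx : Real.exp (-|x - y| / ε) ≤ K)
    (hx' : Real.exp (-|x' - y| / ε) ≤ K) :
    |bump ε r y x - bump ε r y x'| ≤ |x - x'| / ε * K := by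
  have hK : 0 ≤ K := (Real.exp_pos _).le.trans hx
  refine (abs_max_sub_max_le_abs _ _ _).trans ?_
  rw [sub_sub_sub_cancel_right]
  refine (abs_exp_sub_exp_le hx hx').trans (mul_le_mul_of_nonneg_right ?_ hK)
  rw [← sub_div, abs_div, abs_of_pos hε]
  refine div_le_div_of_nonneg_right ?_ hε.le
  have h1 : -|x - y| - -|x' - y| = |x' - y| - |x - y| := by ring
  rw [h1, abs_sub_comm x x']
  refine (abs_abs_sub_abs_le_abs_sub _ _).trans_eq ?_
  congr 1
  ring

/-- The damage variable of a recovery sequence before interpolation: the maximum over the finite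
set `F` of the optimal profiles of heights `β y`, centred at the points `y / lam`. -/
def damage (F : Finset ℝ) (hF : F.Nonempty) (β : ℝ → ℝ) (lam ε r x : ℝ) : ℝ :=
  F.sup' hF fun y => β y * bump ε r (y / lam) x

theorem exists_abs_sup'_sub_le {ι : Type*} (F : Finset ι) (hF : F.Nonempty) (a b : ι → ℝ) :
    ∃ j ∈ F, |F.sup' hF a - F.sup' hF b| ≤ |a j - b j| := by
  wlog h : F.sup' hF b ≤ F.sup' hF a generalizing a b
  · obtain ⟨j, hj, hle⟩ := this b a (le_of_not_ge h)
    exact ⟨j, hj, by rwa [abs_sub_comm, abs_sub_comm (a j)]⟩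
  obtain ⟨j, hj, hja⟩ := F.exists_mem_eq_sup' hF a
  refine ⟨j, hj, ?_⟩
  have h1 : b j ≤ F.sup' hF b := F.le_sup' b hj
  rw [abs_of_nonneg (by linarith), hja]
  exact (by linarith : a j - F.sup' hF b ≤ a j - b j).trans (le_abs_self _)

section damage

variable {F : Finset ℝ} {hF : F.Nonempty} {β : ℝ → ℝ} {lam ε r : ℝ}

theorem le_damage {y : ℝ} (hy : y ∈ F) (x : ℝ) :
    β y * bump ε r (y / lam) x ≤ damage F hF β lam ε r x :=
  F.le_sup' (fun y => β y * bump ε r (y / lam) x) hy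

theorem damage_mem (hβ : ∀ y, β y ∈ Icc (0 : ℝ) 1) (hε : 0 < ε) (x : ℝ) :
    damage F hF β lam ε r x ∈ Icc (0 : ℝ) 1 := by
  refine ⟨?_, Finset.sup'_le _ _ fun y _ => mul_le_one₀ (hβ y).2 (bump_nonneg _ _ _ _)
    (bump_le_one hε _ _ _)⟩
  obtain ⟨y, hy⟩ := hF
  exact (mul_nonneg (hβ y).1 (bump_nonneg _ _ _ _)).trans (le_damage hy x)

theorem damage_eq_zero (hε : 0 < ε) {x : ℝ} (h : ∀ y ∈ F, β y = 0 ∨ r ≤ |x - y / lam|) :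
    damage F hF β lam ε r x = 0 := by
  have : ∀ y ∈ F, β y * bump ε r (y / lam) x = 0 := fun y hy => by
    rcases h y hy with h | h
    · rw [h, zero_mul]
    · rw [bump_eq_zero hε h, mul_zero]
  rw [damage, Finset.sup'_congr hF rfl this, Finset.sup'_const]

/-- The energy of the damage variable is at most the sum of the energies of the profiles, up to the
oscillation of the exponential on an element. -/
theorem integral_damage_le {L : ℝ} (T : Mesh L) (hβ : ∀ y, β y ∈ Icc (0 : ℝ) 1) (hε : 0 < ε) :
    ∫ x in Ioc (-L) L, (1 / ε * T.interp (damage F hF β lam ε r) x ^ 2 +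
      ε * T.stepFun (T.slope (T.interp (damage F hF β lam ε r))) x ^ 2) ≤
      2 * Real.exp (2 * T.size / ε) * ∑ y ∈ F, β y ^ 2 := by
  set q := damage F hF β lam ε r with hq
  -- `E y x` bounds the profile centred at `y / lam` on the whole element containing `x`
  set E : ℝ → ℝ → ℝ := fun y x => Real.exp (T.size / ε) * Real.exp (-|x - y / lam| / ε) with hE
  have hE2 : ∀ y x, E y x ^ 2 = Real.exp (2 * T.size / ε) * Real.exp (-2 * |x - y / lam| / ε) := by
    intro y x
    simp only [hE, mul_pow, ← Real.exp_nat_mul]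
    congr 2 <;> push_cast <;> ring
  have hpt : ∀ x ∈ Ioc (-L) L,
      1 / ε * T.interp q x ^ 2 + ε * T.stepFun (T.slope (T.interp q)) x ^ 2 ≤
      ∑ y ∈ F, 2 / ε * Real.exp (2 * T.size / ε) * β y ^ 2 * Real.exp (-2 * |x - y / lam| / ε) := by
    intro x hx
    obtain ⟨i, hi⟩ := T.exists_mem_Ioc hx
    have hi' := Ioc_subset_Icc_self hi
    have hlt := T.left_lt_right i
    have hsz := T.length_le_size i
    have hEb : ∀ y, ∀ z ∈ Icc (T.left i) (T.right i), Real.exp (-|z - y / lam| / ε) ≤ E y x := by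
      intro y z hz
      simp only [hE]
      rw [← Real.exp_add, ← add_div]
      refine Real.exp_le_exp.2 ?_
      gcongr
      have h1 : |x - y / lam| ≤ |x - z| + |z - y / lam| := abs_sub_le _ _ _
      have h2 : |x - z| ≤ T.size := abs_le.2 ⟨by linarith [hz.2, hi'.1], by linarith [hz.1, hi'.2]⟩
      linarith
    have hsum : ∀ j ∈ F, (β j * E j x) ^ 2 ≤ ∑ y ∈ F, (β y * E y x) ^ 2 := fun j hj =>
      Finset.single_le_sum (f := fun y => (β y * E y x) ^ 2) (fun y _ => sq_nonneg _) hj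
    have h1 : T.interp q x ^ 2 ≤ ∑ y ∈ F, (β y * E y x) ^ 2 := by
      set A : ℝ := F.sup' hF fun y => β y * E y x with hA
      have hqA : ∀ z ∈ Icc (T.left i) (T.right i), q z ∈ Icc 0 A := fun z hz =>
        ⟨(damage_mem hβ hε z).1, Finset.sup'_mono_fun fun y _ => mul_le_mul_of_nonneg_left
          ((bump_le_exp _ _ _ _).trans (hEb y z hz)) (hβ y).1⟩
      have h2 := T.interp_mem q hi' (hqA _ (left_mem_Icc.2 hlt.le)) (hqA _ (right_mem_Icc.2 hlt.le))
      obtain ⟨j, hj, hjA⟩ := F.exists_mem_eq_sup' hF fun y => β y * E y x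
      refine (pow_le_pow_left₀ h2.1 h2.2 2).trans ?_
      rw [hA, hjA]
      exact hsum j hj
    have h2 : (ε * T.slope q i) ^ 2 ≤ ∑ y ∈ F, (β y * E y x) ^ 2 := by
      obtain ⟨j, hj, hjle⟩ := exists_abs_sup'_sub_le F hF
        (fun y => β y * bump ε r (y / lam) (T.right i))
        (fun y => β y * bump ε r (y / lam) (T.left i))
      refine le_trans ?_ (hsum j hj)
      refine sq_le_sq.2 ?_
      have h3 : |q (T.right i) - q (T.left i)| ≤
          β j * ((T.right i - T.left i) / ε * E j x) := by
        refine hjle.trans ?_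
        rw [← mul_sub, abs_mul, abs_of_nonneg (hβ j).1]
        refine mul_le_mul_of_nonneg_left ?_ (hβ j).1
        have := abs_bump_sub_le (r := r) hε (hEb j _ (right_mem_Icc.2 hlt.le))
          (hEb j _ (left_mem_Icc.2 hlt.le))
        rwa [abs_of_pos (by linarith : 0 < T.right i - T.left i)] at this
      have h4 : 0 < T.right i - T.left i := by linarith
      have h5 : 0 ≤ E j x := by positivity
      rw [abs_of_nonneg (mul_nonneg (hβ j).1 h5), Mesh.slope, abs_mul, abs_div, abs_of_pos hε,
        abs_of_pos h4, mul_div_assoc', div_le_iff₀ h4]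
      calc ε * |q (T.right i) - q (T.left i)| ≤
          ε * (β j * ((T.right i - T.left i) / ε * E j x)) := mul_le_mul_of_nonneg_left h3 hε.le
        _ = _ := by field_simp
    have h3 : ∑ y ∈ F, 2 / ε * Real.exp (2 * T.size / ε) * β y ^ 2 *
        Real.exp (-2 * |x - y / lam| / ε) = 2 / ε * ∑ y ∈ F, (β y * E y x) ^ 2 := by
      rw [Finset.mul_sum]
      refine Finset.sum_congr rfl fun y _ => ?_
      rw [mul_pow, hE2]
      ring
    rw [h3, stepFun_of_mem _ hi, slope_interp]
    have h4 : 1 / ε * T.interp q x ^ 2 + ε * T.slope q i ^ 2 =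
        1 / ε * (T.interp q x ^ 2 + (ε * T.slope q i) ^ 2) := by
      field_simp
    rw [h4]
    calc _ ≤ 1 / ε * (2 * ∑ y ∈ F, (β y * E y x) ^ 2) :=
          mul_le_mul_of_nonneg_left (by linarith) (by positivity)
      _ = _ := by ring
  have hi : ∀ y ∈ F, Integrable (fun x => 2 / ε * Real.exp (2 * T.size / ε) * β y ^ 2 *
      Real.exp (-2 * |x - y / lam| / ε)) := fun y _ => (integrable_exp_neg_abs hε _).const_mul _
  calc _ ≤ ∫ x in Ioc (-L) L, ∑ y ∈ F, 2 / ε * Real.exp (2 * T.size / ε) * β y ^ 2 *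
        Real.exp (-2 * |x - y / lam| / ε) := by
        refine integral_mono_of_nonneg (Eventually.of_forall fun x => ?_)
          (integrable_finsetSum _ hi).integrableOn ?_
        · exact add_nonneg (mul_nonneg (by positivity) (sq_nonneg _))
            (mul_nonneg hε.le (sq_nonneg _))
        · filter_upwards [ae_restrict_mem measurableSet_Ioc] with x hx using hpt x hx
    _ ≤ ∫ x, ∑ y ∈ F, 2 / ε * Real.exp (2 * T.size / ε) * β y ^ 2 *
        Real.exp (-2 * |x - y / lam| / ε) := by
        refine setIntegral_le_integral (integrable_finsetSum _ hi)
          (Eventually.of_forall fun x => Finset.sum_nonneg fun y _ => by positivity)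
    _ = _ := by
        rw [integral_finsetSum _ hi, Finset.mul_sum]
        refine Finset.sum_congr rfl fun y _ => ?_
        rw [integral_const_mul, integral_exp_neg_abs hε]
        field_simp

end damage

/-- The energy of the competitor built from a splitting, a stretching factor `lam > 1` and optimal
damage profiles of heights `β` at the points of a finite set. -/
theorem fullEnergy_recovery_le {L E₀ σ G lam ε r c : ℝ} (hL : 0 < L) (hE₀ : 0 < E₀) (hσ : 0 < σ)
    (hG : 0 < G) (hlam : 0 < lam) (hε : 0 < ε) (T : Mesh L) {f : ℝ → ℝ}
    (hf : Integrable f) (hf2 : Integrable fun x => f x ^ 2) (ν : Measure ℝ) [IsFiniteMeasure ν]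
    {F : Finset ℝ} (hF : F.Nonempty) {β : ℝ → ℝ} (hβ : ∀ y, β y ∈ Icc (0 : ℝ) 1) :
    fullEnergy E₀ σ G T ε (T.interp fun x => primitive c f ν (lam * x)) (slip T lam ν)
        (T.interp (damage F hF β lam ε r)) ≤
      E₀ / 2 * (lam * ∫ x, f x ^ 2) +
      σ * (ν.real (F : Set ℝ)ᶜ + ∑ y ∈ F,
        (1 - (Real.exp (-T.size / ε) - Real.exp (-r / ε)) * β y) ^ 2 * ν.real {y}) +
      G / 2 * (2 * Real.exp (2 * T.size / ε) * ∑ y ∈ F, β y ^ 2) := by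
  rw [fullEnergy_eq hL E₀ σ G ε (isP1_interp _) (isP1_interp _)]
  refine add_le_add (add_le_add ?_ ?_) ?_
  · simp only [slope_interp]
    exact mul_le_mul_of_nonneg_left (integral_elastic_le hlam T hf hf2 ν) (by positivity)
  · have hm : ∀ i, T.mean (T.interp (damage F hF β lam ε r)) i ∈ Icc (0 : ℝ) 1 := fun i =>
      (isP1_interp _).mean_mem hL i fun x hx =>
        interp_mem _ hx (damage_mem hβ hε _) (damage_mem hβ hε _)
    refine integral_slip_le hlam hσ.le T ν (fun i => ?_) F
      (a := fun y => (1 - (Real.exp (-T.size / ε) - Real.exp (-r / ε)) * β y) ^ 2)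
      (fun x _ => sq_nonneg _) fun y hy i hyi => ?_
    · rw [degr]
      nlinarith [(hm i).1, (hm i).2]
    · have hlt := T.left_lt_right i
      have hy1 : T.left i < y / lam := by rw [lt_div_iff₀' hlam]; exact hyi.1
      have hy2 : y / lam ≤ T.right i := by rw [div_le_iff₀' hlam]; exact hyi.2
      have hq : ∀ z ∈ Icc (T.left i) (T.right i), damage F hF β lam ε r z ∈
          Icc ((Real.exp (-T.size / ε) - Real.exp (-r / ε)) * β y) 1 := by
        intro z hz
        refine ⟨?_, (damage_mem hβ hε z).2⟩
        refine le_trans ?_ (le_damage hy z)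
        rw [mul_comm]
        refine mul_le_mul_of_nonneg_left (le_trans ?_ (le_max_left _ _)) (hβ y).1
        have h1 : |z - y / lam| ≤ T.size := abs_le.2
          ⟨by linarith [hz.1, T.length_le_size i], by linarith [hz.2, T.length_le_size i]⟩
        gcongr
      have h2 := (isP1_interp (T := T) (damage F hF β lam ε r)).mean_mem hL i fun x hx =>
        interp_mem _ hx (hq _ (left_mem_Icc.2 hlt.le)) (hq _ (right_mem_Icc.2 hlt.le))
      rw [degr]
      refine pow_le_pow_left₀ ?_ ?_ 2 <;> linarith [h2.1, h2.2]
  · exact mul_le_mul_of_nonneg_left (integral_damage_le T hβ hε) (by positivity)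

/-! ### Convergence of the recovery sequences -/

theorem Mesh.measurable_interp {L : ℝ} (T : Mesh L) {q : ℝ → ℝ} (hq : Measurable q) :
    Measurable (T.interp q) :=
  Measurable.ite measurableSet_Ioc
    ((measurable_stepFun _).add ((measurable_stepFun _).mul measurable_id)) hq

theorem measurable_primitive {c : ℝ} {f : ℝ → ℝ} (hf : Integrable f) (ν : Measure ℝ)
    [IsFiniteMeasure ν] : Measurable (primitive c f ν) := by
  obtain ⟨p, q, hp, hq, h⟩ := (boundedVariationOn_primitive c hf
    ν).locallyBoundedVariationOn.exists_monotoneOn_sub_monotoneOn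
  rw [h]
  exact (monotoneOn_univ.1 hp).measurable.sub (monotoneOn_univ.1 hq).measurable

/-- Nodal interpolants converge at the continuity points of the interpolated function. -/
theorem tendsto_interp {L : ℝ} (hL : 0 < L) {T : ℕ → Mesh L}
    (hT : Tendsto (fun n => (T n).size) atTop (𝓝 0)) {q : ℝ → ℝ} {x : ℝ} (hx : x ∈ Icc (-L) L)
    (hq : ContinuousAt q x) : Tendsto (fun n => (T n).interp q x) atTop (𝓝 (q x)) := by
  rw [Metric.tendsto_atTop']
  intro e he
  obtain ⟨ρ, hρ, h⟩ := Metric.continuousAt_iff.1 hq (e / 2) (by positivity)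
  obtain ⟨N, hN⟩ := eventually_atTop.1 (hT.eventually_lt_const hρ)
  refine ⟨N, fun n hn => ?_⟩
  obtain ⟨i, hi⟩ := (T n).exists_mem_Icc hL hx
  have hlt := (T n).left_lt_right i
  have hsz := (T n).length_le_size i
  have hsz' := hN n hn.le
  have hz : ∀ z ∈ Icc ((T n).left i) ((T n).right i), q z ∈ Icc (q x - e / 2) (q x + e / 2) := by
    intro z hz
    have h1 : dist z x < ρ := by
      rw [Real.dist_eq, abs_lt]
      constructor <;> linarith [hz.1, hz.2, hi.1, hi.2]
    have h2 := abs_lt.1 ((Real.dist_eq _ _).symm.trans_lt (h h1))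
    constructor <;> linarith [h2.1, h2.2]
  have h3 := interp_mem q hi (hz _ (left_mem_Icc.2 hlt.le)) (hz _ (right_mem_Icc.2 hlt.le))
  rw [Real.dist_eq, abs_lt]
  constructor <;> linarith [h3.1, h3.2]

/-- Dominated convergence for the interpolants of bounded functions. -/
theorem tendsto_integral_interp {L M : ℝ} (hL : 0 < L) {T : ℕ → Mesh L}
    (hT : Tendsto (fun n => (T n).size) atTop (𝓝 0)) {q : ℝ → ℝ} (hq : Measurable q)
    (hM : ∀ x, |q x| ≤ M) (hc : {x | ¬ ContinuousAt q x}.Countable) :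
    Tendsto (fun n => ∫ x in Icc (-L) L, |(T n).interp q x - q x|) atTop (𝓝 0) := by
  have h0 : Tendsto (fun n => ∫ x in Icc (-L) L, |(T n).interp q x - q x|) atTop
      (𝓝 (∫ x in Icc (-L) L, (0 : ℝ))) := by
    refine tendsto_integral_of_dominated_convergence (fun _ => 2 * M) (fun n => ?_)
      (integrable_const _) (fun n => ?_) ?_
    · exact (((T n).measurable_interp hq).sub hq).abs.aestronglyMeasurable
    · filter_upwards [ae_restrict_mem measurableSet_Icc] with x hx
      have h1 := interp_mem_of_forall (T := T n) hL q (fun x => abs_le.1 (hM x)) hx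
      have h2 := abs_le.1 (hM x)
      rw [Real.norm_eq_abs, abs_abs, abs_le]
      constructor <;> linarith [h1.1, h1.2]
    · have := measure_eq_zero_iff_ae_notMem.1 (hc.measure_zero volume)
      rw [ae_restrict_iff' measurableSet_Icc]
      filter_upwards [this] with x hx hmem
      have h1 := ((tendsto_interp hL hT hmem (not_not.1 hx)).sub_const (q x)).abs
      simpa using h1
  simpa using h0

/-- Stretching is continuous in `L¹`, by dominated convergence. -/
theorem tendsto_integral_stretch {L M : ℝ} {q : ℝ → ℝ} (hq : Measurable q)
    (hM : ∀ x, |q x| ≤ M) (hc : {x | ¬ ContinuousAt q x}.Countable) :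
    Tendsto (fun lam : ℝ => ∫ x in Icc (-L) L, |q (lam * x) - q x|) (𝓝[>] 1) (𝓝 0) := by
  have h0 : Tendsto (fun lam : ℝ => ∫ x in Icc (-L) L, |q (lam * x) - q x|) (𝓝[>] 1)
      (𝓝 (∫ x in Icc (-L) L, (0 : ℝ))) := by
    refine tendsto_integral_filter_of_dominated_convergence (fun _ => 2 * M)
      (Eventually.of_forall fun lam => ?_) (Eventually.of_forall fun lam =>
        Eventually.of_forall fun x => ?_) (integrable_const _) ?_
    · exact ((hq.comp (measurable_const_mul lam)).sub hq).abs.aestronglyMeasurable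
    · have h1 := abs_le.1 (hM (lam * x))
      have h2 := abs_le.1 (hM x)
      rw [Real.norm_eq_abs, abs_abs, abs_le]
      constructor <;> linarith [h1.1, h1.2]
    · have := measure_eq_zero_iff_ae_notMem.1 (hc.measure_zero volume)
      filter_upwards [ae_restrict_of_ae this] with x hx
      have h1 : Tendsto (fun lam : ℝ => lam * x) (𝓝[>] 1) (𝓝 x) := by
        have h2 : Tendsto (fun lam : ℝ => lam * x) (𝓝 1) (𝓝 (1 * x)) :=
          tendsto_id.mul_const x
        rw [one_mul] at h2
        exact h2.mono_left nhdsWithin_le_nhds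
      have h3 : ContinuousAt q x := not_not.1 hx
      simpa using ((h3.tendsto.comp h1).sub_const (q x)).abs
  simpa using h0

/-- The height `σ s / (G + σ s)` of the damage profile at a crack of opening `s`. -/
def optDamage (σ G s : ℝ) : ℝ := σ * s / (G + σ * s)

theorem optDamage_mem {σ G s : ℝ} (hσ : 0 < σ) (hG : 0 < G) (hs : 0 ≤ s) :
    optDamage σ G s ∈ Icc (0 : ℝ) 1 := by
  have h0 : 0 ≤ σ * s := by positivity
  exact ⟨div_nonneg h0 (by positivity), (div_le_one (by positivity)).2 (by linarith)⟩

theorem optDamage_energy {σ G s : ℝ} (hσ : 0 < σ) (hG : 0 < G) (hs : 0 ≤ s) :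
    σ * ((1 - optDamage σ G s) ^ 2 * s) + G * optDamage σ G s ^ 2 = G * σ * s / (G + σ * s) := by
  have h0 : G + σ * s ≠ 0 := by positivity
  rw [optDamage]
  field_simp
  ring

/-- Finitely many atoms carry the cohesive energy up to a small error. -/
theorem exists_finset_cohesiveEnergy_lt {σ G t : ℝ} (hσ : 0 < σ) (hG : 0 < G) (ν : Measure ℝ)
    [IsFiniteMeasure ν] (h : cohesiveEnergy σ G ν < ENNReal.ofReal t) :
    ∃ F : Finset ℝ, F.Nonempty ∧
      σ * ν.real (F : Set ℝ)ᶜ + ∑ y ∈ F, G * σ * ν.real {y} / (G + σ * ν.real {y}) < t := by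
  rw [cohesiveEnergy_eq hσ hG] at h
  set D : Set ℝ := {x | ν {x} = 0} with hD
  have hcount := countable_setOf_singleton_ne_zero ν
  set P : ℝ≥0∞ := ∑' x, phi σ G (ν.real {x}) with hP
  have hsum : ∑' x, ν {x} ≠ ⊤ :=
    ne_top_of_le_ne_top (measure_ne_top ν univ) (tsum_meas_le_meas_iUnion_of_disjoint ν
      (fun x => measurableSet_singleton x) (fun x y hxy => by simpa using hxy) |>.trans
      (measure_mono (subset_univ _)))
  have htail := ENNReal.tendsto_tsum_compl_atTop_zero hsum
  have hlim : Tendsto (fun F : Finset ℝ =>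
      ENNReal.ofReal σ * (ν D + ∑' y : {y // y ∉ F}, ν {(y : ℝ)}) + P) atTop
      (𝓝 (ENNReal.ofReal σ * ν D + P)) := by
    have := ENNReal.Tendsto.const_mul (a := ENNReal.ofReal σ) (htail.const_add (ν D))
      (Or.inr ENNReal.ofReal_ne_top)
    rw [add_zero] at this
    exact this.add_const P
  -- requiring `0 ∈ F` only serves to make `F` nonempty
  obtain ⟨F, hF, hF0⟩ := ((hlim.eventually_lt_const h).and (eventually_ge_atTop {0})).exists
  refine ⟨F, ⟨0, hF0 (Finset.mem_singleton_self 0)⟩, ?_⟩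
  have hFc : ν (F : Set ℝ)ᶜ ≤ ν D + ∑' y : {y // y ∉ F}, ν {(y : ℝ)} := by
    have h1 : (F : Set ℝ)ᶜ ⊆ D ∪ ⋃ y : {y : ℝ // y ∈ Dᶜ}, ({(y : ℝ)} \ (F : Set ℝ)) := by
      intro x hx
      by_cases hxD : x ∈ D
      · exact Or.inl hxD
      · exact Or.inr (mem_iUnion.2 ⟨⟨x, hxD⟩, rfl, hx⟩)
    have : Countable {y : ℝ // y ∈ Dᶜ} := hcount.to_subtype
    refine (measure_mono h1).trans ((measure_union_le _ _).trans ?_)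
    gcongr
    refine (measure_iUnion_le _).trans ?_
    have h2 : ∀ y : ℝ, ν ({y} \ (F : Set ℝ)) =
        ({y | y ∉ F} : Set ℝ).indicator (fun y => ν {y}) y := by
      intro y
      by_cases hy : y ∈ F
      · have h3 : ({y} : Set ℝ) \ (F : Set ℝ) = ∅ := by
          ext z
          simp only [Set.mem_sdiff, mem_singleton_iff, mem_empty_iff_false, iff_false, not_and,
            not_not]
          rintro rfl
          exact hy
        rw [h3, measure_empty, indicator_of_notMem (by simpa using hy)]
      · rw [indicator_of_mem (by exact hy), sdiff_eq_left.2 (by simpa using hy)]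
    calc ∑' y : {y : ℝ // y ∈ Dᶜ}, ν ({(y : ℝ)} \ (F : Set ℝ))
        ≤ ∑' y : ℝ, ν ({y} \ (F : Set ℝ)) :=
          ENNReal.tsum_comp_le_tsum_of_injective Subtype.val_injective _
      _ = ∑' y : {y // y ∉ F}, ν {(y : ℝ)} := by
          simp only [h2]
          exact (tsum_subtype {y | y ∉ F} fun y => ν {y}).symm
  have hPF : ∑ y ∈ F, phi σ G (ν.real {y}) ≤ P := ENNReal.sum_le_tsum F
  have h3 : ENNReal.ofReal (σ * ν.real (F : Set ℝ)ᶜ +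
      ∑ y ∈ F, G * σ * ν.real {y} / (G + σ * ν.real {y})) < ENNReal.ofReal t := by
    have hnn : ∀ y ∈ F, 0 ≤ G * σ * ν.real {y} / (G + σ * ν.real {y}) := fun y _ => by positivity
    rw [ENNReal.ofReal_add (by positivity) (Finset.sum_nonneg hnn),
      ENNReal.ofReal_mul hσ.le, ofReal_measureReal, ENNReal.ofReal_sum_of_nonneg hnn]
    refine lt_of_le_of_lt ?_ hF
    refine add_le_add (by gcongr) (le_trans (le_of_eq ?_) hPF)
    exact Finset.sum_congr rfl fun y _ => (if_pos measureReal_nonneg).symm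
  exact (ENNReal.ofReal_lt_ofReal_iff'.1 h3).1

/-! ### The limsup inequality -/

/-- A recovery sequence exists as soon as approximate recovery is possible with every tolerance. -/
theorem exists_recovery_of_approx {X : Type*} [PseudoMetricSpace X] {F : ℕ → X → ℝ≥0∞}
    {x : X} {F₀ : ℝ≥0∞}
    (H : ∀ c > F₀, ∀ ρ : ℝ, 0 < ρ → ∀ᶠ n in atTop, ∃ y, dist y x < ρ ∧ F n y ≤ c) :
    ∃ y : ℕ → X, Tendsto y atTop (𝓝 x) ∧ limsup (fun n => F n (y n)) atTop ≤ F₀ := by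
  rcases eq_or_ne F₀ ⊤ with rfl | hF₀
  · exact ⟨fun _ => x, tendsto_const_nhds, le_top⟩
  -- near-minimizers of the larger of the distance to `x` and the excess energy
  set e : ℕ → X → ℝ≥0∞ := fun n y => max (edist y x) (F n y - F₀) with he
  have hm : Tendsto (fun n => ⨅ y, e n y) atTop (𝓝 0) := by
    rw [ENNReal.tendsto_nhds_zero]
    intro t ht
    rcases eq_or_ne t ⊤ with rfl | htop
    · exact Eventually.of_forall fun _ => le_top
    filter_upwards [H (F₀ + t) (ENNReal.lt_add_right hF₀ ht.ne') t.toReal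
      (ENNReal.toReal_pos ht.ne' htop)] with n ⟨y, hy, hFy⟩
    refine iInf_le_of_le y (max_le ?_ (tsub_le_iff_left.2 hFy))
    rw [edist_dist]
    exact ENNReal.ofReal_le_of_le_toReal hy.le
  have hex : ∀ n : ℕ, ∃ y, e n y ≤ (⨅ y, e n y) + ((n : ℝ≥0∞) + 1)⁻¹ := by
    intro n
    rcases eq_or_ne (⨅ y, e n y) ⊤ with h | h
    · exact ⟨x, by simp [h]⟩
    · have h1 : (⨅ y, e n y) < (⨅ y, e n y) + ((n : ℝ≥0∞) + 1)⁻¹ :=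
        ENNReal.lt_add_right h (by simp)
      obtain ⟨y, hy⟩ := iInf_lt_iff.1 h1
      exact ⟨y, hy.le⟩
  choose y hy using hex
  have hlim : Tendsto (fun n => e n (y n)) atTop (𝓝 0) := by
    have h1 : Tendsto (fun n : ℕ => ((n : ℝ≥0∞) + 1)⁻¹) atTop (𝓝 0) := by
      have := (ENNReal.tendsto_inv_nat_nhds_zero).comp (tendsto_add_atTop_nat 1)
      simpa [Function.comp_def] using this
    have h2 := hm.add h1
    rw [add_zero] at h2
    exact tendsto_of_tendsto_of_tendsto_of_le_of_le tendsto_const_nhds h2 (fun _ => zero_le) hy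
  refine ⟨y, ?_, ?_⟩
  · rw [tendsto_iff_edist_tendsto_0]
    exact tendsto_of_tendsto_of_tendsto_of_le_of_le tendsto_const_nhds hlim (fun _ => zero_le)
      fun n => le_max_left _ _
  · have h1 : ∀ n, F n (y n) ≤ F₀ + e n (y n) := fun n => tsub_le_iff_left.1 (le_max_right _ _)
    have h2 : Tendsto (fun n => F₀ + e n (y n)) atTop (𝓝 F₀) := by
      simpa using hlim.const_add F₀
    exact (limsup_le_limsup (Eventually.of_forall h1)).trans_eq h2.limsup_eq

theorem dist_toL1 {L : ℝ} {v w : ℝ → ℝ} (hv : Integrable v (volume.restrict (Icc (-L) L)))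
    {u : L1 L} (hu : (u : ℝ → ℝ) =ᵐ[volume.restrict (Icc (-L) L)] w) :
    dist (hv.toL1 v) u = ∫ x in Icc (-L) L, |v x - w x| := by
  rw [L1.dist_eq_integral_dist]
  refine integral_congr_ae ?_
  filter_upwards [hv.coeFn_toL1, hu] with x h1 h2
  rw [h1, h2, Real.dist_eq]

theorem discreteFunctional_toL1_le {L E₀ σ G ε : ℝ} {g v d : ℝ → ℝ} {T : Mesh L}
    (h : Admissible g T v d) (hv : Integrable v (volume.restrict (Icc (-L) L)))
    (hd : Integrable d (volume.restrict (Icc (-L) L))) {η : Fin T.N → ℝ} (hη : ∀ i, 0 ≤ η i) :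
    discreteFunctional E₀ σ G g T ε (hv.toL1 v, hd.toL1 d) ≤
      ENNReal.ofReal (fullEnergy E₀ σ G T ε v η d) := by
  rw [discreteFunctional]
  refine iInf_le_of_le v (iInf_le_of_le d (iInf_le_of_le h (iInf_le_of_le hv.coeFn_toL1
    (iInf_le_of_le hd.coeFn_toL1 ?_))))
  exact iInf_le_of_le η (iInf_le_of_le hη le_rfl)

theorem admissible_interp {L lam ε : ℝ} (hL : 0 < L) (hlam : 1 < lam) (hε : 0 < ε) (T : Mesh L)
    {g f : ℝ → ℝ} {ν : Measure ℝ} (hs : IsSplitting L (g (-L)) (g L) f ν)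
    (hb : ∀ x, |primitive (g (-L)) f ν x| ≤ supNorm L g) {F : Finset ℝ} (hF : F.Nonempty)
    {β : ℝ → ℝ} (hβ : ∀ y, β y ∈ Icc (0 : ℝ) 1) (hβ0 : ∀ y ∉ Icc (-L) L, β y = 0) :
    Admissible g T (T.interp fun x => primitive (g (-L)) f ν (lam * x))
      (T.interp (damage F hF β lam ε (L - L / lam))) := by
  have hlam0 : 0 < lam := by linarith
  have hquot : ∀ y ∈ Icc (-L) L, y / lam ∈ Icc (-(L / lam)) (L / lam) := fun y hy => by
    rw [← neg_div]
    exact ⟨div_le_div_of_nonneg_right hy.1 hlam0.le, div_le_div_of_nonneg_right hy.2 hlam0.le⟩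
  refine ⟨isP1_interp _, isP1_interp _, fun x hx => ?_, fun x hx => ?_, ?_, ?_, ?_, ?_⟩
  · exact abs_le.2 (interp_mem_of_forall hL _ (fun x => abs_le.1 (hb (lam * x))) hx)
  · exact interp_mem_of_forall hL _ (damage_mem hβ hε) hx
  · rw [interp_neg]
    exact hs.primitive_of_lt (by nlinarith)
  · rw [interp_self]
    exact hs.primitive_of_ge (by nlinarith)
  · rw [interp_neg]
    refine damage_eq_zero hε fun y _ => ?_
    by_cases hy : y ∈ Icc (-L) L
    · right
      rw [abs_sub_comm]
      exact le_trans (by linarith [(hquot y hy).1]) (le_abs_self _)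
    · exact Or.inl (hβ0 y hy)
  · rw [interp_self]
    refine damage_eq_zero hε fun y _ => ?_
    by_cases hy : y ∈ Icc (-L) L
    · exact Or.inr (le_trans (by linarith [(hquot y hy).2]) (le_abs_self _))
    · exact Or.inl (hβ0 y hy)

/-- Approximate recovery of a splitting: stretching by a factor close to one moves the mass of `ν`
at the end points into the interior, and optimal damage profiles are put at finitely many atoms. -/
theorem eventually_exists_recovery {L E₀ σ G : ℝ} (hL : 0 < L) (hE₀ : 0 < E₀) (hσ : 0 < σ)
    (hG : 0 < G) {g : ℝ → ℝ} {T : ℕ → Mesh L} {ε : ℕ → ℝ} (hε_pos : ∀ n, 0 < ε n)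
    (hT : Tendsto (fun n => (T n).size) atTop (𝓝 0)) (hε : Tendsto ε atTop (𝓝 0))
    (hTε : (fun n => (T n).size) =o[atTop] ε) {f : ℝ → ℝ} {ν : Measure ℝ}
    (hs : IsSplitting L (g (-L)) (g L) f ν)
    (hb : ∀ x, |primitive (g (-L)) f ν x| ≤ supNorm L g) {p : L1 L × L1 L}
    (hp1 : (p.1 : ℝ → ℝ) =ᵐ[volume.restrict (Icc (-L) L)] primitive (g (-L)) f ν)
    (hp2 : (p.2 : ℝ → ℝ) =ᵐ[volume.restrict (Icc (-L) L)] 0) {t : ℝ}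
    (ht : ENNReal.ofReal (E₀ / 2 * ∫ x, f x ^ 2) + cohesiveEnergy σ G ν < ENNReal.ofReal t)
    {ρ : ℝ} (hρ : 0 < ρ) :
    ∀ᶠ n in atTop, ∃ y, dist y p < ρ ∧
      discreteFunctional E₀ σ G g (T n) (ε n) y ≤ ENNReal.ofReal t := by
  have := hs.finite
  set q := primitive (g (-L)) f ν with hq
  set A : ℝ := E₀ / 2 * ∫ x, f x ^ 2 with hA
  have hA0 : 0 ≤ A := mul_nonneg (by positivity) (integral_nonneg fun x => sq_nonneg _)
  have hcoh : cohesiveEnergy σ G ν < ENNReal.ofReal (t - A) := by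
    rw [ENNReal.ofReal_sub _ hA0]
    exact lt_tsub_iff_left.2 ht
  obtain ⟨F, hF, hFt⟩ := exists_finset_cohesiveEnergy_lt hσ hG ν hcoh
  have hqm : Measurable q := measurable_primitive hs.integrable ν
  have hqc : {x | ¬ ContinuousAt q x}.Countable :=
    countable_not_continuousAt (boundedVariationOn_primitive _ hs.integrable ν)
  -- the stretching factor is so close to `1` that `q (lam x)` is within `ρ / 2` of `q`
  have hlamE : Tendsto (fun lam : ℝ => A * lam) (𝓝[>] 1) (𝓝 (A * 1)) :=
    (tendsto_id.const_mul A).mono_left nhdsWithin_le_nhds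
  obtain ⟨lam, ⟨hlam1, hlamA⟩, hlamρ⟩ := ((eventually_mem_nhdsWithin.and
    (hlamE.eventually_lt_const (u := t - (σ * ν.real (F : Set ℝ)ᶜ +
      ∑ y ∈ F, G * σ * ν.real {y} / (G + σ * ν.real {y}))) (by linarith))).and
    ((tendsto_integral_stretch (L := L) hqm hb hqc).eventually_lt_const
      (by positivity : 0 < ρ / 2))).exists
  have hlam1 : 1 < lam := hlam1
  have hlam0 : 0 < lam := by linarith
  set r : ℝ := L - L / lam with hr
  have hr0 : 0 < r := by
    have : L / lam < L := div_lt_self hL hlam1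
    linarith
  set β : ℝ → ℝ := fun y => optDamage σ G (ν.real {y}) with hβdef
  have hβ : ∀ y, β y ∈ Icc (0 : ℝ) 1 := fun y => optDamage_mem hσ hG measureReal_nonneg
  have hβ0 : ∀ y ∉ Icc (-L) L, β y = 0 := fun y hy => by
    have h1 : ν {y} = 0 := measure_mono_null (singleton_subset_iff.2 hy) hs.measure_compl
    simp [hβdef, optDamage, measureReal_def, h1]
  -- as `h / ε → 0` and `r / ε → ∞`, the bound on the energies tends to the one for `F`
  have hlimE : Tendsto (fun n => E₀ / 2 * (lam * ∫ x, f x ^ 2) +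
      σ * (ν.real (F : Set ℝ)ᶜ + ∑ y ∈ F,
        (1 - (Real.exp (-(T n).size / ε n) - Real.exp (-r / ε n)) * β y) ^ 2 * ν.real {y}) +
      G / 2 * (2 * Real.exp (2 * (T n).size / ε n) * ∑ y ∈ F, β y ^ 2)) atTop
      (𝓝 (E₀ / 2 * (lam * ∫ x, f x ^ 2) +
      σ * (ν.real (F : Set ℝ)ᶜ + ∑ y ∈ F, (1 - (1 - 0) * β y) ^ 2 * ν.real {y}) +
      G / 2 * (2 * 1 * ∑ y ∈ F, β y ^ 2))) := by
    have h0 : Tendsto (fun n => (T n).size / ε n) atTop (𝓝 0) := hTε.tendsto_div_nhds_zero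
    have h1 : Tendsto (fun n => Real.exp (-(T n).size / ε n)) atTop (𝓝 1) := by
      have := (Real.continuous_exp.tendsto (-0)).comp h0.neg
      simpa [Function.comp_def, neg_div] using this
    have h2 : Tendsto (fun n => Real.exp (2 * (T n).size / ε n)) atTop (𝓝 1) := by
      have := (Real.continuous_exp.tendsto (2 * 0)).comp (h0.const_mul 2)
      simpa [Function.comp_def, mul_div_assoc] using this
    have h3 : Tendsto (fun n => Real.exp (-r / ε n)) atTop (𝓝 0) := by
      have h4 : Tendsto (fun n => (ε n)⁻¹) atTop atTop :=
        tendsto_inv_nhdsGT_zero.comp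
          (tendsto_nhdsWithin_iff.2 ⟨hε, Eventually.of_forall hε_pos⟩)
      exact Real.tendsto_exp_atBot.comp (h4.const_mul_atTop_of_neg (by linarith : -r < 0))
    refine (tendsto_const_nhds.add (Tendsto.const_mul _ (Tendsto.const_add _
      (tendsto_finsetSum _ fun y _ => Tendsto.mul_const _ (Tendsto.pow
        (Tendsto.const_sub _ (Tendsto.mul_const _ (h1.sub h3))) 2))))).add
      (Tendsto.const_mul _ (Tendsto.mul_const _ (h2.const_mul 2)))
  have hval : E₀ / 2 * (lam * ∫ x, f x ^ 2) +
      σ * (ν.real (F : Set ℝ)ᶜ + ∑ y ∈ F, (1 - (1 - 0) * β y) ^ 2 * ν.real {y}) +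
      G / 2 * (2 * 1 * ∑ y ∈ F, β y ^ 2) < t := by
    have h1 : σ * (∑ y ∈ F, (1 - (1 - 0) * β y) ^ 2 * ν.real {y}) + G * ∑ y ∈ F, β y ^ 2 =
        ∑ y ∈ F, G * σ * ν.real {y} / (G + σ * ν.real {y}) := by
      rw [Finset.mul_sum, Finset.mul_sum, ← Finset.sum_add_distrib]
      refine Finset.sum_congr rfl fun y _ => ?_
      rw [sub_zero, one_mul]
      exact optDamage_energy hσ hG measureReal_nonneg
    have h2 : E₀ / 2 * (lam * ∫ x, f x ^ 2) = A * lam := by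
      rw [hA]
      ring
    rw [h2]
    linarith
  have hqlam : Measurable fun x => q (lam * x) := hqm.comp (measurable_const_mul lam)
  have hqlamc : {x | ¬ ContinuousAt (fun x => q (lam * x)) x}.Countable := by
    refine (hqc.preimage (mul_right_injective₀ hlam0.ne')).mono fun x hx => ?_
    simp only [mem_preimage, mem_ofPred_eq] at hx ⊢
    refine fun hc => hx ?_
    exact ContinuousAt.comp (f := fun x => lam * x) hc (continuous_const_mul lam).continuousAt
  have hint := tendsto_integral_interp hL hT hqlam (fun x => hb (lam * x)) hqlamc
  have hεsq : Tendsto (fun n => (L - -L) * (2 * t / G * ε n)) atTop (𝓝 0) := by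
    simpa using (hε.const_mul (2 * t / G)).const_mul (L - -L)
  filter_upwards [hlimE.eventually_lt_const hval,
    hint.eventually_lt_const (by positivity : 0 < ρ / 2),
    hεsq.eventually_lt_const (by positivity : 0 < ρ ^ 2)] with n hnE hnv hnd
  set v := (T n).interp fun x => q (lam * x) with hv
  set d := (T n).interp (damage F hF β lam (ε n) r) with hd
  have hadm : Admissible g (T n) v d :=
    admissible_interp hL hlam1 (hε_pos n) (T n) hs hb hF hβ hβ0
  have hen : fullEnergy E₀ σ G (T n) (ε n) v (slip (T n) lam ν) d ≤ t :=
    (fullEnergy_recovery_le hL hE₀ hσ hG hlam0 (hε_pos n) (T n) hs.integrable hs.integrable_sq ν hF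
      hβ).trans hnE.le
  have hvi : IntegrableOn v (Icc (-L) L) := (hadm.u_P1.continuousOn hL).integrableOn_Icc
  have hdi : IntegrableOn d (Icc (-L) L) := (hadm.d_P1.continuousOn hL).integrableOn_Icc
  refine ⟨(hvi.toL1 v, hdi.toL1 d), ?_, (discreteFunctional_toL1_le hadm hvi hdi
    (slip_nonneg (T n) lam ν)).trans (ENNReal.ofReal_le_ofReal hen)⟩
  rw [Prod.dist_eq, max_lt_iff]
  constructor
  · change dist (hvi.toL1 v) p.1 < ρ
    rw [dist_toL1 hvi hp1]
    have hbi : ∀ {w : ℝ → ℝ}, Measurable w → (∀ x, |w x| ≤ supNorm L g) →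
        IntegrableOn w (Icc (-L) L) := fun hw h =>
      Integrable.of_bound hw.aestronglyMeasurable _ (Eventually.of_forall h)
    have h1 : IntegrableOn (fun x => q (lam * x)) (Icc (-L) L) := hbi hqlam fun x => hb _
    have h2 : IntegrableOn q (Icc (-L) L) := hbi hqm hb
    calc ∫ x in Icc (-L) L, |v x - q x|
        ≤ ∫ x in Icc (-L) L, (|v x - q (lam * x)| + |q (lam * x) - q x|) :=
          integral_mono (hvi.sub h2).abs ((hvi.sub h1).abs.add (h1.sub h2).abs)
            fun x => abs_sub_le _ _ _
      _ = (∫ x in Icc (-L) L, |v x - q (lam * x)|) + ∫ x in Icc (-L) L, |q (lam * x) - q x| :=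
          integral_add (hvi.sub h1).abs (h1.sub h2).abs
      _ < ρ := by linarith
  · change dist (hdi.toL1 d) p.2 < ρ
    rw [dist_toL1 hdi hp2]
    have h1 : ∫ x in Icc (-L) L, |d x - (0 : ℝ → ℝ) x| = ∫ x in Ioc (-L) L, d x := by
      rw [integral_Icc_eq_integral_Ioc]
      refine setIntegral_congr_fun measurableSet_Ioc fun x hx => ?_
      simp [abs_of_nonneg (hadm.d_mem x (Ioc_subset_Icc_self hx)).1]
    have h2 := integral_sq_le_of_fullEnergy_le hL hE₀ hσ hG (hε_pos n) hadm.u_P1 hadm.d_P1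
      (slip_nonneg (T n) lam ν) hen
    have h3 : IntegrableOn (fun x => d x ^ 2) (Icc (-L) L) :=
      ((hadm.d_P1.continuousOn hL).pow 2).integrableOn_Icc
    have h4 := sq_integral_Ioc_le (by linarith : -L ≤ L) (hdi.mono_set Ioc_subset_Icc_self)
      (h3.mono_set Ioc_subset_Icc_self)
    rw [h1]
    refine lt_of_pow_lt_pow_left₀ 2 hρ.le (h4.trans_lt (lt_of_le_of_lt ?_ hnd))
    exact mul_le_mul_of_nonneg_left h2 (by linarith)

end CohesiveGamma

end

theorem theorem2p1 (L E₀ σ G : ℝ) (hL : 0 < L) (hE₀ : 0 < E₀) (hσ : 0 < σ) (hG : 0 < G)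
    (g : ℝ → ℝ) (hg : BddAbove ((fun x => |g x|) '' Set.Icc (-L) L))
    (T : ℕ → CohesiveGamma.Mesh L) (ε : ℕ → ℝ) (hε_pos : ∀ n, 0 < ε n)
    (hT : Filter.Tendsto (fun n => (T n).size) Filter.atTop (nhds 0))
    (hε : Filter.Tendsto ε Filter.atTop (nhds 0))
    (hTε : (fun n => (T n).size) =o[Filter.atTop] ε) :
    CohesiveGamma.GammaConverges
      (fun n => CohesiveGamma.discreteFunctional E₀ σ G g (T n) (ε n))
      (CohesiveGamma.limitFunctional L E₀ σ G g) := by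
  open CohesiveGamma in
  refine ⟨fun p y hy => limitFunctional_le_liminf hL hE₀ hσ hG hε_pos hT hε hy, fun p => ?_⟩
  refine exists_recovery_of_approx fun c hc ρ hρ => ?_
  simp only [gt_iff_lt, limitFunctional, iInf_lt_iff] at hc
  obtain ⟨w, hw, hp1, hpb, hjump, hcantor, hp2, hlt⟩ := hc
  obtain ⟨t, -, hlt', htc⟩ := ENNReal.lt_iff_exists_real_btwn.1 hlt
  obtain ⟨f, ν, hs, hprim, hle⟩ :=
    exists_splitting_of_limitEnergy hL hE₀ hσ hG g hw hjump hcantor hlt.ne_top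
  have hgb : ∀ x ∈ Set.Icc (-L) L, |g x| ≤ supNorm L g := fun x hx => le_csSup hg ⟨x, hx, rfl⟩
  have hp1' := hp1.trans hprim.symm
  have hb := hs.abs_primitive_le (hgb _ ⟨le_rfl, by linarith⟩) (hgb _ ⟨by linarith, le_rfl⟩) (by
    filter_upwards [hp1', hpb] with x h1 h2
    rwa [← h1])
  filter_upwards [eventually_exists_recovery hL hE₀ hσ hG hε_pos hT hε hTε hs hb hp1' hp2
    (hle.trans_lt hlt') hρ] with n ⟨y, hy, hFy⟩
  exact ⟨y, hy, hFy.trans htc.le⟩
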